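/- Setting. Let $J\in\mathbb{R}^{2\times2}$ be the rotation by $-\frac{\pi}{2}$; $J$ and $e^{sJ}$ act on each planar component of a vector in $(\mathbb{R}^2)^n$. Let $\Omega\subset\mathbb{R}^2$ be a domain, $k\ge 2$ an integer, and $g:\Omega\times\Omega\to\mathbb{R}$ a symmetric function of class $\mathcal{C}^k$. Put $G(x,y)=-\frac1{2\pi}\log|x-y|-g(x,y)$, $h(x)=g(x,x)$ and $\mathcal{F}_n(\Omega)=\{z\in\Omega^n: z_i\ne z_j \text{ for } i\neq j\}$. (A1$'$) Let $m\ge1$ and $\Gamma^1,\dots,\Gamma^m\in\mathbb{R}\setminus\{0\}$. The point $\alpha\in\mathcal{F}_m(\Omega)$ is a critical point of $\mathcal{H}(a)=\sum_{i\ne i'}\Gamma^i\Gamma^{i'}G(a^i,a^{i'})-\sum_{i}(\Gamma^i)^2h(a^i)$, and one of the following holds: (i) $\alpha$ is nondegenerate; (ii) $e^{sJ}\Omega=\Omega$ and $g(e^{sJ}x,e^{sJ}y)=g(x,y)$ for all $s\in\mathbb{R}$, $x,y\in\Omega$, and $\dim\ker\nabla^2\mathcal{H}(\alpha)=1$; (iii)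 there is $\nu\in\mathbb{R}^2\setminus\{0\}$ with $s\nu+\Omega=\Omega$ and $g(x+s\nu,y+s\nu)=g(x,y)$ for all $s\in\mathbb{R}$, $x,y\in\Omega$, and $\dim\ker\nabla^2\mathcal{H}(\alpha)=1$; (iv) $\Omega=\mathbb{R}^2$, $g(x,y)=\tilde g(|x-y|)$ for some function $\tilde g$, and $\dim\ker\nabla^2\mathcal{H}(\alpha)=3$. (A2) with $l=1$. Let $N_1\ge2$, $N_2=\dots=N_m=1$, $N=\sum_iN_i$, and let $\Gamma^i_j\in\mathbb{R}\setminus\{0\}$ ($1\le i\le m$, $1\le j\le N_i$) satisfy $\sum_{j=1}^{N_i}\Gamma^i_j=\Gamma^i$ for all $i$. (A3$'$) with $l=1$. Permutations act on $(\mathbb{R}^2)^n$ by $(\sigma*z)_j=z_{\sigma^{-1}(j)}$. Let $\sigma_1$ be a permutation of $\{1,\dots,N_1\}$ with $\Gamma^1_j=\Gamma^1_{\sigma_1^{-1}(j)}$ for all $j$, and let $Z^1(t)=e^{\pm tJ/\mathrm{ord}(\sigma_1)}z^1$ (one choice of sign) be a solution of $\Gamma^1_j\dot z_j=J\nabla_{z_j}H_{\mathbb{R}^2}(z)$,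 $1\le j\le N_1$, where $H_{\mathbb{R}^2}(z)=-\frac1{2\pi}\sum_{j\ne j'}\Gamma^1_j\Gamma^1_{j'}\log|z_j-z_{j'}|$ on $\mathcal{F}_{N_1}(\mathbb{R}^2)$. Assume that $Z^1$ is $\sigma_1$-nondegenerate: $\sigma_1*Z^1(\cdot+2\pi)=Z^1$, and the space of solutions $w$ of the linearized equation $\Gamma^1_j\dot w_j=J(\nabla^2H_{\mathbb{R}^2}(Z^1(t))w)_j$ with $\sigma_1*w(\cdot+2\pi)=w$ has dimension $3$. For $i\ge2$ put $Z^i\equiv0$ and $\sigma_i=\mathrm{id}$. Write $Z=(Z^1,0,\dots,0)$, $\sigma=(\sigma_1,\dots,\sigma_m)$, $\sigma*z=(\sigma_1*z^1,\dots,\sigma_m*z^m)$ and $\tau=2\pi\,\mathrm{ord}(\sigma)$. Let $H^1_\tau$ be the space of continuous $\tau$-periodic functions $\mathbb{R}\to\mathbb{R}^{2N}$ with square-integrable derivative, with scalar product $\int_0^\tau\langle u,v\rangle\,dt+\int_0^\tau\langle\dot u,\dot v\rangle\,dt$. For $a\in\mathbb{R}^{2m}$ let $\hat a\in\mathbb{R}^{2N}$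 be the vector with $\hat a^i_j=a^i$. Theorem. Under these assumptions there exist $r_1>0$ and a $\mathcal{C}^{k-2}$ map $u:[0,r_1)\to H^1_\tau$, $r\mapsto u^{(r)}$, such that $u^{(0)}=Z$, such that $\sigma*u^{(r)}(\cdot+2\pi)=u^{(r)}$ for all $r\in[0,r_1)$, and such that for every $r\in(0,r_1)$ the function $$z^{(r)}(t)=r\,u^{(r)}\!\left(\frac{t}{r^2}\right)+\hat\alpha$$ takes values in $\mathcal{F}_N(\Omega)$ and is a $\tau r^2$-periodic solution of $$\Gamma^i_j\dot z^i_j=J\nabla_{z^i_j}H(z),\qquad H(z)=\sum_{(i,j)\ne(i',j')}\Gamma^i_j\Gamma^{i'}_{j'}G(z^i_j,z^{i'}_{j'})-\sum_{(i,j)}(\Gamma^i_j)^2h(z^i_j).$$ If moreover $k\ge3$, then $\partial_ru^{(0)}\in\{\hat a:a\in\mathbb{R}^{2m}\}$, i.e. $\partial_ru^{(0)}$ is a constant function $\hat a$. -/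

import Mathlib

open MeasureTheory Set

noncomputable section

/-! ### The Sobolev space of periodic functions -/

/-- The continuous `T`-periodic functions `u : ℝ → E` with a square-integrable (weak) derivative:
`u` is `T`-periodic and on `[0, T]` it is a primitive of a function in `L²(0, T)`. -/
def hOneSubmodule (T : ℝ) (E : Type*) [NormedAddCommGroup E] [InnerProductSpace ℝ E] :
    Submodule ℝ (ℝ → E) where
  carrier := {u | Function.Periodic u T ∧
    ∃ v : ℝ → E, MemLp v 2 (volume.restrict (Ioc 0 T)) ∧
      ∀ t ∈ Icc 0 T, u t = u 0 + ∫ s in (0 : ℝ)..t, v s}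
  zero_mem' := ⟨fun _ => rfl, 0, MemLp.zero, fun t _ => by simp⟩
  add_mem' := by
    rintro u₁ u₂ ⟨hp₁, v₁, hv₁, h₁⟩ ⟨hp₂, v₂, hv₂, h₂⟩
    refine ⟨hp₁.add hp₂, v₁ + v₂, hv₁.add hv₂, fun t ht => ?_⟩
    have key : ∀ v : ℝ → E, MemLp v 2 (volume.restrict (Ioc 0 T)) →
        IntervalIntegrable v volume 0 t := fun v hv => by
      rw [intervalIntegrable_iff_integrableOn_Ioc_of_le ht.1]
      exact (hv.integrable (by norm_num)).mono_measure
        (Measure.restrict_mono (Ioc_subset_Ioc_right ht.2) le_rfl)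
    simp only [Pi.add_apply]
    rw [intervalIntegral.integral_add (key v₁ hv₁) (key v₂ hv₂), h₁ t ht, h₂ t ht]
    abel
  smul_mem' := by
    rintro c u ⟨hp, v, hv, h⟩
    refine ⟨fun t => by simp [hp t], c • v, hv.const_smul c, fun t ht => ?_⟩
    simp only [Pi.smul_apply]
    rw [intervalIntegral.integral_smul, h t ht, smul_add]

/-- The Sobolev space `H¹(ℝ/Tℤ, E)`. -/
def HOne (T : ℝ) (E : Type*) [NormedAddCommGroup E] [InnerProductSpace ℝ E] : Type _ :=
  hOneSubmodule T E

namespace HOne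

variable {T : ℝ} {E : Type*} [NormedAddCommGroup E] [InnerProductSpace ℝ E]

instance instAddCommGroup : AddCommGroup (HOne T E) :=
  inferInstanceAs (AddCommGroup (hOneSubmodule T E))

instance instModule : Module ℝ (HOne T E) :=
  inferInstanceAs (Module ℝ (hOneSubmodule T E))

/-- Elements of `H¹(ℝ/Tℤ, E)` are functions on `ℝ`. -/
instance instCoeFun : CoeFun (HOne T E) (fun _ => ℝ → E) := ⟨fun u => u.1⟩

theorem ext {u v : HOne T E} (h : ∀ t, u t = v t) : u = v := Subtype.ext (funext h)

theorem add_apply (u v : HOne T E) (t : ℝ) : (u + v) t = u t + v t := rfl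

theorem smul_apply (c : ℝ) (u : HOne T E) (t : ℝ) : (c • u) t = c • u t := rfl

theorem periodic (u : HOne T E) : Function.Periodic (u : ℝ → E) T := u.2.1

theorem ae_hasDerivAt [CompleteSpace E] [hT : Fact (0 < T)] (u : HOne T E) :
    ∃ v : ℝ → E, MemLp v 2 (volume.restrict (Ioc 0 T)) ∧
      (∀ t ∈ Icc 0 T, u t = u 0 + ∫ s in (0 : ℝ)..t, v s) ∧
      ∀ᵐ t ∂(volume.restrict (Ioc 0 T)), HasDerivAt (u : ℝ → E) (v t) t := by
  obtain ⟨-, v, hv, h⟩ := u.2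
  refine ⟨v, hv, h, ?_⟩
  have hi : IntervalIntegrable v volume 0 T := by
    rw [intervalIntegrable_iff_integrableOn_Ioc_of_le hT.out.le]
    exact hv.integrable (by norm_num)
  have hne : ∀ᵐ t : ℝ ∂volume, t ≠ T := by
    simp [ae_iff]
  rw [ae_restrict_iff' measurableSet_Ioc]
  filter_upwards [hi.ae_hasDerivAt_integral, hne] with t ht htT htI
  have hd := ht (by rw [uIcc_of_le hT.out.le]; exact Ioc_subset_Icc_self htI) 0
    (by rw [uIcc_of_le hT.out.le]; exact left_mem_Icc.2 hT.out.le)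
  refine (hd.const_add (u 0)).congr_of_eventuallyEq ?_
  filter_upwards [Icc_mem_nhds htI.1 (lt_of_le_of_ne htI.2 htT)] with s hs
  exact h s hs

theorem ae_differentiableAt [CompleteSpace E] [Fact (0 < T)] (u : HOne T E) :
    ∀ᵐ t ∂(volume.restrict (Ioc 0 T)), DifferentiableAt ℝ (u : ℝ → E) t := by
  obtain ⟨v, -, -, h⟩ := u.ae_hasDerivAt
  filter_upwards [h] with t ht using ht.differentiableAt

theorem memLp_deriv [CompleteSpace E] [Fact (0 < T)] (u : HOne T E) :
    MemLp (deriv (u : ℝ → E)) 2 (volume.restrict (Ioc 0 T)) := by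
  obtain ⟨v, hv, -, h⟩ := u.ae_hasDerivAt
  refine hv.ae_eq ?_
  filter_upwards [h] with t ht using ht.deriv.symm

theorem continuousOn [hT : Fact (0 < T)] (u : HOne T E) : ContinuousOn (u : ℝ → E) (Icc 0 T) := by
  obtain ⟨-, v, hv, h⟩ := u.2
  have hi : IntegrableOn v (Icc 0 T) := by
    rw [integrableOn_Icc_iff_integrableOn_Ioc]
    exact hv.integrable (by norm_num)
  have hc := intervalIntegral.continuousOn_primitive_interval (μ := volume) (f := v) (a := 0)
    (b := T) (by rwa [uIcc_of_le hT.out.le])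
  rw [uIcc_of_le hT.out.le] at hc
  exact (continuousOn_const.add hc).congr h

theorem memLp [hT : Fact (0 < T)] (u : HOne T E) :
    MemLp (u : ℝ → E) 2 (volume.restrict (Ioc 0 T)) := by
  obtain ⟨C, hC⟩ := isCompact_Icc.exists_bound_of_continuousOn u.continuousOn
  refine MemLp.of_bound ((u.continuousOn.mono Ioc_subset_Icc_self).aestronglyMeasurable
    measurableSet_Ioc) C ?_
  rw [ae_restrict_iff' measurableSet_Ioc]
  exact Filter.Eventually.of_forall fun t ht => hC t (Ioc_subset_Icc_self ht)

variable [CompleteSpace E] [hT : Fact (0 < T)]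

/-- The embedding `u ↦ (u, u')` into `L²(0, T) × L²(0, T)`. -/
def toL2 : HOne T E →ₗ[ℝ]
    WithLp 2 (Lp E 2 (volume.restrict (Ioc 0 T)) × Lp E 2 (volume.restrict (Ioc 0 T))) where
  toFun u := WithLp.toLp 2 (u.memLp.toLp _, u.memLp_deriv.toLp _)
  map_add' u v := by
    rw [← WithLp.toLp_add, Prod.mk_add_mk, ← MemLp.toLp_add, ← MemLp.toLp_add]
    congr 2
    rw [MemLp.toLp_eq_toLp_iff]
    filter_upwards [u.ae_differentiableAt, v.ae_differentiableAt] with t hu hv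
    exact deriv_add hu hv
  map_smul' c u := by
    rw [RingHom.id_apply, ← WithLp.toLp_smul, Prod.smul_mk, ← MemLp.toLp_const_smul,
      ← MemLp.toLp_const_smul]
    congr 2
    rw [MemLp.toLp_eq_toLp_iff]
    filter_upwards [u.ae_differentiableAt] with t hu
    exact deriv_const_smul c hu

theorem toL2_injective : Function.Injective (toL2 : HOne T E → _) := by
  intro u v huv
  have h1 : u.memLp.toLp (u : ℝ → E) = v.memLp.toLp (v : ℝ → E) :=
    congrArg (fun p => (WithLp.ofLp p).1) huv
  rw [MemLp.toLp_eq_toLp_iff] at h1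
  have h2 : EqOn (u : ℝ → E) v (Icc 0 T) := by
    refine Measure.eqOn_Icc_of_ae_eq volume hT.out.ne ?_ u.continuousOn v.continuousOn
    rwa [← restrict_Ioc_eq_restrict_Icc]
  refine HOne.ext fun t => ?_
  obtain ⟨s, hs, hst⟩ := (u.periodic.sub v.periodic).exists_mem_Ico₀ hT.out t
  have h3 := h2 (Ico_subset_Icc_self hs)
  simp only [Pi.sub_apply, h3, sub_self] at hst
  exact sub_eq_zero.1 hst

instance instNormedAddCommGroup : NormedAddCommGroup (HOne T E) :=
  NormedAddCommGroup.induced _ _ (toL2 : HOne T E →ₗ[ℝ] _) toL2_injective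

theorem norm_def (u : HOne T E) : ‖u‖ = ‖toL2 u‖ := rfl

/-- The inner product `⟪u, v⟫ = ∫₀ᵀ ⟪u, v⟫ dt + ∫₀ᵀ ⟪u', v'⟫ dt`, see `HOne.inner_eq`. -/
instance instInnerProductSpace : InnerProductSpace ℝ (HOne T E) where
  norm_smul_le c u := by rw [norm_def, norm_def, map_smul]; exact norm_smul_le _ _
  inner u v := inner ℝ (toL2 u) (toL2 v)
  norm_sq_eq_re_inner u := norm_sq_eq_re_inner (𝕜 := ℝ) (toL2 u)
  conj_inner_symm u v := inner_conj_symm (𝕜 := ℝ) (toL2 u) (toL2 v)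
  add_left u v w := by
    simp only [map_add]
    exact inner_add_left (𝕜 := ℝ) (toL2 u) (toL2 v) (toL2 w)
  smul_left u v c := by
    simp only [map_smul]
    exact inner_smul_left (𝕜 := ℝ) (toL2 u) (toL2 v) c

theorem inner_eq (u v : HOne T E) :
    inner ℝ u v = (∫ t in (0 : ℝ)..T, inner ℝ (u t) (v t)) +
      ∫ t in (0 : ℝ)..T, inner ℝ (deriv (u : ℝ → E) t) (deriv (v : ℝ → E) t) := by
  have h : inner ℝ u v = inner ℝ (u.memLp.toLp (u : ℝ → E)) (v.memLp.toLp (v : ℝ → E)) +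
      inner ℝ (u.memLp_deriv.toLp _) (v.memLp_deriv.toLp _) := rfl
  rw [h, L2.inner_def, L2.inner_def, intervalIntegral.integral_of_le hT.out.le,
    intervalIntegral.integral_of_le hT.out.le]
  congr 1
  · refine integral_congr_ae ?_
    filter_upwards [u.memLp.coeFn_toLp, v.memLp.coeFn_toLp] with t h₁ h₂
    rw [h₁, h₂]
  · refine integral_congr_ae ?_
    filter_upwards [u.memLp_deriv.coeFn_toLp, v.memLp_deriv.coeFn_toLp] with t h₁ h₂
    rw [h₁, h₂]

end HOne

/-! ### Point vortices -/

/-- The plane `ℝ²`. -/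
abbrev Plane : Type := EuclideanSpace ℝ (Fin 2)

/-- Positions of vortices indexed by `ι`, with the Euclidean structure of `ℝ^{2|ι|}`. -/
abbrev Conf (ι : Type*) : Type _ := PiLp 2 (fun _ : ι => Plane)

/-- The matrix `J`: rotation of the plane by `-π/2`. -/
def rotJ (x : Plane) : Plane := !₂[x 1, -x 0]

/-- `e^{s J} = (cos s) I + (sin s) J`, since `J² = -I`. -/
def expJ (s : ℝ) (x : Plane) : Plane := Real.cos s • x + Real.sin s • rotJ x

section Vortices

variable {ι : Type*}

/-- Configurations in `Ω` without collisions. -/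
def collisionFree (ι : Type*) (Ω : Set Plane) : Set (Conf ι) :=
  {z | (∀ i, z i ∈ Ω) ∧ ∀ i j, i ≠ j → z i ≠ z j}

/-- The generalized Green's function `G(x, y) = -(1/2π) log |x - y| - g(x, y)`. -/
def greenFun (g : Plane → Plane → ℝ) (x y : Plane) : ℝ :=
  -(1 / (2 * Real.pi)) * Real.log ‖x - y‖ - g x y

/-- The Hamiltonian
`∑_{i ≠ j} Γᵢ Γⱼ G(zᵢ, zⱼ) - ∑ᵢ Γᵢ² g(zᵢ, zᵢ)` of vortices with strengths `Γ`.
The choice `g = 0` is the whole-plane Hamiltonian. -/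
def vortexHam [Fintype ι] [DecidableEq ι] (Γ : ι → ℝ) (g : Plane → Plane → ℝ) (z : Conf ι) : ℝ :=
  (∑ i, ∑ j, if i ≠ j then Γ i * Γ j * greenFun g (z i) (z j) else 0)
    - ∑ i, Γ i * Γ i * g (z i) (z i)

/-- The Hessian `∇²f(z)`, as the derivative of the gradient. -/
def hessianMap [Fintype ι] (f : Conf ι → ℝ) (z : Conf ι) : Conf ι →L[ℝ] Conf ι :=
  fderiv ℝ (gradient f) z

/-- `z : ℝ → 𝓕(Ω)` solves `Γᵢ żᵢ = J ∇_{zᵢ} H(z)` on `ℝ`. -/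
def IsVortexSolution [Fintype ι] [DecidableEq ι] (Ω : Set Plane) (Γ : ι → ℝ)
    (g : Plane → Plane → ℝ) (z : ℝ → Conf ι) : Prop :=
  (∀ t, z t ∈ collisionFree ι Ω) ∧ Differentiable ℝ z ∧
    ∀ t i, Γ i • (deriv z t) i = rotJ ((gradient (vortexHam Γ g) (z t)) i)

/-- The action `(σ * z)_j = z_{σ⁻¹(j)}` of permutations. -/
def permAct (σ : Equiv.Perm ι) (z : Conf ι) : Conf ι := WithLp.toLp 2 fun j => z (σ⁻¹ j)

/-- The rigid rotation `t ↦ e^{ω J t} z` about the origin. -/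
def rigidRotation (ω : ℝ) (z : Conf ι) (t : ℝ) : Conf ι :=
  WithLp.toLp 2 fun i => expJ (ω * t) (z i)

/-- The solutions `w` of the linearization `Γⱼ ẇⱼ = J (∇²H_{ℝ²}(Z(t)) w)ⱼ` of the whole-plane
system along `Z` that satisfy `σ * w(· + 2π) = w`. -/
def linearizedSolutions [Fintype ι] [DecidableEq ι] (Γ : ι → ℝ) (σ : Equiv.Perm ι)
    (Z : ℝ → Conf ι) : Submodule ℝ (ℝ → Conf ι) where
  carrier := {w | Differentiable ℝ w ∧
    (∀ t j, Γ j • (deriv w t) j = rotJ ((hessianMap (vortexHam Γ 0) (Z t) (w t)) j)) ∧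
    ∀ t, permAct σ (w (t + 2 * Real.pi)) = w t}
  zero_mem' := by
    refine ⟨differentiable_const 0, fun t j => ?_, fun t => ?_⟩
    · have : deriv (0 : ℝ → Conf ι) t = 0 := deriv_const t 0
      ext k
      fin_cases k <;> simp [this, rotJ]
    · ext j k
      simp [permAct]
  add_mem' := by
    rintro w₁ w₂ ⟨hd₁, h₁, hp₁⟩ ⟨hd₂, h₂, hp₂⟩
    refine ⟨hd₁.add hd₂, fun t j => ?_, fun t => ?_⟩
    · have : deriv (w₁ + w₂) t = deriv w₁ t + deriv w₂ t := deriv_add (hd₁ t) (hd₂ t)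
      rw [this, PiLp.add_apply, smul_add, h₁, h₂, Pi.add_apply, map_add]
      ext k
      fin_cases k <;> simp [rotJ, add_comm]
    · change permAct σ (w₁ (t + 2 * Real.pi)) + permAct σ (w₂ (t + 2 * Real.pi)) = w₁ t + w₂ t
      rw [hp₁, hp₂]
  smul_mem' := by
    rintro c w ⟨hd, h, hp⟩
    refine ⟨hd.const_smul c, fun t j => ?_, fun t => ?_⟩
    · have : deriv (c • w) t = c • deriv w t := deriv_const_smul c (hd t)
      rw [this, PiLp.smul_apply, smul_comm, h, Pi.smul_apply, map_smul]
      ext k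
      fin_cases k <;> simp [rotJ]
    · change c • permAct σ (w (t + 2 * Real.pi)) = c • w t
      rw [hp]

/-- A whole-plane relative equilibrium solution `Z(t) = e^{ω J t} z`, `ω ≠ 0`. -/
def IsRelativeEquilibrium [Fintype ι] [DecidableEq ι] (Γ : ι → ℝ) (Z : ℝ → Conf ι) : Prop :=
  IsVortexSolution univ Γ 0 Z ∧ ∃ ω : ℝ, ω ≠ 0 ∧ ∃ z : Conf ι, Z = rigidRotation ω z

/-- A relative equilibrium solution `Z` is `σ`-nondegenerate if `σ * Z(· + 2π) = Z` and the
linearization along `Z` has exactly three linearly independent solutions with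
`σ * w(· + 2π) = w`. -/
def IsSigmaNondegenerate [Fintype ι] [DecidableEq ι] (Γ : ι → ℝ) (σ : Equiv.Perm ι)
    (Z : ℝ → Conf ι) : Prop :=
  IsRelativeEquilibrium Γ Z ∧ (∀ t, permAct σ (Z (t + 2 * Real.pi)) = Z t) ∧
    Module.finrank ℝ (linearizedSolutions Γ σ Z) = 3

/-- The point `α` is a collision-free critical point of the `m`-vortex Hamiltonian `𝓗`, which is
nondegenerate up to the symmetries of `Ω` and `g`. -/
def IsAdmissibleCriticalPoint [Fintype ι] [DecidableEq ι] (Ω : Set Plane)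
    (g : Plane → Plane → ℝ) (Γ : ι → ℝ) (α : Conf ι) : Prop :=
  α ∈ collisionFree ι Ω ∧ gradient (vortexHam Γ g) α = 0 ∧
  ( -- `α` is nondegenerate
    (hessianMap (vortexHam Γ g) α).ker = ⊥ ∨
    -- rotational invariance
    ((∀ s : ℝ, expJ s '' Ω = Ω) ∧
      (∀ s : ℝ, ∀ x ∈ Ω, ∀ y ∈ Ω, g (expJ s x) (expJ s y) = g x y) ∧
      Module.finrank ℝ (hessianMap (vortexHam Γ g) α).ker = 1) ∨
    -- translational invariance in one direction
    ((∃ ν : Plane, ν ≠ 0 ∧ ∀ s : ℝ, (fun x => s • ν + x) '' Ω = Ω ∧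
        ∀ x ∈ Ω, ∀ y ∈ Ω, g (x + s • ν) (y + s • ν) = g x y) ∧
      Module.finrank ℝ (hessianMap (vortexHam Γ g) α).ker = 1) ∨
    -- the whole plane with `g` depending on the distance only
    (Ω = univ ∧ (∃ g₀ : ℝ → ℝ, ∀ x y, g x y = g₀ ‖x - y‖) ∧
      Module.finrank ℝ (hessianMap (vortexHam Γ g) α).ker = 3))

end Vortices

/-! ### Clusters of vortices

The `m` clusters are indexed by `Fin m`, the `k`th one consists of `N k` vortices, and
`(k, j) : Σ k, Fin (N k)` stands for the `j`th vortex of the `k`th cluster. -/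

section Clusters

variable {m : ℕ} {N : Fin m → ℕ}

/-- The embedding `a ↦ â = (a¹, …, a¹, …, aᵐ, …, aᵐ)`. -/
def hatConf (N : Fin m → ℕ) (a : Conf (Fin m)) : Conf (Σ k, Fin (N k)) :=
  WithLp.toLp 2 fun i => a i.1

/-- The configuration `(Z¹, …, Zᵐ)` put together from the clusters `Zᵏ`. -/
def joinConf (Z : ∀ k, Conf (Fin (N k))) : Conf (Σ k, Fin (N k)) :=
  WithLp.toLp 2 fun i => Z i.1 i.2

/-- The action `σ * z = (σ₁ * z¹, …, σ_m * zᵐ)` for `σ = (σ₁, …, σ_m) ∈ ∏ₖ Σ_{Nₖ}`. -/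
def clusterPermAct (σ : ∀ k, Equiv.Perm (Fin (N k))) (z : Conf (Σ k, Fin (N k))) :
    Conf (Σ k, Fin (N k)) :=
  WithLp.toLp 2 fun i => z ⟨i.1, (σ i.1)⁻¹ i.2⟩

/-- The period `τ = 2π ord(σ)`, with `ord(σ)` the order of `σ` in the group `∏ₖ Σ_{Nₖ}`. -/
def tauPeriod (σ : ∀ k, Equiv.Perm (Fin (N k))) : ℝ := 2 * Real.pi * orderOf σ

instance fact_tauPeriod_pos (σ : ∀ k, Equiv.Perm (Fin (N k))) : Fact (0 < tauPeriod σ) :=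
  ⟨mul_pos Real.two_pi_pos (Nat.cast_pos.2 (orderOf_pos σ))⟩

end Clusters

end

/-! Blow up at the critical point: put z(t) = α̂ + b̂ + r y(t/r²) with b ∈ ℝ^{2m}. The Hamiltonian
is the sum of the whole-plane interaction inside the clusters, whose gradient ignores translations
of clusters and is homogeneous of degree -1 (`gradient_clusterHam_smul`), and of a part that stays
regular when clusters collapse and whose gradient there is given by that of 𝓗
(`gradient_regularHam_hatCLM`). The equation becomes ẏ = Y(h(y) + r f(b̂ + r y)), where Y divides by
the vorticities and applies J, h is the gradient of the first part and f that of the second one,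
recentred at α̂. At r = 0, b = 0 it is solved by Z. The curve of solutions for small r comes from
the implicit function theorem in ℝ^{2m} × C([0, 2π]) for the boundary condition σ * y(2π) = y(0).

Z is a degenerate solution: the linearization has the translations of clusters and Ż in its kernel,
and ∇²𝓗(α) may have a kernel too. The centres of vorticity of y are therefore normalized to 0, their
motion being carried by b, and two multiplier terms are added, one measuring the phase of y and one
the component of b in the kernel of ∇²𝓗(α). The linearization is then a Volterra operator of the
second kind plus a finite-rank term, so injectivity suffices (`bijective_fderiv_bvp`).

Afterwards the multipliers turn out to be zero (`multipliers_eq_zero`). The energy takes the same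
value at both ends of the time interval, so by Rolle its derivative vanishes somewhere, and this
derivative is the phase multiplier times a nonzero number. The same argument with a Noether integral
removes the other multiplier, because every kernel vector of ∇²𝓗(α) is an infinitesimal rigid motion
that preserves all the Hamiltonians (`IsAdmissibleCriticalPoint.exists_rigidField`).

Since f(0) = 0 and Z is centred at 0, the derivative of the equations in r vanishes at the base
point, so b and y have zero derivative at r = 0. Hadamard's lemma gives b = r a(r) with a(0) = 0, at
the cost of one derivative, and u = â(r) + y. Hence u is Z at r = 0 and its derivative there is the
constant â'(0). The twisted boundary condition extends the solution to ℝ, with period 2π ord(σ). -/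

noncomputable section

open Filter Topology

/-! ### Superposition operators on spaces of continuous functions. -/

section Nemytskii

variable {X : Type} [TopologicalSpace X] [CompactSpace X]

/-- The superposition operator `u ↦ f ∘ u` is of class `C^n` if `f` is. -/
theorem contDiff_continuousMap_comp (n : ℕ) {E : Type} [NormedAddCommGroup E] [NormedSpace ℝ E] :
    ∀ {F : Type} [NormedAddCommGroup F] [NormedSpace ℝ F] (f : C(E, F)),
      ContDiff ℝ n f → ContDiff ℝ n (fun u : C(X, E) => f.comp u) := by
  -- The derivative at u is multiplication by f' ∘ u, which depends on f' ∘ u through the bounded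
  -- linear map `L`. Smoothness of u ↦ f ∘ u thus reduces to that of u ↦ f' ∘ u, and the induction
  -- has to let the target space F vary.
  have key : ∀ {F : Type} [NormedAddCommGroup F] [NormedSpace ℝ F] (f : C(E, F))
      (f' : C(E, E →L[ℝ] F)), (∀ x, HasFDerivAt f (f' x) x) →
      ∃ L : C(X, E →L[ℝ] F) →L[ℝ] C(X, E) →L[ℝ] C(X, F),
      ∀ u : C(X, E), HasFDerivAt (fun u : C(X, E) => f.comp u) (L (f'.comp u)) u := by
    intro F _ _ f f' hf'
    have hbd : ∀ (A : C(X, E →L[ℝ] F)) (w : C(X, E)),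
        ‖(⟨fun t => A t (w t), by fun_prop⟩ : C(X, F))‖ ≤ ‖A‖ * ‖w‖ := fun A w => by
      rw [ContinuousMap.norm_le _ (mul_nonneg (norm_nonneg A) (norm_nonneg w))]
      intro t
      exact ((A t).le_opNorm _).trans (mul_le_mul (A.norm_coe_le_norm t) (w.norm_coe_le_norm t)
        (norm_nonneg _) (norm_nonneg A))
    let L₁ : C(X, E →L[ℝ] F) → C(X, E) →L[ℝ] C(X, F) := fun A =>
      LinearMap.mkContinuous
        { toFun := fun w => ⟨fun t => A t (w t), by fun_prop⟩
          map_add' := fun w₁ w₂ => by ext t; simp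
          map_smul' := fun c w => by ext t; simp } ‖A‖ (hbd A)
    let L : C(X, E →L[ℝ] F) →L[ℝ] C(X, E) →L[ℝ] C(X, F) :=
      LinearMap.mkContinuous
        { toFun := L₁
          map_add' := fun A₁ A₂ => by ext w t; rfl
          map_smul' := fun c A => by ext w t; rfl } 1 fun A => by
        rw [one_mul]
        exact ContinuousLinearMap.opNorm_le_bound _ (norm_nonneg A) (hbd A)
    refine ⟨L, fun u => ?_⟩
    · rw [hasFDerivAt_iff_isLittleO_nhds_zero, Asymptotics.isLittleO_iff]
      intro c hc
      have hcont : Continuous fun w : C(X, E) => f'.comp (u + w) :=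
        (ContinuousMap.continuous_postcomp f').comp (continuous_const.add continuous_id)
      obtain ⟨δ, hδ, hball⟩ := (Metric.continuousAt_iff (α := C(X, E))
        (β := C(X, E →L[ℝ] F))).1 (hcont.continuousAt (x := 0)) c hc
      filter_upwards [Metric.ball_mem_nhds (0 : C(X, E)) hδ] with w hw
      rw [ContinuousMap.norm_le _ (by positivity)]
      intro t
      -- A point of the segment is the value at t of u + θw, and θw is no larger than w, so the
      -- uniform continuity statement for f' ∘ (u + ·) applies with the same δ for all t.
      have hseg : ∀ y ∈ segment ℝ (u t) (u t + w t), ‖f' y - f' (u t)‖ ≤ c := by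
        intro y hy
        rw [segment_eq_image'] at hy
        obtain ⟨θ, hθ, rfl⟩ := hy
        have h1 : dist (θ • w) 0 < δ := by
          rw [dist_zero_right, norm_smul, Real.norm_of_nonneg hθ.1]
          rw [Metric.mem_ball, dist_zero_right] at hw
          exact (mul_le_of_le_one_left (norm_nonneg _) hθ.2).trans_lt hw
        have h2 := (hball h1).le
        have h3 := ContinuousMap.dist_apply_le_dist (f := f'.comp (u + θ • w))
          (g := f'.comp (u + 0)) t
        rw [dist_eq_norm] at h3
        simpa using h3.trans h2
      have := (convex_segment (u t) (u t + w t)).norm_image_sub_le_of_norm_hasFDerivWithin_le'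
        (f := f) (fun y hy => (hf' y).hasFDerivWithinAt) hseg
        (left_mem_segment ℝ _ _) (right_mem_segment ℝ _ _)
      rw [add_sub_cancel_left] at this
      exact this.trans (mul_le_mul_of_nonneg_left (w.norm_coe_le_norm t) hc.le)
  induction n with
  | zero =>
    intro F _ _ f hf
    rw [Nat.cast_zero, contDiff_zero]
    exact ContinuousMap.continuous_postcomp f
  | succ n ih =>
    intro F _ _ f hf
    obtain ⟨f', hf', hd⟩ := contDiff_succ_iff_hasFDerivAt.1 (by exact_mod_cast hf)
    obtain ⟨L, hL⟩ := key f ⟨f', hf'.continuous⟩ hd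
    exact_mod_cast contDiff_succ_iff_hasFDerivAt.2
      ⟨fun u => L ((⟨f', hf'.continuous⟩ : C(E, E →L[ℝ] F)).comp u),
        L.contDiff.comp (ih ⟨f', hf'.continuous⟩ hf'), hL⟩

/-- The derivative of the superposition operator, evaluated pointwise. -/
theorem fderiv_continuousMap_comp_apply {E F : Type} [NormedAddCommGroup E] [NormedSpace ℝ E]
    [NormedAddCommGroup F] [NormedSpace ℝ F] (f : C(E, F)) (hf : ContDiff ℝ 1 f)
    (u w : C(X, E)) (t : X) :
    fderiv ℝ (fun u : C(X, E) => f.comp u) u w t = fderiv ℝ f (u t) (w t) := by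
  have h1 : DifferentiableAt ℝ (fun u : C(X, E) => f.comp u) u :=
    (contDiff_continuousMap_comp 1 f (by exact_mod_cast hf)).differentiable (by simp) u
  have h2 := (ContinuousMap.evalCLM ℝ t).hasFDerivAt.comp u h1.hasFDerivAt
  have h3 := ((hf.differentiable (by simp)) (u t)).hasFDerivAt.comp u
    (ContinuousMap.evalCLM ℝ t : C(X, E) →L[ℝ] E).hasFDerivAt
  exact DFunLike.congr_fun (h2.unique h3) w

end Nemytskii

/-! ### Finite-rank perturbations. -/

section Linear

/-- An injective finite-rank perturbation of a bijective linear map is bijective. -/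
theorem bijective_add_of_finiteDimensional {V W D : Type*} [AddCommGroup V] [Module ℝ V]
    [AddCommGroup W] [Module ℝ W] [AddCommGroup D] [Module ℝ D] [FiniteDimensional ℝ D]
    (A : V →ₗ[ℝ] W) (hA : Function.Bijective A) (R : V →ₗ[ℝ] D) (i : D →ₗ[ℝ] W)
    (h : ∀ x, A x + i (R x) = 0 → x = 0) : Function.Bijective (A + i ∘ₗ R) := by
  let Ae := LinearEquiv.ofBijective A hA
  have hAe : ∀ x, A (Ae.symm x) = x := fun x => Ae.apply_symm_apply x
  refine ⟨(injective_iff_map_eq_zero _).2 fun x hx => h x hx, fun y => ?_⟩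
  -- Solving (A + iR)x = y for d = Rx reduces to (1 + R A⁻¹ i)d = R A⁻¹ y in the finite-dimensional
  -- space, where injectivity gives surjectivity.
  let M : D →ₗ[ℝ] D := LinearMap.id + R ∘ₗ Ae.symm.toLinearMap ∘ₗ i
  have hM : Function.Injective M := by
    refine (injective_iff_map_eq_zero _).2 fun d hd => ?_
    have hd' : d + R (Ae.symm (i d)) = 0 := hd
    have h1 := h (Ae.symm (i d)) (by
      rw [hAe, ← map_add, hd', map_zero])
    rw [h1, map_zero, add_zero] at hd'
    exact hd'
  obtain ⟨d, hd⟩ := LinearMap.injective_iff_surjective.1 hM (R (Ae.symm y))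
  have hd' : d + R (Ae.symm (i d)) = R (Ae.symm y) := hd
  refine ⟨Ae.symm (y - i d), ?_⟩
  simp only [LinearMap.add_apply, LinearMap.comp_apply]
  rw [hAe, map_sub, map_sub, ← hd']
  simp

end Linear

/-! ### Primitives and Volterra operators. -/

section Primitive

variable {T : ℝ} {E : Type} [NormedAddCommGroup E] [NormedSpace ℝ E]

/-- The primitive vanishing at `0` of a continuous function on `[0, T]`. -/
def primitiveCLM (hT : 0 ≤ T) : C(Icc (0 : ℝ) T, E) →L[ℝ] C(Icc (0 : ℝ) T, E) :=
  LinearMap.mkContinuous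
    { toFun := fun w => ⟨fun t => ∫ s in (0 : ℝ)..t, IccExtend hT w s, by
        have hc : Continuous (IccExtend hT w) := w.continuous.Icc_extend'
        exact (intervalIntegral.continuous_primitive
          (fun a b => hc.intervalIntegrable a b) 0).comp continuous_subtype_val⟩
      map_add' := fun v w => by
        ext t
        have hv : Continuous (IccExtend hT v) := v.continuous.Icc_extend'
        have hw : Continuous (IccExtend hT w) := w.continuous.Icc_extend'
        exact intervalIntegral.integral_add (hv.intervalIntegrable _ _) (hw.intervalIntegrable _ _)
      map_smul' := fun c w => by
        ext t
        exact intervalIntegral.integral_smul c (IccExtend hT w) } T fun w => by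
    rw [ContinuousMap.norm_le _ (by positivity)]
    intro t
    refine (intervalIntegral.norm_integral_le_of_norm_le_const
      (fun s _ => w.norm_coe_le_norm _)).trans ?_
    rw [sub_zero, abs_of_nonneg t.2.1, mul_comm]
    exact mul_le_mul_of_nonneg_right t.2.2 (norm_nonneg _)

theorem primitiveCLM_apply (hT : 0 ≤ T) (w : C(Icc (0 : ℝ) T, E)) (t : Icc (0 : ℝ) T) :
    primitiveCLM hT w t = ∫ s in (0 : ℝ)..t, IccExtend hT w s := rfl

theorem primitiveCLM_zero (hT : 0 ≤ T) (w : C(Icc (0 : ℝ) T, E)) :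
    primitiveCLM hT w ⟨0, left_mem_Icc.2 hT⟩ = 0 := by
  simp [primitiveCLM_apply]

/-- A Volterra operator `V` of the second kind is bijective: `1 - V` is invertible for
`V w = ∫ A w`. -/
theorem bijective_sub_volterra [CompleteSpace E] (hT : 0 ≤ T)
    (A : C(Icc (0 : ℝ) T, E) →L[ℝ] C(Icc (0 : ℝ) T, E)) {c : ℝ} (hc : 0 ≤ c)
    (hA : ∀ w t, ‖A w t‖ ≤ c * ‖w t‖) :
    Function.Bijective fun w => w - primitiveCLM hT (A w) := by
  let V : C(Icc (0 : ℝ) T, E) →L[ℝ] C(Icc (0 : ℝ) T, E) := (primitiveCLM hT).comp A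
  -- The pointwise hypothesis on A lets the estimate be iterated under the integral. The factorial
  -- makes some power of V a contraction for any length T, without a smallness assumption.
  have hV : ∀ (n : ℕ) w (t : Icc (0 : ℝ) T),
      ‖(V ^ n) w t‖ ≤ (c * t) ^ n / n.factorial * ‖w‖ := by
    intro n
    induction n with
    | zero => intro w t; simpa using w.norm_coe_le_norm t
    | succ n ih =>
      intro w t
      rw [pow_succ']
      change ‖∫ s in (0 : ℝ)..t, IccExtend hT (A ((V ^ n) w)) s‖ ≤ _
      have hb : ∀ s ∈ Icc (0 : ℝ) t, ‖IccExtend hT (A ((V ^ n) w)) s‖ ≤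
          c * ((c * s) ^ n / n.factorial * ‖w‖) := by
        intro s hs
        have hs' : s ∈ Icc 0 T := ⟨hs.1, hs.2.trans t.2.2⟩
        rw [IccExtend_of_mem hT _ hs']
        exact (hA _ _).trans (mul_le_mul_of_nonneg_left (ih w ⟨s, hs'⟩) hc)
      refine (intervalIntegral.norm_integral_le_of_norm_le t.2.1
        (Eventually.of_forall fun s hs => hb s (Ioc_subset_Icc_self hs))
        (Continuous.intervalIntegrable (by fun_prop) _ _)).trans (le_of_eq ?_)
      have : ∀ s : ℝ, c * ((c * s) ^ n / n.factorial * ‖w‖) =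
          (c ^ (n + 1) / n.factorial * ‖w‖) * s ^ n := fun s => by ring
      simp only [this, intervalIntegral.integral_const_mul, integral_pow]
      have h1 : ((n : ℝ) + 1) ≠ 0 := by positivity
      have h2 : (n.factorial : ℝ) ≠ 0 := by positivity
      rw [Nat.factorial_succ]
      push_cast
      field_simp
      ring
  have hlim := FloorSemiring.tendsto_pow_div_factorial_atTop (c * T)
  obtain ⟨n, hn⟩ := ((hlim.eventually_lt_const (u := 1 / 2) (by norm_num))).exists
  have hnorm : ‖V ^ n‖ < 1 := by
    refine lt_of_le_of_lt (ContinuousLinearMap.opNorm_le_bound _ (by positivity) fun w => ?_)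
      (hn.trans (by norm_num))
    rw [ContinuousMap.norm_le _ (by positivity)]
    intro t
    refine (hV n w t).trans (mul_le_mul_of_nonneg_right ?_ (norm_nonneg _))
    have := t.2.1
    gcongr
    exact t.2.2
  have hu : IsUnit (1 - V ^ n) := by
    have := isUnit_one_sub_of_norm_lt_one (R := C(Icc (0 : ℝ) T, E) →L[ℝ] C(Icc (0 : ℝ) T, E)) hnorm
    exact this
  have hu' : IsUnit (1 - V) := by
    -- 1 - V commutes with the geometric sum and their product 1 - Vⁿ is a unit, so 1 - V is a unit.
    have hcomm : Commute (1 - V) (∑ i ∈ Finset.range n, V ^ i) :=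
      Commute.sum_right _ _ _ fun i _ => ((Commute.one_left _).sub_left ((Commute.refl V).pow_right i))
    exact (hcomm.isUnit_mul_iff.1 ((mul_neg_geom_sum V n).symm ▸ hu)).1
  obtain ⟨W, hW⟩ := hu'
  have h1 : ∀ w, (↑W⁻¹ : C(Icc (0 : ℝ) T, E) →L[ℝ] _) (w - V w) = w := fun w => by
    have := DFunLike.congr_fun (W.inv_mul) w
    rw [hW] at this
    exact this
  have h2 : ∀ w, (↑W⁻¹ : C(Icc (0 : ℝ) T, E) →L[ℝ] C(Icc (0 : ℝ) T, E)) w -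
      V ((↑W⁻¹ : C(Icc (0 : ℝ) T, E) →L[ℝ] _) w) = w := fun w => by
    have := DFunLike.congr_fun (W.mul_inv) w
    rw [hW] at this
    exact this
  refine ⟨fun v w hvw => ?_, fun w => ⟨_, h2 w⟩⟩
  rw [← h1 v, ← h1 w]
  exact congrArg _ hvw

end Primitive

/-! ### Implicit function theorem, cut-off and Hadamard's lemma. -/

section Implicit

/-- Implicit function theorem for a one-parameter family of `C^n` equations, in the case where the
derivative with respect to the parameter vanishes at the base point. -/
theorem exists_implicit_curve {Y W : Type} [NormedAddCommGroup Y] [NormedSpace ℝ Y]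
    [CompleteSpace Y] [NormedAddCommGroup W] [NormedSpace ℝ W] [CompleteSpace W] {n : ℕ}
    (hn : n ≠ 0) (G : ℝ × Y → W) (hG : ContDiff ℝ n G) (y₀ : Y) (h₀ : G (0, y₀) = 0)
    (hbij : Function.Bijective fun w => fderiv ℝ G (0, y₀) (0, w))
    (hr : fderiv ℝ G (0, y₀) (1, 0) = 0) :
    ∃ y : ℝ → Y, ContDiffAt ℝ n y 0 ∧ y 0 = y₀ ∧ HasDerivAt y 0 0 ∧
      ∀ᶠ r in 𝓝 0, G (r, y r) = 0 := by
  have hn' : ((n : ℕ) : WithTop ℕ∞) ≠ 0 := by exact_mod_cast hn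
  have hinv : (fderiv ℝ G (0, y₀) ∘L .inr ℝ ℝ Y).IsInvertible :=
    ⟨ContinuousLinearEquiv.ofBijective (fderiv ℝ G (0, y₀) ∘L .inr ℝ ℝ Y)
      (LinearMap.ker_eq_bot.2 hbij.1) (LinearMap.range_eq_top.2 hbij.2), rfl⟩
  have hc : ContDiffAt ℝ n G (0, y₀) := hG.contDiffAt
  refine ⟨hc.implicitFunction hn' hinv, hc.contDiffAt_implicitFunction hn' hinv,
    hc.implicitFunction_apply_self hn' hinv, ?_, ?_⟩
  -- The derivative of the implicit function is minus the inverse of the partial derivative in y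
  -- applied to the partial derivative in r, and the latter is zero.
  · have := (hc.hasStrictFDerivAt_implicitFunction hn' hinv).hasFDerivAt.hasDerivAt
    simpa [hr] using this
  · simpa [h₀] using hc.eventually_apply_implicitFunction hn' hinv

/-- A `C^n` function on a neighbourhood of a compact set agrees near that set with a function of
class `C^n` on the whole space. -/
theorem exists_contDiff_eqOn_nhds {E F : Type} [NormedAddCommGroup E] [NormedSpace ℝ E]
    [FiniteDimensional ℝ E] [NormedAddCommGroup F] [NormedSpace ℝ F] {n : ℕ} {f : E → F}
    {U K : Set E} (hU : IsOpen U) (hf : ContDiffOn ℝ n f U) (hK : IsCompact K) (hKU : K ⊆ U) :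
    ∃ f' : E → F, ContDiff ℝ n f' ∧ ∃ V, IsOpen V ∧ K ⊆ V ∧ V ⊆ U ∧ EqOn f' f V := by
  obtain ⟨t, ht, hKt, htU⟩ := exists_compact_between hK hU hKU
  obtain ⟨χ, h1, h0, -⟩ := exists_contMDiffMap_one_nhds_of_subset_interior
    (modelWithCornersSelf ℝ E) (n := n) hK.isClosed hKt
  have hχ : ContDiff ℝ n χ := contMDiff_iff_contDiff.1 χ.contMDiff
  obtain ⟨V, hV, hKV, hV1⟩ := (mem_nhdsSet_iff_exists).1 h1
  refine ⟨fun x => χ x • f x, ?_, V ∩ U, hV.inter hU, subset_inter hKV hKU, inter_subset_right,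
    fun x hx => ?_⟩
  · rw [contDiff_iff_contDiffAt]
    intro x
    by_cases hx : x ∈ U
    · exact hχ.contDiffAt.smul (hf.contDiffAt (hU.mem_nhds hx))
    · refine (contDiffAt_const (c := (0 : F))).congr_of_eventuallyEq ?_
      filter_upwards [ht.isClosed.isOpen_compl.mem_nhds fun h => hx (htU h)] with y hy
      rw [h0 y hy, zero_smul]
  · have : χ x = 1 := hV1 hx.1
    simp [this]

/-- Hadamard's lemma: a `C^{n+1}` curve vanishing at `0` is `r ↦ r • a r` with `a` of class
`C^n`. -/
theorem exists_contDiffAt_smul {B : Type} [NormedAddCommGroup B] [NormedSpace ℝ B]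
    [CompleteSpace B] {n : ℕ} {b : ℝ → B} (hb : ContDiffAt ℝ (n + 1 : ℕ) b 0) (h0 : b 0 = 0) :
    ∃ a : ℝ → B, ContDiffAt ℝ n a 0 ∧ a 0 = deriv b 0 ∧ ∀ᶠ r in 𝓝 0, b r = r • a r := by
  obtain ⟨U₀, hU₀, hbU₀⟩ := hb.contDiffOn le_rfl (by simp)
  obtain ⟨U, hUU₀, hU, h0U⟩ := mem_nhds_iff.1 hU₀
  obtain ⟨f, hf, V, hV, h0V, -, hfV⟩ := exists_contDiff_eqOn_nhds hU
    (hbU₀.mono hUU₀) (isCompact_singleton (x := (0 : ℝ)))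
    (singleton_subset_iff.2 h0U)
  have h0V' : V ∈ 𝓝 (0 : ℝ) := hV.mem_nhds (h0V rfl)
  have hfd : Differentiable ℝ f := hf.differentiable (by simp)
  have hf' : ContDiff ℝ n (deriv f) :=
    (contDiff_succ_iff_deriv.1 (by exact_mod_cast hf)).2.2
  -- The quotient is a(r) = ∫₀¹ b'(rs) ds. Its regularity in r comes from the superposition operator
  -- of b' along the linear curve r ↦ r • ι in C([0, 1]), which replaces differentiation under the
  -- integral.
  let ι : C(Icc (0 : ℝ) 1, ℝ) := ⟨fun t => t, continuous_subtype_val⟩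
  let f'c : C(ℝ, B) := ⟨deriv f, hf'.continuous⟩
  have hN := (contDiff_continuousMap_comp (X := Icc (0 : ℝ) 1) n f'c hf')
  let Ev : C(Icc (0 : ℝ) 1, B) →L[ℝ] B :=
    (ContinuousMap.evalCLM ℝ ⟨1, right_mem_Icc.2 zero_le_one⟩).comp (primitiveCLM zero_le_one)
  have hEv : ∀ r : ℝ, Ev (f'c.comp (r • ι)) = ∫ s in (0 : ℝ)..1, deriv f (r * s) := by
    intro r
    change (∫ s in (0 : ℝ)..1, IccExtend zero_le_one (f'c.comp (r • ι)) s) = _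
    refine intervalIntegral.integral_congr fun s hs => ?_
    rw [uIcc_of_le zero_le_one] at hs
    simp only [IccExtend_of_mem _ _ hs]
    rfl
  refine ⟨fun r => Ev (f'c.comp (r • ι)), ?_, ?_, ?_⟩
  · have h1 : ContDiff ℝ n fun r : ℝ => r • ι := contDiff_id.smul contDiff_const
    exact (Ev.contDiff.comp (hN.comp h1)).contDiffAt
  · beta_reduce
    rw [hEv]
    have : f =ᶠ[𝓝 0] b := by filter_upwards [h0V'] with x hx using hfV hx
    simp [this.deriv_eq]
  · filter_upwards [h0V'] with r hr
    rw [hEv, ← intervalIntegral.integral_smul]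
    have hd : ∀ s ∈ uIcc (0 : ℝ) 1, HasDerivAt (fun s => f (r * s)) (r • deriv f (r * s)) s := by
      intro s _
      have h1 : HasDerivAt (fun s : ℝ => r * s) r s := by
        simpa using (hasDerivAt_id s).const_mul r
      exact (hfd (r * s)).hasDerivAt.scomp s h1
    rw [intervalIntegral.integral_eq_sub_of_hasDerivAt hd
      ((hf'.continuous.comp (by fun_prop)).const_smul r |>.intervalIntegrable _ _)]
    rw [mul_one, mul_zero, hfV hr, hfV (h0V rfl), h0, sub_zero]

end Implicit

/-! ### Twisted extension from a time interval to the line. -/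

section Twist

variable {T : ℝ} {E : Type} [NormedAddCommGroup E] [InnerProductSpace ℝ E]

/-- The extension of a function on `[0, T]` to `ℝ` with `w (t + T) = S⁻¹ (w t)`. -/
def twistExtend (hT : 0 < T) (S : E ≃ₗᵢ[ℝ] E) (w : C(Icc (0 : ℝ) T, E)) (t : ℝ) : E :=
  (S⁻¹ ^ ⌊t / T⌋) (IccExtend hT.le w (t - ⌊t / T⌋ * T))

variable (hT : 0 < T) (S : E ≃ₗᵢ[ℝ] E) (w : C(Icc (0 : ℝ) T, E))

theorem twistExtend_add_period (t : ℝ) :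
    twistExtend hT S w (t + T) = S⁻¹ (twistExtend hT S w t) := by
  have h : ⌊(t + T) / T⌋ = ⌊t / T⌋ + 1 := by
    rw [add_div, div_self hT.ne', Int.floor_add_one]
  unfold twistExtend
  have h' : t + T - ((⌊t / T⌋ + 1 : ℤ) : ℝ) * T = t - ⌊t / T⌋ * T := by
    push_cast
    ring
  rw [h, h', add_comm ⌊t / T⌋ 1, zpow_one_add]
  rfl

theorem twistExtend_of_mem {t : ℝ} (ht : t ∈ Ico 0 T) :
    twistExtend hT S w t = w ⟨t, Ico_subset_Icc_self ht⟩ := by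
  have h : ⌊t / T⌋ = 0 :=
    Int.floor_eq_zero_iff.2 ⟨div_nonneg ht.1 hT.le, (div_lt_one hT).2 ht.2⟩
  unfold twistExtend
  rw [h, zpow_zero, Int.cast_zero, zero_mul, sub_zero,
    IccExtend_of_mem _ _ (Ico_subset_Icc_self ht)]
  rfl

theorem norm_twistExtend_le (t : ℝ) : ‖twistExtend hT S w t‖ ≤ ‖w‖ := by
  unfold twistExtend
  rw [LinearIsometryEquiv.norm_map]
  exact w.norm_coe_le_norm _

theorem twistExtend_add (v w : C(Icc (0 : ℝ) T, E)) (t : ℝ) :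
    twistExtend hT S (v + w) t = twistExtend hT S v t + twistExtend hT S w t := by
  unfold twistExtend
  rw [← map_add]
  rfl

theorem twistExtend_smul (c : ℝ) (t : ℝ) :
    twistExtend hT S (c • w) t = c • twistExtend hT S w t := by
  unfold twistExtend
  rw [← map_smul]
  rfl

/-- The extension may jump at the multiples of T, so continuity is not available. It is a countable
family of continuous functions composed with the measurable floor. -/
theorem stronglyMeasurable_twistExtend [FiniteDimensional ℝ E] :
    StronglyMeasurable (twistExtend hT S w) := by
  borelize E
  refine Measurable.stronglyMeasurable ?_
  have h : Measurable fun p : ℝ × ℤ => (S⁻¹ ^ p.2) (IccExtend hT.le w (p.1 - p.2 * T)) :=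
    measurable_from_prod_countable_left fun n => by
      have hc : Continuous (IccExtend hT.le w) := w.continuous.Icc_extend'
      exact ((S⁻¹ ^ n).continuous.comp (hc.comp (by fun_prop))).measurable
  exact h.comp (measurable_id.prodMk (Int.measurable_floor.comp (by fun_prop)))

theorem intervalIntegrable_twistExtend [FiniteDimensional ℝ E] (a b : ℝ) :
    IntervalIntegrable (twistExtend hT S w) volume a b :=
  (intervalIntegrable_const (c := ‖w‖)).mono_fun
    (stronglyMeasurable_twistExtend hT S w).aestronglyMeasurable
    (Eventually.of_forall fun t => by
      rw [norm_norm]; exact norm_twistExtend_le hT S w t)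

/-- The primitive of the twisted extension. -/
def twistPrimitive (x : E) (t : ℝ) : E := x + ∫ s in (0 : ℝ)..t, twistExtend hT S w s

variable {v : C(Icc (0 : ℝ) T, E)} {x : E}

theorem twistPrimitive_of_mem (hv : v = ContinuousMap.const _ x + primitiveCLM hT.le w)
    {t : ℝ} (ht : t ∈ Icc 0 T) : twistPrimitive hT S w x t = v ⟨t, ht⟩ := by
  rw [hv]
  change x + _ = x + ∫ s in (0 : ℝ)..t, _
  congr 1
  rw [intervalIntegral.integral_of_le ht.1, intervalIntegral.integral_of_le ht.1,
    ← integral_Ico_eq_integral_Ioc, ← integral_Ico_eq_integral_Ioc]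
  refine setIntegral_congr_fun measurableSet_Ico fun s hs => ?_
  have hs' : s ∈ Ico 0 T := ⟨hs.1, hs.2.trans_le ht.2⟩
  rw [twistExtend_of_mem hT S w hs', IccExtend_of_mem _ _ (Ico_subset_Icc_self hs')]

variable [FiniteDimensional ℝ E]

theorem twistPrimitive_add_period (hv : v = ContinuousMap.const _ x + primitiveCLM hT.le w)
    (hvT : S (v ⟨T, right_mem_Icc.2 hT.le⟩) = x) (t : ℝ) :
    twistPrimitive hT S w x (t + T) = S⁻¹ (twistPrimitive hT S w x t) := by
  have h1 : twistPrimitive hT S w x (t + T) =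
      twistPrimitive hT S w x T + ∫ s in T..(t + T), twistExtend hT S w s := by
    unfold twistPrimitive
    rw [add_assoc, intervalIntegral.integral_add_adjacent_intervals
      (intervalIntegrable_twistExtend hT S w _ _) (intervalIntegrable_twistExtend hT S w _ _)]
  have h2 : ∫ s in T..(t + T), twistExtend hT S w s =
      S⁻¹ (∫ s in (0 : ℝ)..t, twistExtend hT S w s) := by
    have h3 := intervalIntegral.integral_comp_add_right (a := 0) (b := t)
      (twistExtend hT S w) T
    rw [zero_add] at h3
    rw [← h3]
    simp only [twistExtend_add_period]
    exact (S⁻¹ : E ≃ₗᵢ[ℝ] E).toContinuousLinearEquiv.toContinuousLinearMap.intervalIntegral_comp_comm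
      (intervalIntegrable_twistExtend hT S w _ _)
  rw [h1, h2, twistPrimitive_of_mem hT S w hv (right_mem_Icc.2 hT.le), twistPrimitive, map_add]
  congr 1
  rw [← hvT]
  exact (S.symm_apply_apply _).symm

/-- A solution of an ODE on `[0, T]` with the twisted boundary condition `S (v T) = v 0` extends
to a solution on `ℝ` if the ODE is equivariant. -/
theorem hasDerivAt_twistPrimitive (hv : v = ContinuousMap.const _ x + primitiveCLM hT.le w)
    (hvT : S (v ⟨T, right_mem_Icc.2 hT.le⟩) = x) {D : Set E} {W : ℝ → E → E}
    (hD : ∀ y ∈ D, S y ∈ D) (hD' : ∀ y ∈ D, S⁻¹ y ∈ D)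
    (hWc : ContinuousOn (Function.uncurry W) (univ ×ˢ D))
    (hWS : ∀ t, ∀ y ∈ D, W (t + T) (S⁻¹ y) = S⁻¹ (W t y))
    (hvD : ∀ t, v t ∈ D) (hw : ∀ t, w t = W t (v t)) (t : ℝ) :
    twistPrimitive hT S w x t ∈ D ∧
    HasDerivAt (twistPrimitive hT S w x) (W t (twistPrimitive hT S w x t)) t := by
  set u := twistPrimitive hT S w x with hu
  have hper : ∀ t, u (t + T) = S⁻¹ (u t) := twistPrimitive_add_period hT S w hv hvT
  have key : ∀ t, u t ∈ D ∧ twistExtend hT S w t = W t (u t) := by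
    intro t
    -- Equivariance makes the truth of this proposition T-periodic in t, so it need only be checked
    -- on [0, T).
    have hp : Function.Periodic (fun t => u t ∈ D ∧ twistExtend hT S w t = W t (u t)) T := by
      intro t
      beta_reduce
      rw [hper, twistExtend_add_period]
      refine propext ⟨fun ⟨h1, h2⟩ => ?_, fun ⟨h1, h2⟩ => ⟨hD' _ h1, ?_⟩⟩
      · have h3 : u t ∈ D := by
          have := hD _ h1
          rwa [show S (S⁻¹ (u t)) = u t from S.apply_symm_apply _] at this
        rw [hWS t _ h3] at h2
        exact ⟨h3, (S⁻¹).injective h2⟩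
      · rw [hWS t _ h1, h2]
    obtain ⟨s, hs, hst⟩ := hp.exists_mem_Ico₀ hT t
    rw [hst, twistExtend_of_mem hT S w hs, hu,
      twistPrimitive_of_mem hT S w hv (Ico_subset_Icc_self hs)]
    exact ⟨hvD _, hw _⟩
  have huc : Continuous u := continuous_const.add
    (intervalIntegral.continuous_primitive (intervalIntegrable_twistExtend hT S w) 0)
  -- The derivative has no jumps after all: it is a continuous function of the time and of the
  -- continuous primitive.
  have hwc : Continuous (twistExtend hT S w) := by
    have : twistExtend hT S w = Function.uncurry W ∘ fun t => (t, u t) := funext fun t => (key t).2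
    rw [this]
    exact hWc.comp_continuous (by fun_prop) fun t => ⟨mem_univ _, (key t).1⟩
  refine ⟨(key t).1, ?_⟩
  rw [← (key t).2]
  exact (intervalIntegral.integral_hasDerivAt_right (intervalIntegrable_twistExtend hT S w _ _)
    (hwc.stronglyMeasurableAtFilter _ _) hwc.continuousAt).const_add x

end Twist

/-! ### Twisted functions as elements of the periodic Sobolev space. -/

section Twist

variable {T : ℝ} {E : Type} [NormedAddCommGroup E] [InnerProductSpace ℝ E]
  (hT : 0 < T) (S : E ≃ₗᵢ[ℝ] E)

theorem eq_of_twisted_of_pow_eq_one {f : ℝ → E} (hf : ∀ t, f (t + T) = S⁻¹ (f t)) {ν : ℕ}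
    (hS : S ^ ν = 1) : Function.Periodic f (T * ν) := by
  have h : ∀ (n : ℕ) (t : ℝ), f (t + T * n) = (S⁻¹ ^ n) (f t) := by
    intro n
    induction n with
    | zero => intro t; simp
    | succ n ih =>
      intro t
      rw [show t + T * ((n + 1 : ℕ) : ℝ) = t + T * n + T by push_cast; ring, hf, ih, pow_succ']
      rfl
  intro t
  rw [h, inv_pow, hS, inv_one]
  rfl

variable [FiniteDimensional ℝ E] {P : ℝ} [hP0 : Fact (0 < P)] {ν : ℕ}

/-- The integrand of the periodic primitive. -/
def twistCentered (P : ℝ) (w : C(Icc (0 : ℝ) T, E)) (t : ℝ) : E :=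
  twistExtend hT S w t - P⁻¹ • ∫ s in (0 : ℝ)..P, twistExtend hT S w s

omit hP0 in
theorem intervalIntegrable_twistCentered (w : C(Icc (0 : ℝ) T, E)) (a b : ℝ) :
    IntervalIntegrable (twistCentered hT S P w) volume a b :=
  (intervalIntegrable_twistExtend hT S w a b).sub intervalIntegrable_const

omit [FiniteDimensional ℝ E] in
theorem norm_twistCentered_le (w : C(Icc (0 : ℝ) T, E)) (t : ℝ) :
    ‖twistCentered hT S P w t‖ ≤ 2 * ‖w‖ := by
  have h1 := norm_twistExtend_le hT S w t
  have h2 : ‖∫ s in (0 : ℝ)..P, twistExtend hT S w s‖ ≤ ‖w‖ * |P - 0| :=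
    intervalIntegral.norm_integral_le_of_norm_le_const fun s _ => norm_twistExtend_le hT S w s
  rw [sub_zero, abs_of_pos hP0.out] at h2
  refine (norm_sub_le _ _).trans ?_
  rw [norm_smul, norm_inv, Real.norm_of_nonneg hP0.out.le]
  have h3 : P⁻¹ * ‖∫ s in (0 : ℝ)..P, twistExtend hT S w s‖ ≤ P⁻¹ * (‖w‖ * P) :=
    mul_le_mul_of_nonneg_left h2 (inv_nonneg.2 hP0.out.le)
  have h4 : P⁻¹ * (‖w‖ * P) = ‖w‖ := by
    have := hP0.out.ne'
    field_simp
  linarith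

/-- Subtracting the mean makes the primitive of a periodic function periodic. This works for every
w, so a linear map into H¹ is defined on all of C([0, T]) and not only on derivatives of periodic
curves. -/
theorem twistPrimitive_mem_hOneSubmodule (hS : S ^ ν = 1) (hP : P = T * ν) (x : E)
    (w : C(Icc (0 : ℝ) T, E)) :
    (fun t => x + ∫ s in (0 : ℝ)..t, twistCentered hT S P w s) ∈ hOneSubmodule P E := by
  refine ⟨fun t => ?_, twistCentered hT S P w, ?_, fun t _ => by simp⟩
  · have hper : Function.Periodic (twistCentered hT S P w) P := by
      have := eq_of_twisted_of_pow_eq_one S (twistExtend_add_period hT S w) hS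
      rw [← hP] at this
      exact fun t => congrArg (· - P⁻¹ • ∫ s in (0 : ℝ)..P, twistExtend hT S w s) (this t)
    have h0 : ∫ s in (0 : ℝ)..P, twistCentered hT S P w s = 0 := by
      simp only [twistCentered]
      rw [intervalIntegral.integral_sub (intervalIntegrable_twistExtend hT S w _ _)
        intervalIntegrable_const, intervalIntegral.integral_const, sub_zero, smul_smul,
        mul_inv_cancel₀ hP0.out.ne', one_smul, sub_self]
    have h1 := hper.intervalIntegral_add_eq t 0
    rw [zero_add, h0] at h1
    beta_reduce
    rw [← intervalIntegral.integral_add_adjacent_intervals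
      (intervalIntegrable_twistCentered hT S w 0 t)
      (intervalIntegrable_twistCentered hT S w t (t + P)), h1, add_zero]
  · refine MemLp.of_bound
      (((stronglyMeasurable_twistExtend hT S w).sub stronglyMeasurable_const).aestronglyMeasurable)
      (2 * ‖w‖) (Eventually.of_forall fun t => norm_twistCentered_le hT S w t)

/-- The element of `H¹` with a given initial value and a given derivative on `[0, T]`, corrected by
its mean. -/
def hOneCLM (hS : S ^ ν = 1) (hP : P = T * ν) :
    E × C(Icc (0 : ℝ) T, E) →L[ℝ] HOne P E :=
  LinearMap.mkContinuous
    { toFun := fun p => ⟨_, twistPrimitive_mem_hOneSubmodule hT S hS hP p.1 p.2⟩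
      map_add' := fun p q => by
        refine HOne.ext fun t => ?_
        have h : ∀ s, twistCentered hT S P (p + q).2 s =
            twistCentered hT S P p.2 s + twistCentered hT S P q.2 s := fun s => by
          simp only [twistCentered, Prod.snd_add, twistExtend_add]
          rw [intervalIntegral.integral_add (intervalIntegrable_twistExtend hT S _ _ _)
            (intervalIntegrable_twistExtend hT S _ _ _), smul_add]
          abel
        change (p + q).1 + (∫ s in (0 : ℝ)..t, twistCentered hT S P (p + q).2 s) =
          (p.1 + ∫ s in (0 : ℝ)..t, twistCentered hT S P p.2 s) +
          (q.1 + ∫ s in (0 : ℝ)..t, twistCentered hT S P q.2 s)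
        simp only [h]
        rw [intervalIntegral.integral_add (intervalIntegrable_twistCentered hT S _ _ _)
            (intervalIntegrable_twistCentered hT S _ _ _), Prod.fst_add]
        abel
      map_smul' := fun c p => by
        refine HOne.ext fun t => ?_
        have h : ∀ s, twistCentered hT S P (c • p).2 s = c • twistCentered hT S P p.2 s :=
          fun s => by
          simp only [twistCentered, Prod.smul_snd, twistExtend_smul]
          rw [intervalIntegral.integral_smul, smul_sub, smul_comm]
        change (c • p).1 + (∫ s in (0 : ℝ)..t, twistCentered hT S P (c • p).2 s) =
          c • (p.1 + ∫ s in (0 : ℝ)..t, twistCentered hT S P p.2 s)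
        simp only [h]
        rw [intervalIntegral.integral_smul, Prod.smul_fst, smul_add] }
    -- The two summands bound the integrals of |u|² and |u'|² for a unit vector p: the centred
    -- integrand is at most 2‖p‖, hence |u| ≤ (1 + 2P)‖p‖ on [0, P] and |u'| ≤ 2‖p‖.
    (Real.sqrt (P * (1 + 2 * P) ^ 2 + P * 2 ^ 2)) fun p => by
    have hPpos : 0 < P := hP0.out
    set u : HOne P E := ⟨_, twistPrimitive_mem_hOneSubmodule hT S hS hP p.1 p.2⟩ with hu
    change ‖u‖ ≤ _
    have hp1 : ‖p.1‖ ≤ ‖p‖ := norm_fst_le p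
    have hp2 : ‖p.2‖ ≤ ‖p‖ := norm_snd_le p
    have hut : ∀ t, u t = p.1 + ∫ s in (0 : ℝ)..t, twistCentered hT S P p.2 s := fun t => rfl
    have hb1 : ∀ t ∈ uIoc 0 P, ‖inner ℝ (u t) (u t)‖ ≤ ((1 + 2 * P) * ‖p‖) ^ 2 := by
      intro t ht
      rw [uIoc_of_le hPpos.le] at ht
      rw [real_inner_self_eq_norm_sq, Real.norm_of_nonneg (by positivity)]
      refine pow_le_pow_left₀ (norm_nonneg _) ?_ 2
      have h2 : ‖∫ s in (0 : ℝ)..t, twistCentered hT S P p.2 s‖ ≤ 2 * ‖p.2‖ * |t - 0| :=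
        intervalIntegral.norm_integral_le_of_norm_le_const
          fun s _ => norm_twistCentered_le hT S p.2 s
      rw [sub_zero, abs_of_pos ht.1] at h2
      have h3 : 2 * ‖p.2‖ * t ≤ 2 * ‖p‖ * P := by
        have := ht.1.le
        gcongr
        exact ht.2
      rw [hut]
      refine (norm_add_le _ _).trans ?_
      linarith
    have hlip : LipschitzWith (Real.toNNReal (2 * ‖p.2‖)) (u : ℝ → E) := by
      refine LipschitzWith.of_dist_le_mul fun s t => ?_
      rw [Real.coe_toNNReal _ (by positivity), dist_eq_norm, hut, hut, add_sub_add_left_eq_sub,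
        intervalIntegral.integral_interval_sub_left (intervalIntegrable_twistCentered hT S _ _ _)
          (intervalIntegrable_twistCentered hT S _ _ _)]
      rw [Real.dist_eq]
      exact intervalIntegral.norm_integral_le_of_norm_le_const
          fun s _ => norm_twistCentered_le hT S p.2 s
    have hb2 : ∀ t ∈ uIoc 0 P,
        ‖inner ℝ (deriv (u : ℝ → E) t) (deriv (u : ℝ → E) t)‖ ≤ (2 * ‖p‖) ^ 2 := by
      intro t _
      rw [real_inner_self_eq_norm_sq, Real.norm_of_nonneg (by positivity)]
      refine pow_le_pow_left₀ (norm_nonneg _) ?_ 2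
      have := norm_deriv_le_of_lipschitz hlip (x₀ := t)
      rw [Real.coe_toNNReal _ (by positivity)] at this
      linarith
    have h1 := intervalIntegral.norm_integral_le_of_norm_le_const hb1
    have h2 := intervalIntegral.norm_integral_le_of_norm_le_const hb2
    rw [sub_zero, abs_of_pos hPpos] at h1 h2
    have h3 : ‖u‖ ^ 2 ≤ (P * (1 + 2 * P) ^ 2 + P * 2 ^ 2) * ‖p‖ ^ 2 := by
      rw [← real_inner_self_eq_norm_sq, HOne.inner_eq]
      refine (add_le_add ((le_abs_self _).trans h1) ((le_abs_self _).trans h2)).trans (le_of_eq ?_)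
      ring
    calc ‖u‖ = Real.sqrt (‖u‖ ^ 2) := (Real.sqrt_sq (norm_nonneg _)).symm
      _ ≤ Real.sqrt ((P * (1 + 2 * P) ^ 2 + P * 2 ^ 2) * ‖p‖ ^ 2) := Real.sqrt_le_sqrt h3
      _ = _ := by rw [Real.sqrt_mul (by positivity), Real.sqrt_sq (norm_nonneg _)]

theorem hOneCLM_apply (hS : S ^ ν = 1) (hP : P = T * ν) (p : E × C(Icc (0 : ℝ) T, E)) (t : ℝ) :
    hOneCLM hT S hS hP p t = p.1 + ∫ s in (0 : ℝ)..t, twistCentered hT S P p.2 s := rfl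

theorem hOneCLM_const (hS : S ^ ν = 1) (hP : P = T * ν) (c : E) (t : ℝ) :
    hOneCLM hT S hS hP (c, 0) t = c := by
  have h : ∀ s, twistExtend hT S (0 : C(Icc (0 : ℝ) T, E)) s = 0 := fun s =>
    norm_le_zero_iff.1 ((norm_twistExtend_le hT S 0 s).trans (by simp))
  rw [hOneCLM_apply]
  simp [twistCentered, h]

/-- A twisted solution is recovered from its initial value and its derivative on `[0, T]`. -/
theorem hOneCLM_eq_twistPrimitive (hS : S ^ ν = 1) (hP : P = T * ν) {x : E}
    {v w : C(Icc (0 : ℝ) T, E)} (hv : v = ContinuousMap.const _ x + primitiveCLM hT.le w)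
    (hvT : S (v ⟨T, right_mem_Icc.2 hT.le⟩) = x) (c : E) (t : ℝ) :
    hOneCLM hT S hS hP (c + x, w) t = c + twistPrimitive hT S w x t := by
  have h1 := eq_of_twisted_of_pow_eq_one S (twistPrimitive_add_period hT S w hv hvT) hS 0
  rw [← hP, zero_add] at h1
  -- The boundary condition makes the twisted primitive P-periodic, so the mean correction is zero.
  have h2 : ∫ s in (0 : ℝ)..P, twistExtend hT S w s = 0 := by
    simpa [twistPrimitive] using h1
  rw [hOneCLM_apply, twistPrimitive, add_assoc]
  simp only [twistCentered, h2, smul_zero, sub_zero]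

end Twist

/-! ### Gradient fields and the abstract fast-slow system. -/

section Gradient

variable {E : Type} [NormedAddCommGroup E] [InnerProductSpace ℝ E] [CompleteSpace E]

/-- The derivative of a gradient field is symmetric. -/
theorem inner_fderiv_gradient_comm {H : E → ℝ} {h : E → E} {x : E}
    (hH : ∀ᶠ y in 𝓝 x, HasGradientAt H (h y) y) (hh : DifferentiableAt ℝ h x) (v w : E) :
    inner ℝ (fderiv ℝ h x v) w = inner ℝ v (fderiv ℝ h x w) := by
  have h1 : ∀ᶠ y in 𝓝 x, HasFDerivAt H (InnerProductSpace.toDual ℝ E (h y)) y := hH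
  have h2 : HasFDerivAt (fun y => InnerProductSpace.toDual ℝ E (h y))
      ((InnerProductSpace.toDual ℝ E).toContinuousLinearEquiv.toContinuousLinearMap ∘L
        fderiv ℝ h x) x :=
    ((InnerProductSpace.toDual ℝ E).toContinuousLinearEquiv.toContinuousLinearMap.hasFDerivAt).comp
      x hh.hasFDerivAt
  have h3 := second_derivative_symmetric_of_eventually h1 h2 v w
  change inner ℝ (fderiv ℝ h x v) w = inner ℝ (fderiv ℝ h x w) v at h3
  rw [h3, real_inner_comm]

end Gradient

/-- A Hamiltonian system on `E` with a slow component in `B`: the linear structure maps, the fast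
Hamiltonian `H` with gradient `h`, the slow Hamiltonian `F` with gradient `f`, and a twisted
periodic orbit `Z` of the fast system. -/
structure ClusterSystem (E B : Type) [NormedAddCommGroup E] [InnerProductSpace ℝ E]
    [CompleteSpace E] [NormedAddCommGroup B] [InnerProductSpace ℝ B] where
  Y : E →L[ℝ] E
  S : E ≃ₗᵢ[ℝ] E
  hat : B →L[ℝ] E
  P : E →L[ℝ] B
  q : E →L[ℝ] B
  qs : B →L[ℝ] E
  YB : B →L[ℝ] B
  Q : E →L[ℝ] E
  inner_Y : ∀ x, inner ℝ x (Y x) = 0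
  Y_S : ∀ x, Y (S x) = S (Y x)
  S_hat : ∀ a, S (hat a) = hat a
  inner_P : ∀ x a, inner ℝ (P x) a = inner ℝ x (hat a)
  q_hat : ∀ a, q (hat a) = a
  q_S : ∀ x, q (S x) = q x
  inner_qs : ∀ a x, inner ℝ (qs a) x = inner ℝ a (q x)
  q_Y : ∀ x, q (Y x) = YB (P x)
  P_Q : ∀ x, P (Q x) = 0
  n : ℕ
  n_ne_zero : n ≠ 0
  H : E → ℝ
  h : E → E
  U : Set E
  isOpen_U : IsOpen U
  H_S : ∀ x, H (S x) = H x
  S_mem_U : ∀ x, S x ∈ U ↔ x ∈ U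
  hasGradientAt_H : ∀ x ∈ U, HasGradientAt H (h x) x
  contDiffOn_h : ContDiffOn ℝ n h U
  P_h : ∀ x ∈ U, P (h x) = 0
  F : E → ℝ
  f : E → E
  O : Set E
  isOpen_O : IsOpen O
  zero_mem_O : 0 ∈ O
  F_S : ∀ x, F (S x) = F x
  S_mem_O : ∀ x, S x ∈ O ↔ x ∈ O
  hasGradientAt_F : ∀ x ∈ O, HasGradientAt F (f x) x
  contDiffOn_f : ContDiffOn ℝ n f O
  f_zero : f 0 = 0
  M : B →L[ℝ] B
  inner_M : ∀ a b, inner ℝ (M a) b = inner ℝ a (M b)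
  fderiv_f_hat : ∀ a, fderiv ℝ f 0 (hat a) = qs (M a)
  T : ℝ
  T_pos : 0 < T
  Z : ℝ → E
  Z_mem : ∀ t, Z t ∈ U
  hasDerivAt_Z : ∀ t, HasDerivAt Z (Y (h (Z t))) t
  S_Z : ∀ t, S (Z (t + T)) = Z t
  q_Z : ∀ t, q (Z t) = 0
  inner_Q_Z : ∀ t, inner ℝ (Q (Z t)) (Y (h (Z t))) ≠ 0
  -- The two last conditions exclude the trivial solutions of the linearization: the vanishing
  -- centre excludes translations, the orthogonality excludes Ż.
  nondegenerate : ∀ w : C(Icc (0 : ℝ) T, E),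
    (∀ t, w t = w ⟨0, left_mem_Icc.2 T_pos.le⟩ +
      ∫ s in (0 : ℝ)..t, Y (fderiv ℝ h (Z s) (IccExtend T_pos.le w s))) →
    S (w ⟨T, right_mem_Icc.2 T_pos.le⟩) = w ⟨0, left_mem_Icc.2 T_pos.le⟩ →
    q (w ⟨0, left_mem_Icc.2 T_pos.le⟩) = 0 →
    inner ℝ (w ⟨0, left_mem_Icc.2 T_pos.le⟩) (Y (h (Z 0))) = 0 → w = 0
  C : ℝ
  -- `ξ` is the symmetry field that extends the kernel vector a, and `I` its Noether integral. The
  -- last inequality says that ξ pairs positively with qs a near 0, uniformly in the direction of a.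
  symmetry : ∀ a, M a = 0 → ∃ (I : E → ℝ) (ξ : E → E), Differentiable ℝ I ∧
    (∀ x, I (S x) = I x) ∧ (∀ x y, fderiv ℝ I x (Y y) = inner ℝ y (ξ x)) ∧
    (∀ r : ℝ, r ≠ 0 → ∀ b, ∀ v ∈ U, hat b + r • v ∈ O →
      inner ℝ (h v + r • f (hat b + r • v)) (ξ (hat b + r • v)) = 0) ∧
    ∀ x, ‖a‖ ^ 2 - C * ‖a‖ ^ 2 * ‖x‖ ≤ inner ℝ (qs a) (ξ x)

namespace ClusterSystem

variable {E B : Type} [NormedAddCommGroup E] [InnerProductSpace ℝ E]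
    [CompleteSpace E] [NormedAddCommGroup B] [InnerProductSpace ℝ B] (D : ClusterSystem E B)

theorem inner_Y_right (x y : E) : inner ℝ x (D.Y y) = -inner ℝ (D.Y x) y := by
  have h := D.inner_Y (x + y)
  rw [map_add, inner_add_left, inner_add_right, inner_add_right, D.inner_Y, D.inner_Y] at h
  rw [real_inner_comm y]
  linarith

theorem P_qs (a : B) : D.P (D.qs a) = a := by
  refine ext_inner_right ℝ fun b => ?_
  rw [D.inner_P, D.inner_qs, D.q_hat]

theorem differentiableAt_h {x : E} (hx : x ∈ D.U) : DifferentiableAt ℝ D.h x :=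
  (D.contDiffOn_h.contDiffAt (D.isOpen_U.mem_nhds hx)).differentiableAt
    (by exact_mod_cast D.n_ne_zero)

theorem differentiableAt_f {x : E} (hx : x ∈ D.O) : DifferentiableAt ℝ D.f x :=
  (D.contDiffOn_f.contDiffAt (D.isOpen_O.mem_nhds hx)).differentiableAt
    (by exact_mod_cast D.n_ne_zero)

theorem inner_fderiv_h {x : E} (hx : x ∈ D.U) (v w : E) :
    inner ℝ (fderiv ℝ D.h x v) w = inner ℝ v (fderiv ℝ D.h x w) :=
  inner_fderiv_gradient_comm
    (by filter_upwards [D.isOpen_U.mem_nhds hx] with y hy using D.hasGradientAt_H y hy)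
    (D.differentiableAt_h hx) v w

/-- This is the transpose of `fderiv_f_hat`, by symmetry of the Hessian. It shows that the force on
the centres is, to first order, sensitive to the centres alone. -/
theorem P_fderiv_f (y : E) : D.P (fderiv ℝ D.f 0 y) = D.M (D.q y) := by
  refine ext_inner_right ℝ fun b => ?_
  have h0 := D.isOpen_O.mem_nhds D.zero_mem_O
  rw [D.inner_P, inner_fderiv_gradient_comm
    (by filter_upwards [h0] with y hy using D.hasGradientAt_F y hy)
    (D.differentiableAt_f D.zero_mem_O), D.fderiv_f_hat, real_inner_comm, D.inner_qs, D.inner_M]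
  rw [real_inner_comm, D.inner_M]

theorem P_fderiv_h {x : E} (hx : x ∈ D.U) (y : E) : D.P (fderiv ℝ D.h x y) = 0 := by
  have h1 : HasFDerivAt (fun z => D.P (D.h z)) (D.P ∘L fderiv ℝ D.h x) x :=
    D.P.hasFDerivAt.comp x (D.differentiableAt_h hx).hasFDerivAt
  have h2 : (fun z => D.P (D.h z)) =ᶠ[𝓝 x] fun _ => 0 := by
    filter_upwards [D.isOpen_U.mem_nhds hx] with z hz using D.P_h z hz
  have h3 := h1.unique ((hasFDerivAt_const (0 : B) x).congr_of_eventuallyEq h2)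
  exact DFunLike.congr_fun h3 y

end ClusterSystem

/-- Equivariance of the gradient of a locally invariant function. -/
theorem gradient_equivariant {E : Type} [NormedAddCommGroup E] [InnerProductSpace ℝ E]
    [CompleteSpace E] {H : E → ℝ} (S : E ≃ₗᵢ[ℝ] E) {x g g' : E}
    (hS : ∀ᶠ y in 𝓝 x, H (S y) = H y) (h1 : HasGradientAt H g x) (h2 : HasGradientAt H g' (S x)) :
    g' = S g := by
  have h3 : HasFDerivAt (fun y => H (S y)) _ x := h2.hasFDerivAt.comp x
    S.toContinuousLinearEquiv.toContinuousLinearMap.hasFDerivAt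
  have h4 := h1.hasFDerivAt.unique (h3.congr_of_eventuallyEq (hS.mono fun y hy => hy.symm))
  refine ext_inner_right ℝ fun y => ?_
  have h5 := DFunLike.congr_fun h4 (S.symm y)
  change inner ℝ g (S.symm y) = inner ℝ g' (S (S.symm y)) at h5
  rw [S.apply_symm_apply] at h5
  rw [← h5, ← S.inner_map_map g, S.apply_symm_apply]

/-! ### Trivial kernel of the linearized problem. -/

namespace ClusterSystem

variable {E B : Type} [NormedAddCommGroup E] [InnerProductSpace ℝ E]
    [CompleteSpace E] [NormedAddCommGroup B] [InnerProductSpace ℝ B] (D : ClusterSystem E B)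

theorem h_S {x : E} (hx : x ∈ D.U) : D.h (D.S x) = D.S (D.h x) :=
  gradient_equivariant D.S (Eventually.of_forall D.H_S) (D.hasGradientAt_H x hx)
    (D.hasGradientAt_H _ ((D.S_mem_U x).2 hx))

theorem f_S {x : E} (hx : x ∈ D.O) : D.f (D.S x) = D.S (D.f x) :=
  gradient_equivariant D.S (Eventually.of_forall D.F_S) (D.hasGradientAt_F x hx)
    (D.hasGradientAt_F _ ((D.S_mem_O x).2 hx))

/-- The linearization at the unperturbed orbit has trivial kernel. -/
theorem linearization_injective {w : C(Icc (0 : ℝ) D.T, E)} {ℓ : ℝ}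
    (hℓ : ℓ = inner ℝ (w ⟨0, left_mem_Icc.2 D.T_pos.le⟩) (D.Y (D.h (D.Z 0))))
    (hw : ∀ t, w t = (D.S (w ⟨D.T, right_mem_Icc.2 D.T_pos.le⟩) +
        D.hat (D.q (w ⟨0, left_mem_Icc.2 D.T_pos.le⟩))) +
      ∫ s in (0 : ℝ)..t, D.Y (fderiv ℝ D.h (D.Z s) (IccExtend D.T_pos.le w s) +
        ℓ • D.Q (D.Z s))) : w = 0 := by
  have hT := D.T_pos
  set e0 : Icc (0 : ℝ) D.T := ⟨0, left_mem_Icc.2 D.T_pos.le⟩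
  set eT : Icc (0 : ℝ) D.T := ⟨D.T, right_mem_Icc.2 D.T_pos.le⟩
  obtain ⟨x, hx⟩ : ∃ x, x = D.S (w eT) + D.hat (D.q (w e0)) := ⟨_, rfl⟩
  rw [← hx] at hw
  have hw0 : w e0 = x := by rw [hw e0]; simp [e0]
  have hZc : Continuous D.Z :=
    continuous_iff_continuousAt.2 fun t => (D.hasDerivAt_Z t).continuousAt
  have hh'c : Continuous fun s => fderiv ℝ D.h (D.Z s) := by
    have h1 : ContinuousOn (fderiv ℝ D.h) D.U :=
      (D.contDiffOn_h).continuousOn_fderiv_of_isOpen D.isOpen_U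
        (by exact_mod_cast Nat.one_le_iff_ne_zero.2 D.n_ne_zero)
    exact h1.comp_continuous hZc D.Z_mem
  have hwc : Continuous (IccExtend hT.le w) := w.continuous.Icc_extend'
  set k : ℝ → E := fun s => D.Y (fderiv ℝ D.h (D.Z s) (IccExtend D.T_pos.le w s) + ℓ • D.Q (D.Z s))
    with hk
  have hkc : Continuous k := by fun_prop
  obtain ⟨V, hV⟩ : ∃ V : ℝ → E, V = fun t => x + ∫ s in (0 : ℝ)..t, k s := ⟨_, rfl⟩
  have hVw : ∀ t (ht : t ∈ Icc 0 D.T), V t = w ⟨t, ht⟩ := fun t ht => by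
    rw [hV]; exact (hw ⟨t, ht⟩).symm
  have hVd : ∀ t, HasDerivAt V (k t) t := fun t => by
    rw [hV]
    exact (hkc.integral_hasStrictDerivAt 0 t).hasDerivAt.const_add x
  have hkV : ∀ t ∈ Icc 0 D.T, k t = D.Y (fderiv ℝ D.h (D.Z t) (V t) + ℓ • D.Q (D.Z t)) := by
    intro t ht
    rw [hVw t ht, hk]
    simp only [IccExtend_of_mem _ _ ht]
  have hV0 : V 0 = w e0 := hVw 0 _
  have hVT : V D.T = w eT := hVw D.T _
  have hVb : V 0 = D.S (V D.T) + D.hat (D.q (V 0)) := by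
    rw [hV0, hVT]; exact hw0.trans hx
  -- the weighted centres are conserved
  have hqk : ∀ t ∈ Icc 0 D.T, D.q (k t) = 0 := by
    intro t ht
    rw [hkV t ht, D.q_Y, map_add, D.P_fderiv_h (D.Z_mem t), map_smul, D.P_Q]
    simp
  have hqV : D.q (V D.T) = D.q (V 0) := by
    refine constant_of_derivWithin_zero (f := fun t => D.q (V t)) (a := 0) (b := D.T) ?_ ?_ D.T
      (right_mem_Icc.2 hT.le)
    · exact fun t _ => (D.q.hasFDerivAt.comp_hasDerivAt t
        (hVd t)).differentiableAt.differentiableWithinAt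
    · intro t ht
      exact (((D.q.hasFDerivAt.comp_hasDerivAt t (hVd t)).hasDerivWithinAt).derivWithin
        (uniqueDiffOn_Icc hT t (Ico_subset_Icc_self ht))).trans (hqk t (Ico_subset_Icc_self ht))
  -- Applying q to the boundary relation gives q V(0) = q V(T) + q V(0), so q V(T) = 0. With the
  -- conservation of q this kills the correction term and leaves S V(T) = V(0).
  have hq0 : D.q (V 0) = 0 := by
    have h1 := congrArg D.q hVb
    rw [map_add, D.q_S, D.q_hat] at h1
    rw [← hqV]
    simpa using h1
  have hSV : D.S (V D.T) = V 0 := by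
    rw [hq0, map_zero, add_zero] at hVb
    exact hVb.symm
  -- the derivative of the energy along the linearized flow
  have hℓ0 : ℓ = 0 := by
    -- The first variation of the energy is constant along the linearized flow, up to the term with
    -- Q: the Hessian terms cancel by skewness of Y and symmetry of the Hessian. It has equal values
    -- at both ends, so Rolle yields a zero of ℓ⟨QZ, Ż⟩.
    have hφ : ∀ t ∈ Ioo 0 D.T, HasDerivAt (fun t => (inner ℝ (D.h (D.Z t)) (V t) : ℝ))
        (-(ℓ * inner ℝ (D.Q (D.Z t)) (D.Y (D.h (D.Z t))))) t := by
      intro t ht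
      have h1 : HasDerivAt (fun t => D.h (D.Z t)) (fderiv ℝ D.h (D.Z t) (D.Y (D.h (D.Z t)))) t :=
        (D.differentiableAt_h (D.Z_mem t)).hasFDerivAt.comp_hasDerivAt t (D.hasDerivAt_Z t)
      refine (h1.inner ℝ (hVd t)).congr_deriv ?_
      rw [hkV t (Ioo_subset_Icc_self ht), D.inner_Y_right, D.inner_fderiv_h (D.Z_mem t),
        inner_add_right, inner_smul_right, real_inner_comm (D.Q (D.Z t))]
      ring
    have hcont : ContinuousOn (fun t => (inner ℝ (D.h (D.Z t)) (V t) : ℝ)) (Icc 0 D.T) := by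
      have h1 : Continuous fun t => D.h (D.Z t) :=
        D.contDiffOn_h.continuousOn.comp_continuous hZc D.Z_mem
      have h2 : Continuous V := continuous_iff_continuousAt.2 fun t => (hVd t).continuousAt
      exact (h1.inner h2).continuousOn
    have hend : (inner ℝ (D.h (D.Z 0)) (V 0) : ℝ) = inner ℝ (D.h (D.Z D.T)) (V D.T) := by
      have h1 : D.S (D.Z D.T) = D.Z 0 := by simpa using D.S_Z 0
      rw [← hSV, ← h1, D.h_S (D.Z_mem _), D.S.inner_map_map]
    obtain ⟨t, ht, h0⟩ := exists_hasDerivAt_eq_zero hT hcont hend hφ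
    rw [neg_eq_zero, mul_eq_zero] at h0
    exact h0.resolve_right (D.inner_Q_Z t)
  refine D.nondegenerate w (fun t => ?_) ?_ ?_ ?_
  · rw [hw t, hw0]
    simp [hk, hℓ0]
  · rw [← hVT, hSV, hV0]
  · rw [← hV0, hq0]
  · rw [← hℓ, hℓ0]

end ClusterSystem

/-! ### The boundary value problem with multipliers. -/

namespace ClusterSystem

variable {E B : Type} [NormedAddCommGroup E] [InnerProductSpace ℝ E]
    [CompleteSpace E] [NormedAddCommGroup B] [InnerProductSpace ℝ B] (D : ClusterSystem E B)

/-- The left end point of the time interval. -/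
def tzero : Icc (0 : ℝ) D.T := ⟨0, left_mem_Icc.2 D.T_pos.le⟩

/-- The right end point of the time interval. -/
def tend : Icc (0 : ℝ) D.T := ⟨D.T, right_mem_Icc.2 D.T_pos.le⟩

/-- The orbit `Z` on the time interval. -/
def orbit : C(Icc (0 : ℝ) D.T, E) := ⟨fun t => D.Z t,
  (continuous_iff_continuousAt.2 fun t => (D.hasDerivAt_Z t).continuousAt).comp
    continuous_subtype_val⟩

/-- The constant functions. -/
def cst (V : Type) [NormedAddCommGroup V] [NormedSpace ℝ V] : V →L[ℝ] C(Icc (0 : ℝ) D.T, V) :=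
  ContinuousLinearMap.const ℝ (Icc (0 : ℝ) D.T)

/-- Pointwise application of a linear map. -/
def ptw {V W : Type} [NormedAddCommGroup V] [NormedSpace ℝ V] [NormedAddCommGroup W]
    [NormedSpace ℝ W] (A : V →L[ℝ] W) : C(Icc (0 : ℝ) D.T, V) →L[ℝ] C(Icc (0 : ℝ) D.T, W) :=
  A.compLeftContinuous ℝ (Icc (0 : ℝ) D.T)

/-- Evaluation at a time. -/
def ev (V : Type) [NormedAddCommGroup V] [NormedSpace ℝ V] (t : Icc (0 : ℝ) D.T) :
    C(Icc (0 : ℝ) D.T, V) →L[ℝ] V :=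
  ContinuousMap.evalCLM ℝ t

/-- The phase of a curve relative to the orbit. -/
def phase (v : C(Icc (0 : ℝ) D.T, E)) : ℝ :=
  inner ℝ (D.Y (D.h (D.Z 0))) (D.ev E D.tzero v - D.Z 0)

/-- The argument of the slow Hamiltonian. -/
def slowArg (p : ℝ × B × C(Icc (0 : ℝ) D.T, E)) : C(Icc (0 : ℝ) D.T, E) :=
  D.cst E (D.hat p.2.1) + p.1 • p.2.2

theorem contDiff_slowArg {k : WithTop ℕ∞} : ContDiff ℝ k D.slowArg :=
  ((D.cst E ∘L D.hat).contDiff.comp (contDiff_fst.comp contDiff_snd)).add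
    (contDiff_fst.smul (contDiff_snd.comp contDiff_snd))

theorem contDiff_phase {k : WithTop ℕ∞} : ContDiff ℝ k D.phase :=
  contDiff_const.inner ℝ ((D.ev E D.tzero).contDiff.sub contDiff_const)

/-- The base point of the continuation. -/
def base : ℝ × B × C(Icc (0 : ℝ) D.T, E) := (0, 0, D.orbit)

theorem phase_orbit : D.phase D.orbit = 0 := by
  have : D.ev E D.tzero D.orbit = D.Z 0 := rfl
  rw [phase, this, sub_self, inner_zero_right]

theorem slowArg_base : D.slowArg D.base = 0 := by
  simp [slowArg, base]

theorem fc_comp_zero {fc : C(E, E)} (hf0 : fc 0 = 0) : fc.comp (0 : C(Icc (0 : ℝ) D.T, E)) = 0 := by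
  ext t
  simp [hf0]

theorem fderiv_slowArg_base (d : ℝ × B × C(Icc (0 : ℝ) D.T, E)) :
    fderiv ℝ D.slowArg D.base d = D.cst E (D.hat d.2.1) + d.1 • D.orbit := by
  have hd : DifferentiableAt ℝ D.slowArg D.base :=
    (D.contDiff_slowArg (k := 1)).differentiable (by simp) _
  have h1 : HasDerivAt (fun s : ℝ => D.slowArg (D.base + s • d)) (fderiv ℝ D.slowArg D.base d) 0 :=
    hd.hasFDerivAt.hasLineDerivAt d
  have h2 : HasDerivAt (fun s : ℝ => D.slowArg (D.base + s • d))
      (D.cst E (D.hat d.2.1) + d.1 • D.orbit) 0 := by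
    have e : (fun s : ℝ => D.slowArg (D.base + s • d)) = fun s : ℝ =>
        s • D.cst E (D.hat d.2.1) + (s • d.1) • (D.orbit + s • d.2.2) := by
      funext s
      simp [slowArg, base]
    rw [e]
    have h3 : HasDerivAt (fun s : ℝ => s • d.1) d.1 0 := by
      simpa using (hasDerivAt_id (0 : ℝ)).smul_const d.1
    have h4 : HasDerivAt (fun s : ℝ => D.orbit + s • d.2.2) d.2.2 0 := by
      simpa using ((hasDerivAt_id (0 : ℝ)).smul_const d.2.2).const_add D.orbit
    have h5 : HasDerivAt (fun s : ℝ => s • D.cst E (D.hat d.2.1)) (D.cst E (D.hat d.2.1)) 0 := by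
      simpa using (hasDerivAt_id (0 : ℝ)).smul_const (D.cst E (D.hat d.2.1))
    exact (h5.add (h3.smul h4)).congr_deriv (by simp)
  exact h1.unique h2

variable [FiniteDimensional ℝ B] (hc fc : C(E, E))

/-- The projection onto the kernel of the reduced Hessian. -/
def kerProj : B →L[ℝ] B := D.M.ker.starProjection

/-- The gradient of the rescaled Hamiltonian with Lagrange multiplier terms. -/
def grad (p : ℝ × B × C(Icc (0 : ℝ) D.T, E)) : C(Icc (0 : ℝ) D.T, E) :=
  hc.comp p.2.2 + p.1 • fc.comp (D.slowArg p) +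
    -- The factor r/T makes the time integral of this term, seen by P, equal to r times the kernel
    -- component of b, so that it matches the first component of `bvp`. The unknowns b and v
    -- themselves supply the multipliers.
    (p.1 / D.T) • D.cst E (D.qs (D.kerProj p.2.1)) + D.phase p.2.2 • D.ptw D.Q p.2.2

/-- The map whose zeros are the solutions of the boundary value problem. -/
def bvp (p : ℝ × B × C(Icc (0 : ℝ) D.T, E)) : B × C(Icc (0 : ℝ) D.T, E) :=
  -- The first component makes the mean force on the centres, multiplier included, vanish. In the
  -- second one, evaluation at 0 gives v(0) = S v(T) + hat(q v(0)): the boundary condition and the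
  -- normalization of the centre are combined in one equation.
  (D.ev B D.tend (primitiveCLM D.T_pos.le (D.ptw D.P (fc.comp (D.slowArg p)))) +
      D.kerProj p.2.1,
    p.2.2 - D.cst E (D.S (D.ev E D.tend p.2.2) + D.hat (D.q (D.ev E D.tzero p.2.2))) -
      primitiveCLM D.T_pos.le (D.ptw D.Y (D.grad hc fc p)))

variable {hc fc}

theorem contDiff_grad {n : ℕ} (hhc : ContDiff ℝ n hc) (hfc : ContDiff ℝ n fc) :
    ContDiff ℝ n (D.grad hc fc) := by
  have hv : ContDiff ℝ n fun p : ℝ × B × C(Icc (0 : ℝ) D.T, E) => p.2.2 :=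
    contDiff_snd.comp contDiff_snd
  have hb : ContDiff ℝ n fun p : ℝ × B × C(Icc (0 : ℝ) D.T, E) => p.2.1 :=
    contDiff_fst.comp contDiff_snd
  have h1 := (contDiff_continuousMap_comp (X := Icc (0 : ℝ) D.T) n hc hhc).comp hv
  have h2 := (contDiff_continuousMap_comp (X := Icc (0 : ℝ) D.T) n fc hfc).comp
    (D.contDiff_slowArg (k := n))
  have h3 := (D.cst E ∘L D.qs ∘L D.kerProj).contDiff.comp hb
  have h4 := (D.contDiff_phase (k := n)).comp hv
  have h5 := (D.ptw D.Q).contDiff.comp hv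
  exact ((h1.add (contDiff_fst.smul h2)).add ((contDiff_fst.div_const D.T).smul h3)).add
    (h4.smul h5)

theorem contDiff_bvp {n : ℕ} (hhc : ContDiff ℝ n hc) (hfc : ContDiff ℝ n fc) :
    ContDiff ℝ n (D.bvp hc fc) := by
  have hv : ContDiff ℝ n fun p : ℝ × B × C(Icc (0 : ℝ) D.T, E) => p.2.2 :=
    contDiff_snd.comp contDiff_snd
  have hb : ContDiff ℝ n fun p : ℝ × B × C(Icc (0 : ℝ) D.T, E) => p.2.1 :=
    contDiff_fst.comp contDiff_snd
  have h2 := (contDiff_continuousMap_comp (X := Icc (0 : ℝ) D.T) n fc hfc).comp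
    (D.contDiff_slowArg (k := n))
  have h3 := (D.ev B D.tend ∘L primitiveCLM D.T_pos.le ∘L D.ptw D.P).contDiff.comp h2
  have h4 := (D.cst E ∘L (D.S.toContinuousLinearEquiv.toContinuousLinearMap ∘L D.ev E D.tend +
    D.hat ∘L D.q ∘L D.ev E D.tzero)).contDiff.comp hv
  have h5 := (primitiveCLM D.T_pos.le ∘L D.ptw D.Y).contDiff.comp (D.contDiff_grad hhc hfc)
  exact (h3.add (D.kerProj.contDiff.comp hb)).prodMk ((hv.sub h4).sub h5)

/-- The two terms with a factor r drop out because their cofactors, f at the slow argument and the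
kernel component of b, vanish at the base point. In particular nothing depends on the r-component of
d. -/
theorem fderiv_grad_base (hhc : ContDiff ℝ 1 hc) (hfc : ContDiff ℝ 1 fc) (hf0 : fc 0 = 0)
    (d : ℝ × B × C(Icc (0 : ℝ) D.T, E)) :
    fderiv ℝ (D.grad hc fc) D.base d =
      fderiv ℝ (fun u : C(Icc (0 : ℝ) D.T, E) => hc.comp u) D.orbit d.2.2 +
      (inner ℝ (D.Y (D.h (D.Z 0))) (d.2.2 D.tzero) : ℝ) • D.ptw D.Q D.orbit := by
  have hd : DifferentiableAt ℝ (D.grad hc fc) D.base :=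
    (D.contDiff_grad (n := 1) (by exact_mod_cast hhc) (by exact_mod_cast hfc)).differentiable
      (by simp) _
  have h1 : HasDerivAt (fun s : ℝ => D.grad hc fc (D.base + s • d))
      (fderiv ℝ (D.grad hc fc) D.base d) 0 :=
    hd.hasFDerivAt.hasLineDerivAt d
  refine h1.unique ?_
  -- The directional derivative is taken along a line, on which the phase and the multiplier of the
  -- kernel are exactly linear in s.
  have e : (fun s : ℝ => D.grad hc fc (D.base + s • d)) = fun s : ℝ =>
      hc.comp (D.orbit + s • d.2.2) + (s • d.1) • fc.comp (D.slowArg (D.base + s • d)) +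
      (s • d.1 / D.T) • (s • D.cst E (D.qs (D.kerProj d.2.1))) +
      (s • (inner ℝ (D.Y (D.h (D.Z 0))) (d.2.2 D.tzero) : ℝ)) •
        (D.ptw D.Q (D.orbit + s • d.2.2)) := by
    funext s
    have hp : D.phase (D.orbit + s • d.2.2) =
        s • (inner ℝ (D.Y (D.h (D.Z 0))) (d.2.2 D.tzero) : ℝ) := by
      have h6 : D.ev E D.tzero (D.orbit + s • d.2.2) - D.Z 0 = s • d.2.2 D.tzero := by
        change D.Z 0 + s • d.2.2 D.tzero - D.Z 0 = _
        abel
      rw [phase, h6, inner_smul_right, smul_eq_mul]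
    simp only [grad]
    rw [show (D.base + s • d).2.2 = D.orbit + s • d.2.2 from rfl,
      show (D.base + s • d).1 = s • d.1 by simp [base],
      show (D.base + s • d).2.1 = s • d.2.1 by simp [base], hp]
    simp only [map_smul]
  rw [e]
  have h3 : HasDerivAt (fun s : ℝ => s • d.1) d.1 0 := by
    simpa using (hasDerivAt_id (0 : ℝ)).smul_const d.1
  have h4 : HasDerivAt (fun s : ℝ => D.orbit + s • d.2.2) d.2.2 0 := by
    simpa using ((hasDerivAt_id (0 : ℝ)).smul_const d.2.2).const_add D.orbit
  have hN : DifferentiableAt ℝ (fun u : C(Icc (0 : ℝ) D.T, E) => hc.comp u) D.orbit :=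
    (contDiff_continuousMap_comp 1 hc (by exact_mod_cast hhc)).differentiable (by simp) _
  have h5 : HasDerivAt (fun s : ℝ => hc.comp (D.orbit + s • d.2.2)) (fderiv ℝ
      (fun u : C(Icc (0 : ℝ) D.T, E) => hc.comp u) D.orbit d.2.2) 0 :=
    hN.hasFDerivAt.hasLineDerivAt d.2.2
  have hNf : DifferentiableAt ℝ (fun p => fc.comp (D.slowArg p)) D.base :=
    ((contDiff_continuousMap_comp (X := Icc (0 : ℝ) D.T) 1 fc (by exact_mod_cast hfc)).comp
      (D.contDiff_slowArg (k := (1 : ℕ)))).differentiable (by simp) _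
  have h6 : HasDerivAt (fun s : ℝ => fc.comp (D.slowArg (D.base + s • d))) _ 0 :=
    hNf.hasFDerivAt.hasLineDerivAt d
  have h8 : HasDerivAt (fun s : ℝ => s • D.cst E (D.qs (D.kerProj d.2.1)))
      (D.cst E (D.qs (D.kerProj d.2.1))) 0 := by
    simpa using (hasDerivAt_id (0 : ℝ)).smul_const (D.cst E (D.qs (D.kerProj d.2.1)))
  have h9 : HasDerivAt (fun s : ℝ => s • (inner ℝ (D.Y (D.h (D.Z 0))) (d.2.2 D.tzero) : ℝ))
      (inner ℝ (D.Y (D.h (D.Z 0))) (d.2.2 D.tzero) : ℝ) 0 := by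
    simpa using (hasDerivAt_id (0 : ℝ)).smul_const
      (inner ℝ (D.Y (D.h (D.Z 0))) (d.2.2 D.tzero) : ℝ)
  have h10 := (D.ptw D.Q).hasFDerivAt.comp_hasDerivAt (0 : ℝ) h4
  have h11 := (((h5.add (h3.smul h6)).add ((h3.div_const D.T).smul h8)).add
    (h9.smul h10))
  refine h11.congr_deriv ?_
  have h12 : fc.comp (D.slowArg (D.base + (0 : ℝ) • d)) = 0 := by
    rw [zero_smul, add_zero, slowArg_base, D.fc_comp_zero hf0]
  rw [h12]
  simp

end ClusterSystem

/-! ### Linearization of the boundary value problem. -/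

namespace ClusterSystem

variable {E B : Type} [NormedAddCommGroup E] [InnerProductSpace ℝ E]
    [CompleteSpace E] [NormedAddCommGroup B] [InnerProductSpace ℝ B] (D : ClusterSystem E B)
    [FiniteDimensional ℝ B] {hc fc : C(E, E)}

/-- The linearization is triangular enough to decouple: the first component sees only b, because P
f'(0) = M q and q Z = 0, and the second one sees only v. -/
theorem fderiv_bvp_base (hhc : ContDiff ℝ 1 hc) (hfc : ContDiff ℝ 1 fc)
    (hf : fc =ᶠ[𝓝 0] D.f) (d : ℝ × B × C(Icc (0 : ℝ) D.T, E)) :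
    fderiv ℝ (D.bvp hc fc) D.base d =
      (D.T • D.M d.2.1 + D.kerProj d.2.1,
        d.2.2 - D.cst E (D.S (d.2.2 D.tend) + D.hat (D.q (d.2.2 D.tzero))) -
          primitiveCLM D.T_pos.le (D.ptw D.Y (fderiv ℝ (D.grad hc fc) D.base d))) := by
  have hv : HasFDerivAt (fun p : ℝ × B × C(Icc (0 : ℝ) D.T, E) => p.2.2) _ D.base :=
    ((ContinuousLinearMap.snd ℝ B C(Icc (0 : ℝ) D.T, E)) ∘L
      (ContinuousLinearMap.snd ℝ ℝ (B × C(Icc (0 : ℝ) D.T, E)))).hasFDerivAt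
  have hb : HasFDerivAt (fun p : ℝ × B × C(Icc (0 : ℝ) D.T, E) => p.2.1) _ D.base :=
    ((ContinuousLinearMap.fst ℝ B C(Icc (0 : ℝ) D.T, E)) ∘L
      (ContinuousLinearMap.snd ℝ ℝ (B × C(Icc (0 : ℝ) D.T, E)))).hasFDerivAt
  have hN : DifferentiableAt ℝ (fun u : C(Icc (0 : ℝ) D.T, E) => fc.comp u) (D.slowArg D.base) :=
    (contDiff_continuousMap_comp 1 fc (by exact_mod_cast hfc)).differentiable (by simp) _
  have hsl : DifferentiableAt ℝ D.slowArg D.base :=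
    (D.contDiff_slowArg (k := 1)).differentiable (by simp) _
  have h2 : HasFDerivAt (fun p => fc.comp (D.slowArg p)) _ D.base :=
    HasFDerivAt.comp (g := fun u : C(Icc (0 : ℝ) D.T, E) => fc.comp u) D.base
      hN.hasFDerivAt hsl.hasFDerivAt
  have hg : DifferentiableAt ℝ (D.grad hc fc) D.base :=
    (D.contDiff_grad (n := 1) (by exact_mod_cast hhc) (by exact_mod_cast hfc)).differentiable
      (by simp) _
  have h3 := (D.ev B D.tend ∘L primitiveCLM D.T_pos.le ∘L D.ptw D.P).hasFDerivAt.comp D.base h2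
  have h4 := (D.cst E ∘L (D.S.toContinuousLinearEquiv.toContinuousLinearMap ∘L D.ev E D.tend +
    D.hat ∘L D.q ∘L D.ev E D.tzero)).hasFDerivAt.comp D.base hv
  have h5 := (primitiveCLM D.T_pos.le ∘L D.ptw D.Y).hasFDerivAt.comp D.base hg.hasFDerivAt
  have h6 : HasFDerivAt (D.bvp hc fc) _ D.base :=
    (h3.add (D.kerProj.hasFDerivAt.comp D.base hb)).prodMk ((hv.sub h4).sub h5)
  rw [h6.fderiv]
  refine Prod.ext ?_ rfl
  change D.ev B D.tend (primitiveCLM D.T_pos.le (D.ptw D.P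
    (fderiv ℝ (fun u : C(Icc (0 : ℝ) D.T, E) => fc.comp u) (D.slowArg D.base)
      (fderiv ℝ D.slowArg D.base d)))) + D.kerProj d.2.1 = _
  have h7 : D.ptw D.P (fderiv ℝ (fun u : C(Icc (0 : ℝ) D.T, E) => fc.comp u) (D.slowArg D.base)
      (fderiv ℝ D.slowArg D.base d)) = D.cst B (D.M d.2.1) := by
    ext t
    change D.P (fderiv ℝ (fun u : C(Icc (0 : ℝ) D.T, E) => fc.comp u) (D.slowArg D.base)
      (fderiv ℝ D.slowArg D.base d) t) = D.M d.2.1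
    rw [fderiv_continuousMap_comp_apply fc hfc, slowArg_base, fderiv_slowArg_base]
    change D.P (fderiv ℝ fc 0 (D.hat d.2.1 + d.1 • D.Z t)) = _
    rw [hf.fderiv_eq, D.P_fderiv_f, map_add, D.q_hat, map_smul, D.q_Z, smul_zero, add_zero]
  rw [h7]
  congr 1
  change ∫ s in (0 : ℝ)..D.T, IccExtend D.T_pos.le (D.cst B (D.M d.2.1)) s = _
  have h8 : ∀ s, IccExtend D.T_pos.le (D.cst B (D.M d.2.1)) s = D.M d.2.1 := fun s => rfl
  simp only [h8, intervalIntegral.integral_const, sub_zero]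

theorem M_kerProj (b : B) : D.M (D.kerProj b) = 0 :=
  (D.M.ker.starProjection_apply_mem b)

/-- M is self-adjoint, so its range is orthogonal to its kernel. Pairing with the kernel component
of b shows that this component is zero, and then b lies in the kernel. -/
theorem reduced_injective {c : ℝ} (hc0 : c ≠ 0) {b : B} (h : c • D.M b + D.kerProj b = 0) :
    b = 0 := by
  have h1 : inner ℝ (D.kerProj b) (D.kerProj b) = (0 : ℝ) := by
    have h2 := congrArg (fun x => (inner ℝ x (D.kerProj b) : ℝ)) h
    simpa [inner_add_left, inner_smul_left, D.inner_M, D.M_kerProj] using h2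
  rw [inner_self_eq_zero] at h1
  rw [h1, add_zero, smul_eq_zero] at h
  have h3 : b ∈ D.M.ker := h.resolve_left hc0
  rw [← h1]
  exact (Submodule.starProjection_eq_self_iff.2 h3).symm

theorem bvp_base (hf : fc =ᶠ[𝓝 0] D.f) (hh : ∀ t : Icc (0 : ℝ) D.T, hc =ᶠ[𝓝 (D.Z t)] D.h) :
    D.bvp hc fc D.base = 0 := by
  have hf0 : fc 0 = 0 := hf.self_of_nhds.trans D.f_zero
  have hg : D.grad hc fc D.base = hc.comp D.orbit := by
    have : D.grad hc fc D.base = hc.comp D.orbit + (0 : ℝ) • fc.comp (D.slowArg D.base) +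
      ((0 : ℝ) / D.T) • D.cst E (D.qs (D.kerProj 0)) + D.phase D.orbit • D.ptw D.Q D.orbit := rfl
    rw [this, D.phase_orbit]
    simp
  refine Prod.ext ?_ ?_
  · change D.ev B D.tend (primitiveCLM D.T_pos.le (D.ptw D.P (fc.comp (D.slowArg D.base)))) +
      D.kerProj 0 = 0
    rw [D.slowArg_base, D.fc_comp_zero hf0]
    simp
  · change D.orbit - D.cst E (D.S (D.Z D.T) + D.hat (D.q (D.Z 0))) -
      primitiveCLM D.T_pos.le (D.ptw D.Y (D.grad hc fc D.base)) = 0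
    have hST : D.S (D.Z D.T) = D.Z 0 := by simpa using D.S_Z 0
    rw [hg, D.q_Z, map_zero, add_zero, hST]
    ext t
    change D.Z t - D.Z 0 - ∫ s in (0 : ℝ)..t, IccExtend D.T_pos.le
      (D.ptw D.Y (hc.comp D.orbit)) s = 0
    have hZc : Continuous D.Z :=
      continuous_iff_continuousAt.2 fun t => (D.hasDerivAt_Z t).continuousAt
    have h1 : ∫ s in (0 : ℝ)..t, IccExtend D.T_pos.le (D.ptw D.Y (hc.comp D.orbit)) s =
        ∫ s in (0 : ℝ)..t, D.Y (D.h (D.Z s)) := by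
      refine intervalIntegral.integral_congr fun s hs => ?_
      rw [uIcc_of_le t.2.1] at hs
      have hs' : s ∈ Icc 0 D.T := ⟨hs.1, hs.2.trans t.2.2⟩
      simp only [IccExtend_of_mem _ _ hs']
      change D.Y (hc (D.Z s)) = _
      rw [(hh ⟨s, hs'⟩).self_of_nhds]
    rw [h1, intervalIntegral.integral_eq_sub_of_hasDerivAt (fun s _ => D.hasDerivAt_Z s)
      ((D.Y.continuous.comp (D.contDiffOn_h.continuousOn.comp_continuous hZc
        D.Z_mem)).intervalIntegrable _ _)]
    simp

variable [FiniteDimensional ℝ E]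

/-- The only infinite-dimensional part of the linearization is 1 - ∫Y h'(Z), a Volterra operator and
hence bijective. The boundary values, the phase and the component in B factor through B × E × ℝ, so
injectivity decides. -/
theorem bijective_fderiv_bvp (hhc : ContDiff ℝ 1 hc) (hfc : ContDiff ℝ 1 fc)
    (hf : fc =ᶠ[𝓝 0] D.f) (hh : ∀ t : Icc (0 : ℝ) D.T, hc =ᶠ[𝓝 (D.Z t)] D.h) :
    Function.Bijective fun y => fderiv ℝ (D.bvp hc fc) D.base (0, y) := by
  have hf0 : fc 0 = 0 := hf.self_of_nhds.trans D.f_zero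
  set L : C(Icc (0 : ℝ) D.T, E) →L[ℝ] C(Icc (0 : ℝ) D.T, E) :=
    D.ptw D.Y ∘L fderiv ℝ (fun u : C(Icc (0 : ℝ) D.T, E) => hc.comp u) D.orbit with hL
  have hLt : ∀ w t, L w t = D.Y (fderiv ℝ D.h (D.Z t) (w t)) := by
    intro w t
    change D.Y (fderiv ℝ (fun u : C(Icc (0 : ℝ) D.T, E) => hc.comp u) D.orbit w t) = _
    rw [fderiv_continuousMap_comp_apply hc hhc]
    change D.Y (fderiv ℝ hc (D.Z t) (w t)) = _
    rw [(hh t).fderiv_eq]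
  -- the Volterra part
  obtain ⟨c, hc0, hcL⟩ : ∃ c : ℝ, 0 ≤ c ∧ ∀ w t, ‖L w t‖ ≤ c * ‖w t‖ := by
    have hcont : Continuous fun t : Icc (0 : ℝ) D.T => D.Y ∘L fderiv ℝ hc (D.orbit t) := by
      have h1 : Continuous (fderiv ℝ hc) := hhc.continuous_fderiv (by simp)
      exact continuous_const.clm_comp (h1.comp D.orbit.continuous)
    obtain ⟨c, hcb⟩ := isCompact_univ.exists_bound_of_continuousOn hcont.continuousOn
    refine ⟨max c 0, le_max_right _ _, fun w t => ?_⟩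
    have h2 : L w t = (D.Y ∘L fderiv ℝ hc (D.orbit t)) (w t) := by
      rw [hLt, ← (hh t).fderiv_eq]
      rfl
    rw [h2]
    refine ((D.Y ∘L fderiv ℝ hc (D.orbit t)).le_opNorm _).trans ?_
    exact mul_le_mul_of_nonneg_right ((hcb t (mem_univ _)).trans (le_max_left _ _)) (norm_nonneg _)
  have hV := bijective_sub_volterra D.T_pos.le L hc0 hcL
  set k : C(Icc (0 : ℝ) D.T, E) := primitiveCLM D.T_pos.le (D.ptw D.Y (D.ptw D.Q D.orbit)) with hk
  let A : B × C(Icc (0 : ℝ) D.T, E) →ₗ[ℝ] B × C(Icc (0 : ℝ) D.T, E) :=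
    LinearMap.prodMap LinearMap.id
      (LinearMap.id - (primitiveCLM D.T_pos.le ∘L L : C(Icc (0 : ℝ) D.T, E) →L[ℝ] _).toLinearMap)
  have hA : Function.Bijective A := Function.bijective_id.prodMap hV
  -- The first entry subtracts y.1 because `A` is taken to be the identity on B.
  let R : B × C(Icc (0 : ℝ) D.T, E) →ₗ[ℝ] B × E × ℝ :=
    { toFun := fun y => (D.T • D.M y.1 + D.kerProj y.1 - y.1,
        D.S (y.2 D.tend) + D.hat (D.q (y.2 D.tzero)),
        inner ℝ (D.Y (D.h (D.Z 0))) (y.2 D.tzero))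
      map_add' := fun y z => by
        refine Prod.ext ?_ (Prod.ext ?_ ?_)
        · simp only [Prod.fst_add, map_add, smul_add]; abel
        · simp only [Prod.snd_add, Prod.fst_add, ContinuousMap.add_apply, map_add]; abel
        · simp only [Prod.snd_add, ContinuousMap.add_apply, inner_add_right]
      map_smul' := fun r y => by
        refine Prod.ext ?_ (Prod.ext ?_ ?_)
        · simp only [Prod.smul_fst, map_smul, RingHom.id_apply, smul_sub, smul_add,
            smul_comm r D.T]
        · simp only [Prod.smul_snd, Prod.smul_fst, ContinuousMap.smul_apply, map_smul,
            RingHom.id_apply, smul_add]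
        · simp only [Prod.smul_snd, ContinuousMap.smul_apply, inner_smul_right,
            RingHom.id_apply, smul_eq_mul] }
  let i : B × E × ℝ →ₗ[ℝ] B × C(Icc (0 : ℝ) D.T, E) :=
    { toFun := fun z => (z.1, -D.cst E z.2.1 - z.2.2 • k)
      map_add' := fun y z => by
        refine Prod.ext rfl ?_
        simp only [Prod.snd_add, Prod.fst_add, map_add, add_smul]; abel
      map_smul' := fun r y => by
        refine Prod.ext rfl ?_
        simp only [Prod.smul_snd, Prod.smul_fst, map_smul, RingHom.id_apply, smul_sub, smul_neg,
          smul_eq_mul, mul_smul] }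
  have hsum : ∀ y, A y + i (R y) = fderiv ℝ (D.bvp hc fc) D.base (0, y) := by
    intro y
    rw [D.fderiv_bvp_base hhc hfc hf, D.fderiv_grad_base hhc hfc hf0]
    refine Prod.ext ?_ ?_
    · change y.1 + (D.T • D.M y.1 + D.kerProj y.1 - y.1) = D.T • D.M y.1 + D.kerProj y.1
      abel
    · change (y.2 - primitiveCLM D.T_pos.le (L y.2)) + (-D.cst E _ - _ • k) =
        y.2 - D.cst E _ - primitiveCLM D.T_pos.le (D.ptw D.Y (_ + _))
      have h8 : ∀ (u v : C(Icc (0 : ℝ) D.T, E)) (c : ℝ), primitiveCLM D.T_pos.le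
          (D.ptw D.Y (u + c • v)) = primitiveCLM D.T_pos.le (D.ptw D.Y u) +
            c • primitiveCLM D.T_pos.le (D.ptw D.Y v) := fun u v c => by
        rw [map_add, map_add, map_smul, map_smul]
      rw [h8, ← hk]
      change _ = y.2 - D.cst E _ - (primitiveCLM D.T_pos.le (L y.2) + _)
      change y.2 - primitiveCLM D.T_pos.le (L y.2) +
        (-D.cst E (D.S (y.2 D.tend) + D.hat (D.q (y.2 D.tzero))) -
          (inner ℝ (D.Y (D.h (D.Z 0))) (y.2 D.tzero) : ℝ) • k) = _
      abel
  have hinj : ∀ y, A y + i (R y) = 0 → y = 0 := by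
    intro y hy
    rw [hsum, D.fderiv_bvp_base hhc hfc hf, D.fderiv_grad_base hhc hfc hf0] at hy
    obtain ⟨h1, h2⟩ := Prod.ext_iff.1 hy
    refine Prod.ext (D.reduced_injective D.T_pos.ne' h1) ?_
    refine D.linearization_injective (real_inner_comm _ _) fun t => ?_
    have h3 := DFunLike.congr_fun h2 t
    change y.2 t - (D.S (y.2 D.tend) + D.hat (D.q (y.2 D.tzero))) -
      ∫ s in (0 : ℝ)..t, IccExtend D.T_pos.le (D.ptw D.Y (_ + _)) s = 0 at h3
    rw [sub_sub, sub_eq_zero] at h3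
    rw [h3]
    refine congrArg₂ (· + ·) rfl (intervalIntegral.integral_congr fun s hs => ?_)
    rw [uIcc_of_le t.2.1] at hs
    have hs' : s ∈ Icc 0 D.T := ⟨hs.1, hs.2.trans t.2.2⟩
    simp only [IccExtend_of_mem _ _ hs']
    have h4 := hLt y.2 ⟨s, hs'⟩
    change D.Y (fderiv ℝ (fun u : C(Icc (0 : ℝ) D.T, E) => hc.comp u) D.orbit y.2 ⟨s, hs'⟩) = _
      at h4
    rw [map_add]
    change _ = D.Y (fderiv ℝ D.h (D.Z s) (y.2 ⟨s, hs'⟩) + _)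
    rw [map_add D.Y, ← h4]
    rfl
  have := bijective_add_of_finiteDimensional A hA R i hinj
  convert this using 1
  funext y
  exact (hsum y).symm

end ClusterSystem

/-! ### Vanishing of the multipliers and continuation of the orbit. -/

namespace ClusterSystem

variable {E B : Type} [NormedAddCommGroup E] [InnerProductSpace ℝ E]
    [CompleteSpace E] [NormedAddCommGroup B] [InnerProductSpace ℝ B] (D : ClusterSystem E B)
    [FiniteDimensional ℝ B] {hc fc : C(E, E)}

/-- For solutions of the boundary value problem the Lagrange multipliers vanish. -/
theorem multipliers_eq_zero {r : ℝ} (hr : r ≠ 0) {b : B} {v : C(Icc (0 : ℝ) D.T, E)}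
    (h0 : D.bvp hc fc (r, b, v) = 0) (hU : ∀ t, v t ∈ D.U) (hh : ∀ t, hc (v t) = D.h (v t))
    (hO : ∀ t, D.hat b + r • v t ∈ D.O)
    (hf : ∀ t, fc (D.hat b + r • v t) = D.f (D.hat b + r • v t))
    (hQ : ∀ t, inner ℝ (D.Q (v t)) (D.Y (D.grad hc fc (r, b, v) t)) ≠ (0 : ℝ))
    (hC : ∀ t, D.C * ‖D.hat b + r • v t‖ < 1) :
    D.phase v = 0 ∧ D.kerProj b = 0 ∧ D.S (v D.tend) = v D.tzero := by
  have hT := D.T_pos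
  obtain ⟨h1, h2⟩ := Prod.ext_iff.1 h0
  obtain ⟨ℓ, hℓ⟩ : ∃ ℓ, ℓ = D.phase v := ⟨_, rfl⟩
  obtain ⟨μ, hμ⟩ : ∃ μ, μ = D.kerProj b := ⟨_, rfl⟩
  obtain ⟨g, hg⟩ : ∃ g, g = D.grad hc fc (r, b, v) := ⟨_, rfl⟩
  have hgt : ∀ t, g t = D.h (v t) + r • D.f (D.hat b + r • v t) + (r / D.T) • D.qs μ +
      ℓ • D.Q (v t) := by
    intro t
    rw [← hh t, ← hf t, hμ, hℓ, hg]
    rfl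
  obtain ⟨x, hx⟩ : ∃ x, x = D.S (v D.tend) + D.hat (D.q (v D.tzero)) := ⟨_, rfl⟩
  obtain ⟨W, hW⟩ : ∃ W, W = IccExtend hT.le (D.ptw D.Y g) := ⟨_, rfl⟩
  have hWc : Continuous W := by rw [hW]; exact (D.ptw D.Y g).continuous.Icc_extend'
  have hWt : ∀ t (ht : t ∈ Icc 0 D.T), W t = D.Y (g ⟨t, ht⟩) := by
    intro t ht
    rw [hW, IccExtend_of_mem _ _ ht]
    rfl
  obtain ⟨V, hV⟩ : ∃ V : ℝ → E, V = fun t => x + ∫ s in (0 : ℝ)..t, W s := ⟨_, rfl⟩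
  have hVd : ∀ t, HasDerivAt V (W t) t := fun t => by
    rw [hV]
    exact (hWc.integral_hasStrictDerivAt 0 t).hasDerivAt.const_add x
  have hVc : Continuous V := continuous_iff_continuousAt.2 fun t => (hVd t).continuousAt
  have hVv : ∀ t (ht : t ∈ Icc 0 D.T), V t = v ⟨t, ht⟩ := by
    intro t ht
    have h3 := DFunLike.congr_fun h2 ⟨t, ht⟩
    change v ⟨t, ht⟩ - (D.S (v D.tend) + D.hat (D.q (v D.tzero))) -
      ∫ s in (0 : ℝ)..t, IccExtend hT.le (D.ptw D.Y (D.grad hc fc (r, b, v))) s = 0 at h3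
    rw [← hg, ← hx, ← hW, sub_sub, sub_eq_zero] at h3
    rw [hV, h3]
  have hV0 : V 0 = v D.tzero := hVv 0 _
  have hVT : V D.T = v D.tend := hVv D.T _
  have hVb : V 0 = D.S (V D.T) + D.hat (D.q (V 0)) := by
    have : V 0 = x := by rw [hV]; simp
    rw [hVT]
    nth_rw 1 [this]
    rw [hx, hV0]
  -- conservation of the weighted centres
  have hqV : D.q (V D.T) = D.q (V 0) := by
    -- The drift of the centres over [0, T] is r YB applied to the first component of `bvp`, since P
    -- annihilates h and Q, and P ∘ qs is the identity.
    have h3 : D.q (V D.T) - D.q (V 0) = ∫ s in (0 : ℝ)..D.T, D.q (W s) := by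
      rw [intervalIntegral.integral_eq_sub_of_hasDerivAt
        (fun s _ => D.q.hasFDerivAt.comp_hasDerivAt s (hVd s))
        ((D.q.continuous.comp hWc).intervalIntegrable _ _)]
      rfl
    have h4 : D.ev B D.tend (primitiveCLM hT.le (D.ptw D.P (fc.comp (D.slowArg (r, b, v))))) + μ
        = 0 := by rw [hμ]; exact h1
    have h5 : Continuous (IccExtend hT.le (D.ptw D.P (fc.comp (D.slowArg (r, b, v))))) :=
      (D.ptw D.P (fc.comp (D.slowArg (r, b, v)))).continuous.Icc_extend'
    have h6 : ∫ s in (0 : ℝ)..D.T, D.q (W s) = ∫ s in (0 : ℝ)..D.T, D.YB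
        (r • IccExtend hT.le (D.ptw D.P (fc.comp (D.slowArg (r, b, v)))) s + (r / D.T) • μ) := by
      refine intervalIntegral.integral_congr fun s hs => ?_
      rw [uIcc_of_le hT.le] at hs
      rw [hWt s hs, D.q_Y, hgt, IccExtend_of_mem _ _ hs]
      simp only [map_add, map_smul, D.P_h _ (hU _), D.P_Q, D.P_qs, smul_zero, zero_add, add_zero]
      rw [← hf]
      rfl
    have h7 := D.YB.intervalIntegral_comp_comm (μ := volume) (a := 0) (b := D.T)
      (f := fun s => r • IccExtend hT.le (D.ptw D.P (fc.comp (D.slowArg (r, b, v)))) s +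
        (r / D.T) • μ) (Continuous.intervalIntegrable (by fun_prop) _ _)
    rw [h6, h7, intervalIntegral.integral_add (Continuous.intervalIntegrable (by fun_prop) _ _)
      intervalIntegrable_const, intervalIntegral.integral_smul, intervalIntegral.integral_const,
      sub_zero, smul_smul, mul_div_cancel₀ _ hT.ne', ← smul_add] at h3
    change _ = D.YB (r • (D.ev B D.tend (primitiveCLM hT.le
      (D.ptw D.P (fc.comp (D.slowArg (r, b, v))))) + μ)) at h3
    rw [h4, smul_zero, map_zero] at h3
    exact sub_eq_zero.1 h3
  have hq0 : D.q (V 0) = 0 := by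
    have h1 := congrArg D.q hVb
    rw [map_add, D.q_S, D.q_hat] at h1
    rw [← hqV]
    simpa using h1
  have hSV : D.S (V D.T) = V 0 := by
    rw [hq0, map_zero, add_zero] at hVb
    exact hVb.symm
  have hslow : D.S (D.hat b + r • V D.T) = D.hat b + r • V 0 := by
    rw [map_add, D.S_hat, map_smul, hSV]
  have hsd : ∀ t, HasDerivAt (fun t => D.hat b + r • V t) (r • W t) t := fun t =>
    ((hVd t).const_smul r).const_add _
  -- the energy
  have hℓ0 : ℓ = 0 := by
    -- All terms of the vector field except ℓQ are gradients of this function, and the velocity is Y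
    -- of the field, hence orthogonal to it. What remains is the work of -ℓQ.
    have hd : ∀ t ∈ Icc 0 D.T, HasDerivAt (fun t => D.H (V t) + D.F (D.hat b + r • V t) +
        (inner ℝ ((r / D.T) • D.qs μ) (V t) : ℝ))
        (-(ℓ * inner ℝ (D.Q (V t)) (W t))) t := by
      intro t ht
      have e1 : HasDerivAt (fun t => D.H (V t)) (inner ℝ (D.h (V t)) (W t)) t := by
        have hVU : V t ∈ D.U := by rw [hVv t ht]; exact hU _
        exact (D.hasGradientAt_H _ hVU).hasFDerivAt.comp_hasDerivAt t (hVd t)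
      have e2 : HasDerivAt (fun t => D.F (D.hat b + r • V t))
          (inner ℝ (D.f (D.hat b + r • V t)) (r • W t)) t := by
        have hVO : D.hat b + r • V t ∈ D.O := by rw [hVv t ht]; exact hO _
        exact (D.hasGradientAt_F _ hVO).hasFDerivAt.comp_hasDerivAt t (hsd t)
      have e3 : HasDerivAt (fun t => (inner ℝ ((r / D.T) • D.qs μ) (V t) : ℝ))
          (inner ℝ ((r / D.T) • D.qs μ) (W t)) t := by
        simpa using (hasDerivAt_const t ((r / D.T) • D.qs μ)).inner ℝ (hVd t)
      refine ((e1.add e2).add e3).congr_deriv ?_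
      have e4 : inner ℝ (g ⟨t, ht⟩) (W t) = (0 : ℝ) := by
        rw [hWt t ht]; exact D.inner_Y _
      rw [hgt, ← hVv t ht, inner_add_left, inner_add_left, inner_add_left] at e4
      rw [inner_smul_right]
      simp only [inner_smul_left, RCLike.conj_to_real] at e4 ⊢
      linarith
    -- H and F are S-invariant, and the linear term depends on V only through its conserved centre.
    have hend : D.H (V 0) + D.F (D.hat b + r • V 0) + (inner ℝ ((r / D.T) • D.qs μ) (V 0) : ℝ) =
        D.H (V D.T) + D.F (D.hat b + r • V D.T) +
          (inner ℝ ((r / D.T) • D.qs μ) (V D.T) : ℝ) := by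
      rw [← hslow, D.F_S, ← D.H_S (V D.T), hSV, inner_smul_left, inner_smul_left, D.inner_qs,
        D.inner_qs, hqV]
    obtain ⟨t, ht, h3⟩ := exists_hasDerivAt_eq_zero hT
      (fun t ht => (hd t ht).continuousAt.continuousWithinAt) hend
      (fun t ht => hd t (Ioo_subset_Icc_self ht))
    rw [neg_eq_zero, mul_eq_zero] at h3
    refine h3.resolve_right ?_
    have ht' := Ioo_subset_Icc_self ht
    rw [hWt t ht', hVv t ht', hg]
    exact hQ _
  refine ⟨hℓ ▸ hℓ0, ?_, by rw [← hVT, hSV, hV0]⟩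
  -- the first integral generated by the symmetry
  have hμM : D.M μ = 0 := by rw [hμ]; exact D.M_kerProj b
  obtain ⟨I, ξ, hI, hIS, hIξ, hinv, hξ⟩ := D.symmetry μ hμM
  -- With ℓ = 0 the symmetry removes the Hamiltonian terms, and only the multiplier μ contributes to
  -- the derivative of the integral.
  have hd : ∀ t ∈ Icc 0 D.T, HasDerivAt (fun t => I (D.hat b + r • V t))
      (r * (r / D.T * inner ℝ (D.qs μ) (ξ (D.hat b + r • V t)))) t := by
    intro t ht
    refine ((hI _).hasFDerivAt.comp_hasDerivAt t (hsd t)).congr_deriv ?_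
    have e1 := hinv r hr b (v ⟨t, ht⟩) (hU _) (hO _)
    rw [map_smul, hWt t ht, hIξ, hgt, hℓ0, ← hVv t ht, zero_smul, add_zero, inner_add_left]
    rw [← hVv t ht] at e1
    rw [e1, zero_add, inner_smul_left, smul_eq_mul, RCLike.conj_to_real]
  have hend : I (D.hat b + r • V 0) = I (D.hat b + r • V D.T) := by rw [← hslow, hIS]
  obtain ⟨t, ht, h3⟩ := exists_hasDerivAt_eq_zero hT
    (fun t ht => (hd t ht).continuousAt.continuousWithinAt) hend
    (fun t ht => hd t (Ioo_subset_Icc_self ht))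
  have h4 : inner ℝ (D.qs μ) (ξ (D.hat b + r • V t)) = (0 : ℝ) :=
    ((mul_eq_zero.1 ((mul_eq_zero.1 h3).resolve_left hr)).resolve_left (div_ne_zero hr hT.ne'))
  have h5 := hξ (D.hat b + r • V t)
  have h6 := hC ⟨t, Ioo_subset_Icc_self ht⟩
  rw [← hVv t] at h6
  rw [h4] at h5
  rw [← hμ]
  by_contra hne
  have h7 : 0 < ‖μ‖ ^ 2 := by positivity
  -- At the Rolle point ‖μ‖²(1 - C‖x‖) ≤ 0, whereas C‖x‖ < 1.
  nlinarith

/-- Solutions with vanishing multipliers satisfy the unperturbed equation. -/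
theorem grad_apply_of_multipliers {r : ℝ} {b : B} {v : C(Icc (0 : ℝ) D.T, E)}
    (hp : D.phase v = 0) (hb : D.kerProj b = 0) (hh : ∀ t, hc (v t) = D.h (v t))
    (hf : ∀ t, fc (D.hat b + r • v t) = D.f (D.hat b + r • v t)) (t : Icc (0 : ℝ) D.T) :
    D.grad hc fc (r, b, v) t = D.h (v t) + r • D.f (D.hat b + r • v t) := by
  have : D.grad hc fc (r, b, v) t = hc (v t) + r • fc (D.hat b + r • v t) +
    (r / D.T) • D.qs (D.kerProj b) + D.phase v • D.Q (v t) := rfl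
  rw [this, hp, hb, hh, hf]
  simp

/-- Evaluation at time 0 identifies the integration constant in the second component with v(0). -/
theorem eq_primitive_of_bvp {r : ℝ} {b : B} {v : C(Icc (0 : ℝ) D.T, E)}
    (h0 : D.bvp hc fc (r, b, v) = 0) :
    v = ContinuousMap.const _ (v D.tzero) +
      primitiveCLM D.T_pos.le (D.ptw D.Y (D.grad hc fc (r, b, v))) := by
  obtain ⟨-, h2⟩ := Prod.ext_iff.1 h0
  have h3 : ∀ t, v t = (D.S (v D.tend) + D.hat (D.q (v D.tzero))) +
      primitiveCLM D.T_pos.le (D.ptw D.Y (D.grad hc fc (r, b, v))) t := by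
    intro t
    have h4 := DFunLike.congr_fun h2 t
    change v t - (D.S (v D.tend) + D.hat (D.q (v D.tzero))) -
      primitiveCLM D.T_pos.le (D.ptw D.Y (D.grad hc fc (r, b, v))) t = 0 at h4
    rwa [sub_sub, sub_eq_zero] at h4
  have h5 : v D.tzero = D.S (v D.tend) + D.hat (D.q (v D.tzero)) := by
    nth_rw 1 [h3 D.tzero]
    rw [show primitiveCLM D.T_pos.le (D.ptw D.Y (D.grad hc fc (r, b, v))) D.tzero = 0 from
      primitiveCLM_zero _ _, add_zero]
  ext t
  rw [ContinuousMap.add_apply, ContinuousMap.const_apply]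
  nth_rw 1 [h3 t]
  rw [← h5]

variable [FiniteDimensional ℝ E]

omit [FiniteDimensional ℝ B] [FiniteDimensional ℝ E] in
-- Mapping a compact space into a given open set is an open condition in the compact-open topology.
theorem eventually_forall_mem {V : Type} [TopologicalSpace V]
    {φ : ℝ → C(Icc (0 : ℝ) D.T, V)} (hφ : ContinuousAt φ 0) {O : Set V} (hO : IsOpen O)
    (h : ∀ t, φ 0 t ∈ O) : ∀ᶠ r in 𝓝 0, ∀ t, φ r t ∈ O := by
  have h1 := ContinuousMap.isOpen_setOfPred_mapsTo (X := Icc (0 : ℝ) D.T) isCompact_univ hO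
  filter_upwards [hφ.preimage_mem_nhds (h1.mem_nhds fun t _ => h t)] with r hr t
  exact hr (mem_univ t)

/-- Continuation of the orbit `Z` for small values of the scaling parameter. -/
theorem exists_continuation : ∃ (b : ℝ → B) (v w : ℝ → C(Icc (0 : ℝ) D.T, E)),
    ContDiffAt ℝ D.n b 0 ∧ ContDiffAt ℝ D.n v 0 ∧ ContDiffAt ℝ D.n w 0 ∧
    HasDerivAt b 0 0 ∧ HasDerivAt v 0 0 ∧ HasDerivAt w 0 0 ∧ b 0 = 0 ∧ v 0 = D.orbit ∧
    ∀ᶠ r in 𝓝 0, v r = ContinuousMap.const _ (v r D.tzero) + primitiveCLM D.T_pos.le (w r) ∧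
      D.S (v r D.tend) = v r D.tzero ∧
      ∀ t, v r t ∈ D.U ∧ D.hat (b r) + r • v r t ∈ D.O ∧
        w r t = D.Y (D.h (v r t) + r • D.f (D.hat (b r) + r • v r t)) := by
  have hn1 : (1 : WithTop ℕ∞) ≤ D.n := by exact_mod_cast Nat.one_le_iff_ne_zero.2 D.n_ne_zero
  -- The gradients are singular at collisions. Cut-offs near the orbit and near 0 give globally
  -- defined superposition operators, and the curves found for small r stay where nothing has been
  -- changed.
  obtain ⟨h', hh', Vh, hVh, hZV, hVU, hhV⟩ := exists_contDiff_eqOn_nhds D.isOpen_U D.contDiffOn_h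
    (isCompact_range D.orbit.continuous) (range_subset_iff.2 fun t => D.Z_mem t)
  obtain ⟨f', hf', Vf, hVf, h0V, hVO, hfV⟩ := exists_contDiff_eqOn_nhds D.isOpen_O D.contDiffOn_f
    (isCompact_singleton (x := (0 : E))) (singleton_subset_iff.2 D.zero_mem_O)
  set hc : C(E, E) := ⟨h', hh'.continuous⟩
  set fc : C(E, E) := ⟨f', hf'.continuous⟩
  have hhe : ∀ t : Icc (0 : ℝ) D.T, hc =ᶠ[𝓝 (D.Z t)] D.h := fun t => by
    filter_upwards [hVh.mem_nhds (hZV (mem_range_self t))] with x hx using hhV hx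
  have hfe : fc =ᶠ[𝓝 0] D.f := by
    filter_upwards [hVf.mem_nhds (h0V rfl)] with x hx using hfV hx
  have hhc : ContDiff ℝ D.n hc := hh'
  have hfc : ContDiff ℝ D.n fc := hf'
  have hG := D.contDiff_bvp hhc hfc
  have hg := D.contDiff_grad hhc hfc
  have hhc1 : ContDiff ℝ 1 hc := hhc.of_le hn1
  have hfc1 : ContDiff ℝ 1 fc := hfc.of_le hn1
  have hg0 : fderiv ℝ (D.grad hc fc) D.base (1, 0) = 0 := by
    rw [D.fderiv_grad_base hhc1 hfc1 (hfe.self_of_nhds.trans D.f_zero)]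
    simp
  have hr0 : fderiv ℝ (D.bvp hc fc) D.base (1, 0) = 0 := by
    rw [D.fderiv_bvp_base hhc1 hfc1 hfe, hg0]
    refine Prod.ext ?_ ?_ <;> simp
  obtain ⟨y, hy, hy0, hyd, hyG⟩ := exists_implicit_curve D.n_ne_zero (D.bvp hc fc) hG (0, D.orbit)
    (D.bvp_base hfe hhe) (D.bijective_fderiv_bvp hhc1 hfc1 hfe hhe) hr0
  have hn0 : ((D.n : ℕ) : WithTop ℕ∞) ≠ 0 := by exact_mod_cast D.n_ne_zero
  have hp : ContDiffAt ℝ D.n (fun r => (r, y r)) 0 := contDiffAt_id.prodMk hy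
  have hp0 : ((0 : ℝ), y 0) = D.base := by rw [hy0]; rfl
  have hpd : HasDerivAt (fun r => (r, y r)) (1, 0) 0 := (hasDerivAt_id 0).prodMk hyd
  have hgy : ContDiffAt ℝ D.n (fun r => D.ptw D.Y (D.grad hc fc (r, y r))) 0 :=
    (D.ptw D.Y).contDiff.contDiffAt.comp (0 : ℝ) (hg.contDiffAt.comp (0 : ℝ) hp)
  have hgd : HasDerivAt (fun r => D.ptw D.Y (D.grad hc fc (r, y r))) 0 0 := by
    have h1 : HasFDerivAt (D.grad hc fc) (fderiv ℝ (D.grad hc fc) D.base) ((0 : ℝ), y 0) := by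
      rw [hp0]
      exact (hg.differentiable hn0 _).hasFDerivAt
    have h2 := h1.comp_hasDerivAt (0 : ℝ) hpd
    rw [hg0] at h2
    have h3 := (D.ptw D.Y).hasFDerivAt.comp_hasDerivAt (0 : ℝ) h2
    rw [map_zero] at h3
    exact h3
  have hv : ContDiffAt ℝ D.n (fun r => (y r).2) 0 := hy.snd
  have hsl : ContinuousAt (fun r => D.slowArg (r, y r)) 0 :=
    ((D.contDiff_slowArg (k := 1)).contDiffAt.comp (0 : ℝ) (hp.of_le hn1)).continuousAt
  have hsl0 : D.slowArg ((0 : ℝ), y 0) = 0 := by rw [hp0, D.slowArg_base]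
  refine ⟨fun r => (y r).1, fun r => (y r).2, fun r => D.ptw D.Y (D.grad hc fc (r, y r)),
    hy.fst, hv, hgy, hyd.fst, hyd.snd, hgd, congrArg Prod.fst hy0, congrArg Prod.snd hy0, ?_⟩
  have ev1 : ∀ᶠ r in 𝓝 0, ∀ t, (y r).2 t ∈ Vh :=
    D.eventually_forall_mem hv.continuousAt hVh fun t => by
      rw [hy0]; exact hZV (mem_range_self t)
  have ev2 : ∀ᶠ r in 𝓝 0, ∀ t, D.slowArg (r, y r) t ∈ Vf ∩ {x | D.C * ‖x‖ < 1} :=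
    D.eventually_forall_mem hsl
      (hVf.inter (isOpen_lt (by fun_prop) continuous_const)) fun t => by
        rw [hsl0]; exact ⟨h0V rfl, by simp⟩
  have ev3 : ∀ᶠ r in 𝓝 0, ∀ t, ((y r).2.prodMk (D.ptw D.Y (D.grad hc fc (r, y r)))) t ∈
      {z : E × E | (inner ℝ (D.Q z.1) z.2 : ℝ) ≠ 0} := by
    refine D.eventually_forall_mem ?_ ?_ fun t => ?_
    · have h1 : ∀ r, (y r).2.prodMk (D.ptw D.Y (D.grad hc fc (r, y r))) =
          D.ptw (ContinuousLinearMap.inl ℝ E E) (y r).2 +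
          D.ptw (ContinuousLinearMap.inr ℝ E E) (D.ptw D.Y (D.grad hc fc (r, y r))) := fun r => by
        ext t
        · exact (add_zero _).symm
        · exact (zero_add _).symm
      simp only [h1]
      exact ((D.ptw (ContinuousLinearMap.inl ℝ E E)).continuous.continuousAt.comp
        hv.continuousAt).add ((D.ptw (ContinuousLinearMap.inr ℝ E E)).continuous.continuousAt.comp
        hgy.continuousAt)
    · exact isOpen_ne_fun (by fun_prop) continuous_const
    · have h1 : D.grad hc fc ((0 : ℝ), y 0) t = D.h (D.Z t) := by
        rw [hy0]
        have h2 : D.grad hc fc ((0 : ℝ), ((0 : B), D.orbit)) t = hc (D.Z t) +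
          (0 : ℝ) • fc (D.hat 0 + (0 : ℝ) • D.Z t) + (0 / D.T) • D.qs (D.kerProj 0) +
          D.phase D.orbit • D.Q (D.Z t) := rfl
        rw [h2, D.phase_orbit, (hhe t).self_of_nhds]
        simp
      change (inner ℝ (D.Q ((y 0).2 t)) (D.Y (D.grad hc fc (0, y 0) t)) : ℝ) ≠ 0
      rw [h1, hy0]
      exact D.inner_Q_Z t
  filter_upwards [hyG, ev1, ev2, ev3] with r hG0 h1 h2 h3
  have hU : ∀ t, (y r).2 t ∈ D.U := fun t => hVU (h1 t)
  have hh : ∀ t, hc ((y r).2 t) = D.h ((y r).2 t) := fun t => hhV (h1 t)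
  have hO : ∀ t, D.hat (y r).1 + r • (y r).2 t ∈ D.O := fun t => hVO (h2 t).1
  have hf : ∀ t, fc (D.hat (y r).1 + r • (y r).2 t) = D.f (D.hat (y r).1 + r • (y r).2 t) :=
    fun t => hfV (h2 t).1
  have hm : D.phase (y r).2 = 0 ∧ D.kerProj (y r).1 = 0 ∧
      D.S ((y r).2 D.tend) = (y r).2 D.tzero := by
    -- The argument with the Noether integral divides by r, so the base orbit is treated separately.
    rcases eq_or_ne r 0 with rfl | hr
    · rw [hy0]
      exact ⟨D.phase_orbit, map_zero _, (by simpa using D.S_Z 0 : D.S (D.Z D.T) = D.Z 0)⟩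
    · exact D.multipliers_eq_zero hr hG0 hU hh hO hf h3 fun t => (h2 t).2
  refine ⟨D.eq_primitive_of_bvp hG0, hm.2.2, fun t => ⟨hU t, hO t, ?_⟩⟩
  change D.Y (D.grad hc fc (r, (y r).1, (y r).2) t) = _
  rw [D.grad_apply_of_multipliers hm.1 hm.2.1 hh hf]

end ClusterSystem

/-! ### Linear maps on configurations -/

instance continuousSMul_conf {ι : Type} [Fintype ι] : ContinuousSMul ℝ (Conf ι) :=
  IsBoundedSMul.continuousSMul

/-- The rotation `J` as a continuous linear map. -/
def rotJL : Plane →L[ℝ] Plane :=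
  LinearMap.toContinuousLinearMap
    { toFun := rotJ
      map_add' := fun x y => by ext k; fin_cases k <;> simp [rotJ, add_comm]
      map_smul' := fun c x => by ext k; fin_cases k <;> simp [rotJ] }

theorem rotJL_apply (x : Plane) : rotJL x = rotJ x := rfl

theorem inner_rotJL_self (x : Plane) : inner ℝ x (rotJL x) = 0 := by
  simp [rotJL_apply, rotJ, PiLp.inner_apply, Fin.sum_univ_two]; ring

theorem inner_rotJL_rotJL (x y : Plane) : inner ℝ (rotJL x) (rotJL y) = inner ℝ x y := by
  simp [rotJL_apply, rotJ, PiLp.inner_apply, Fin.sum_univ_two]; ring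

theorem rotJL_rotJL (x : Plane) : rotJL (rotJL x) = -x := by
  ext k; fin_cases k <;> simp [rotJL_apply, rotJ]

theorem inner_rotJL_right (x y : Plane) : inner ℝ x (rotJL y) = -inner ℝ (rotJL x) y := by
  rw [← inner_rotJL_rotJL, rotJL_rotJL, inner_neg_right]

theorem rotJL_eq_zero {x : Plane} : rotJL x = 0 ↔ x = 0 := by
  refine ⟨fun h => ?_, fun h => by rw [h, map_zero]⟩
  have := rotJL_rotJL x
  rw [h, map_zero] at this
  simpa using this.symm

section General

variable {ι : Type} [Fintype ι]

/-- The map `z ↦ (cᵢ⁻¹ J zᵢ)ᵢ`. -/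
def confRot (c : ι → ℝ) : Conf ι →L[ℝ] Conf ι :=
  { toFun := fun z => WithLp.toLp 2 fun i => (c i)⁻¹ • rotJL (z i)
    map_add' := fun x y => by ext i : 1; simp
    map_smul' := fun a x => by ext i : 1; simp [smul_comm a]
    cont := by fun_prop }

omit [Fintype ι] in
@[simp] theorem confRot_apply (c : ι → ℝ) (z : Conf ι) (i : ι) :
    confRot c z i = (c i)⁻¹ • rotJL (z i) := rfl

theorem inner_confRot (c : ι → ℝ) (z : Conf ι) : inner ℝ z (confRot c z) = 0 := by
  rw [PiLp.inner_apply]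
  exact Finset.sum_eq_zero fun i _ => by
    rw [confRot_apply, inner_smul_right, inner_rotJL_self, mul_zero]

/-- Relabelling of the components, as a linear isometry. -/
def relabel (π : Equiv.Perm ι) : Conf ι ≃ₗᵢ[ℝ] Conf ι :=
  LinearIsometryEquiv.piLpCongrLeft 2 ℝ Plane π

@[simp] theorem relabel_apply (π : Equiv.Perm ι) (z : Conf ι) (i : ι) :
    relabel π z i = z (π⁻¹ i) := by
  simp [relabel, Equiv.piCongrLeft'_apply]

theorem confRot_relabel {c : ι → ℝ} {π : Equiv.Perm ι} (hc : ∀ i, c (π⁻¹ i) = c i) (z : Conf ι) :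
    confRot c (relabel π z) = relabel π (confRot c z) := by
  ext i : 1
  rw [confRot_apply, relabel_apply, relabel_apply, confRot_apply, hc]

theorem relabel_one : relabel (1 : Equiv.Perm ι) = 1 := by
  ext z i : 2
  rw [relabel_apply, inv_one]
  rfl

theorem relabel_mul (π ρ : Equiv.Perm ι) : relabel (π * ρ) = relabel π * relabel ρ := by
  ext z i : 2
  change _ = relabel π (relabel ρ z) i
  rw [relabel_apply, mul_inv_rev, relabel_apply, relabel_apply]
  rfl

theorem relabel_pow (π : Equiv.Perm ι) (n : ℕ) : relabel π ^ n = relabel (π ^ n) := by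
  induction n with
  | zero => rw [pow_zero, pow_zero, relabel_one]
  | succ n ih => rw [pow_succ, pow_succ, ih, relabel_mul]

end General

section Clusters

variable {m : ℕ} {N : Fin m → ℕ}

/-- `a ↦ â` as a continuous linear map. -/
def hatCLM (N : Fin m → ℕ) : Conf (Fin m) →L[ℝ] Conf (Σ k, Fin (N k)) :=
  { toFun := fun a => WithLp.toLp 2 fun i => a i.1
    map_add' := fun x y => rfl
    map_smul' := fun a x => rfl
    cont := by fun_prop }

theorem hatCLM_eq (a : Conf (Fin m)) : hatCLM N a = hatConf N a := rfl

@[simp] theorem hatCLM_apply (a : Conf (Fin m)) (i : Σ k, Fin (N k)) : hatCLM N a i = a i.1 := rfl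

/-- The cluster sums `∑ⱼ zₖⱼ`. -/
def clusterSum (N : Fin m → ℕ) : Conf (Σ k, Fin (N k)) →L[ℝ] Conf (Fin m) :=
  { toFun := fun z => WithLp.toLp 2 fun k => ∑ j, z ⟨k, j⟩
    map_add' := fun x y => by ext k : 1; simp [Finset.sum_add_distrib]
    map_smul' := fun a x => by ext k : 1; simp [Finset.smul_sum]
    cont := by fun_prop }

@[simp] theorem clusterSum_apply (z : Conf (Σ k, Fin (N k))) (k : Fin m) :
    clusterSum N z k = ∑ j, z ⟨k, j⟩ := rfl

theorem inner_clusterSum (x : Conf (Σ k, Fin (N k))) (a : Conf (Fin m)) :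
    inner ℝ (clusterSum N x) a = inner ℝ x (hatCLM N a) := by
  rw [PiLp.inner_apply, PiLp.inner_apply, Fintype.sum_sigma]
  simp [sum_inner]

/-- The centres of vorticity `Γₖ⁻¹ ∑ⱼ γₖⱼ zₖⱼ` of the clusters. -/
def clusterCenter (γ : ∀ k, Fin (N k) → ℝ) (Γ : Fin m → ℝ) :
    Conf (Σ k, Fin (N k)) →L[ℝ] Conf (Fin m) :=
  { toFun := fun z => WithLp.toLp 2 fun k => (Γ k)⁻¹ • ∑ j, γ k j • z ⟨k, j⟩
    map_add' := fun x y => by ext k : 1; simp [Finset.sum_add_distrib]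
    map_smul' := fun a x => by
      ext k : 1
      simp only [PiLp.smul_apply, smul_comm (γ k _) a, ← Finset.smul_sum, RingHom.id_apply]
      rw [smul_comm]
    cont := by fun_prop }

@[simp] theorem clusterCenter_apply (γ : ∀ k, Fin (N k) → ℝ) (Γ : Fin m → ℝ)
    (z : Conf (Σ k, Fin (N k))) (k : Fin m) :
    clusterCenter γ Γ z k = (Γ k)⁻¹ • ∑ j, γ k j • z ⟨k, j⟩ := rfl

/-- The adjoint of `clusterCenter`. -/
def clusterSpread (γ : ∀ k, Fin (N k) → ℝ) (Γ : Fin m → ℝ) :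
    Conf (Fin m) →L[ℝ] Conf (Σ k, Fin (N k)) :=
  { toFun := fun b => WithLp.toLp 2 fun i => (γ i.1 i.2 / Γ i.1) • b i.1
    map_add' := fun x y => by ext i : 1; simp
    map_smul' := fun a x => by ext i : 1; simp [smul_comm a]
    cont := by fun_prop }

@[simp] theorem clusterSpread_apply (γ : ∀ k, Fin (N k) → ℝ) (Γ : Fin m → ℝ)
    (b : Conf (Fin m)) (i : Σ k, Fin (N k)) :
    clusterSpread γ Γ b i = (γ i.1 i.2 / Γ i.1) • b i.1 := rfl

theorem inner_clusterSpread (γ : ∀ k, Fin (N k) → ℝ) (Γ : Fin m → ℝ) (a : Conf (Fin m))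
    (x : Conf (Σ k, Fin (N k))) :
    inner ℝ (clusterSpread γ Γ a) x = inner ℝ a (clusterCenter γ Γ x) := by
  rw [PiLp.inner_apply, PiLp.inner_apply, Fintype.sum_sigma]
  refine Finset.sum_congr rfl fun k _ => ?_
  simp only [clusterSpread_apply, clusterCenter_apply, inner_smul_right, inner_sum,
    real_inner_smul_left, Finset.mul_sum]
  exact Finset.sum_congr rfl fun j _ => by rw [div_eq_inv_mul, mul_assoc]

/-- The rotated deviations `J (zₖⱼ - mean of the kth cluster)`. -/
def clusterTwist (N : Fin m → ℕ) : Conf (Σ k, Fin (N k)) →L[ℝ] Conf (Σ k, Fin (N k)) :=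
  { toFun := fun z => WithLp.toLp 2 fun i =>
      rotJL (z i - (N i.1 : ℝ)⁻¹ • clusterSum N z i.1)
    map_add' := fun x y => by
      ext i : 1
      simp only [map_add, PiLp.add_apply, smul_add, map_sub]
      abel
    map_smul' := fun a x => by
      ext i : 1
      simp only [map_smul, PiLp.smul_apply, map_sub, smul_sub, RingHom.id_apply]
      rw [smul_comm]
    cont := by fun_prop }

@[simp] theorem clusterTwist_apply (z : Conf (Σ k, Fin (N k))) (i : Σ k, Fin (N k)) :
    clusterTwist N z i = rotJL (z i - (N i.1 : ℝ)⁻¹ • clusterSum N z i.1) := rfl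

theorem clusterSum_clusterTwist (hN : ∀ k, N k ≠ 0) (z : Conf (Σ k, Fin (N k))) :
    clusterSum N (clusterTwist N z) = 0 := by
  ext k : 1
  have : (N k : ℝ) ≠ 0 := Nat.cast_ne_zero.2 (hN k)
  simp only [clusterSum_apply, clusterTwist_apply, ← map_sum, Finset.sum_sub_distrib,
    Finset.sum_const, Finset.card_univ, Fintype.card_fin, ← Nat.cast_smul_eq_nsmul ℝ, smul_smul,
    mul_inv_cancel₀ this, one_smul, sub_self, map_zero, PiLp.zero_apply]

theorem clusterCenter_hatCLM {γ : ∀ k, Fin (N k) → ℝ} {Γ : Fin m → ℝ}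
    (hsum : ∀ k, ∑ j, γ k j = Γ k) (hΓ : ∀ k, Γ k ≠ 0) (a : Conf (Fin m)) :
    clusterCenter γ Γ (hatCLM N a) = a := by
  ext k : 1
  simp only [clusterCenter_apply, hatCLM_apply, ← Finset.sum_smul, hsum, smul_smul,
    inv_mul_cancel₀ (hΓ k), one_smul]

/-- The vorticities in the weights cancel those in the symplectic structure, so the centres move by
the total force on their cluster. -/
theorem clusterCenter_confRot {γ : ∀ k, Fin (N k) → ℝ} (hγ : ∀ k j, γ k j ≠ 0) (Γ : Fin m → ℝ)
    (x : Conf (Σ k, Fin (N k))) :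
    clusterCenter γ Γ (confRot (fun i : Σ k, Fin (N k) => γ i.1 i.2) x) =
      confRot Γ (clusterSum N x) := by
  ext k : 1
  simp only [clusterCenter_apply, confRot_apply, smul_smul, mul_inv_cancel₀ (hγ k _), one_smul,
    clusterSum_apply, map_sum]

theorem clusterPermAct_eq (σ : ∀ k, Equiv.Perm (Fin (N k))) (z : Conf (Σ k, Fin (N k))) :
    relabel (Equiv.sigmaCongrRight σ) z = clusterPermAct σ z := by
  ext i : 1
  rw [relabel_apply]
  rfl

theorem relabel_sigmaCongrRight_hatCLM (σ : ∀ k, Equiv.Perm (Fin (N k))) (a : Conf (Fin m)) :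
    relabel (Equiv.sigmaCongrRight σ) (hatCLM N a) = hatCLM N a := by
  rw [clusterPermAct_eq]
  rfl

theorem clusterCenter_relabel {γ : ∀ k, Fin (N k) → ℝ} (Γ : Fin m → ℝ)
    {σ : ∀ k, Equiv.Perm (Fin (N k))} (hσ : ∀ k j, γ k j = γ k ((σ k)⁻¹ j))
    (x : Conf (Σ k, Fin (N k))) :
    clusterCenter γ Γ (relabel (Equiv.sigmaCongrRight σ) x) = clusterCenter γ Γ x := by
  rw [clusterPermAct_eq]
  ext k : 1
  simp only [clusterCenter_apply, clusterPermAct]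
  congr 1
  rw [← Equiv.sum_comp (σ k)⁻¹ fun j => γ k j • x ⟨k, j⟩]
  exact Finset.sum_congr rfl fun j _ => by rw [← hσ]

theorem relabel_sigmaCongrRight_pow_orderOf (σ : ∀ k, Equiv.Perm (Fin (N k))) :
    relabel (Equiv.sigmaCongrRight σ) ^ orderOf σ = 1 := by
  have h : Equiv.sigmaCongrRight σ = Equiv.Perm.sigmaCongrRightHom (fun k => Fin (N k)) σ := rfl
  rw [relabel_pow, h, ← map_pow, pow_orderOf_eq_one, map_one, relabel_one]

end Clusters

/-! ### Pair interaction Hamiltonians -/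

section Gradient

variable {E : Type} [NormedAddCommGroup E] [InnerProductSpace ℝ E] [CompleteSpace E]

theorem contDiffOn_gradient {F : E → ℝ} {s : Set E} (hs : IsOpen s) {n : ℕ}
    (hF : ContDiffOn ℝ (n + 1 : ℕ) F s) : ContDiffOn ℝ n (gradient F) s :=
  (InnerProductSpace.toDual ℝ E).symm.toContinuousLinearEquiv.contDiff.comp_contDiffOn
    (hF.fderiv_of_isOpen hs (by norm_cast))

theorem ContDiffOn.hasGradientAt {F : E → ℝ} {s : Set E} (hs : IsOpen s) {n : ℕ} (hn : n ≠ 0)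
    (hF : ContDiffOn ℝ n F s) {x : E} (hx : x ∈ s) : HasGradientAt F (gradient F x) x :=
  ((hF.contDiffAt (hs.mem_nhds hx)).differentiableAt (by exact_mod_cast hn)).hasGradientAt

theorem inner_gradient {F : E → ℝ} (x y : E) :
    inner ℝ (gradient F x) y = fderiv ℝ F x y := by
  rw [gradient, InnerProductSpace.toDual_symm_apply]

end Gradient

section Pair

variable {ι : Type}

/-- Configurations in `Ω` such that vortices related by `ρ` do not collide. -/
def separated (Ω : Set Plane) (ρ : ι → ι → Prop) : Set (Conf ι) :=
  {z | (∀ i, z i ∈ Ω) ∧ ∀ i j, ρ i j → z i ≠ z j}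

variable [Fintype ι]

theorem isOpen_separated {Ω : Set Plane} (hΩ : IsOpen Ω) (ρ : ι → ι → Prop) :
    IsOpen (separated Ω ρ) := by
  refine IsOpen.inter (s := {z : Conf ι | ∀ i, z i ∈ Ω})
    (t := {z : Conf ι | ∀ i j, ρ i j → z i ≠ z j}) ?_ ?_
  · rw [ofPred_forall]
    exact isOpen_iInter_of_finite fun i => hΩ.preimage
      (by fun_prop : Continuous fun z : Conf ι => z i)
  · simp only [ofPred_forall]
    refine isOpen_iInter_of_finite fun i => isOpen_iInter_of_finite fun j =>
      isOpen_iInter_of_finite fun _ => isOpen_ne_fun ?_ ?_ <;> fun_prop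

theorem relabel_mem_separated {Ω : Set Plane} {ρ : ι → ι → Prop} {π : Equiv.Perm ι}
    (hρ : ∀ i j, ρ (π⁻¹ i) (π⁻¹ j) ↔ ρ i j) (z : Conf ι) :
    relabel π z ∈ separated Ω ρ ↔ z ∈ separated Ω ρ := by
  simp only [separated, mem_ofPred_eq, relabel_apply]
  refine and_congr ?_ ?_
  · exact ⟨fun h i => by simpa using h (π i), fun h i => h _⟩
  · constructor
    · intro h i j hij
      have := h (π i) (π j)
      rw [← hρ] at this
      simpa using this (by simpa using hij)
    · exact fun h i j hij => h _ _ ((hρ i j).2 hij)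

/-- The Hamiltonian `∑ᵢⱼ cᵢ cⱼ Kᵢⱼ(zᵢ, zⱼ)`. -/
def pairHam (c : ι → ℝ) (K : ι → ι → Plane × Plane → ℝ) (z : Conf ι) : ℝ :=
  ∑ i, ∑ j, c i * c j * K i j (z i, z j)

theorem contDiffAt_pairHam {n : WithTop ℕ∞} (c : ι → ℝ) {K : ι → ι → Plane × Plane → ℝ}
    {z : Conf ι} (h : ∀ i j, ContDiffAt ℝ n (K i j) (z i, z j)) :
    ContDiffAt ℝ n (pairHam c K) z := by
  refine ContDiffAt.sum fun i _ => ContDiffAt.sum fun j _ => contDiffAt_const.mul ?_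
  exact ContDiffAt.comp z (g := K i j) (f := fun z : Conf ι => (z i, z j)) (h i j) (by fun_prop)

theorem fderiv_pairHam (c : ι → ℝ) {K : ι → ι → Plane × Plane → ℝ}
    {z : Conf ι} (h : ∀ i j, DifferentiableAt ℝ (K i j) (z i, z j)) (y : Conf ι) :
    fderiv ℝ (pairHam c K) z y =
      ∑ i, ∑ j, c i * c j * fderiv ℝ (K i j) (z i, z j) (y i, y j) := by
  have hc : ∀ i j, HasFDerivAt (fun z : Conf ι => (z i, z j))
      ((PiLp.proj 2 (fun _ : ι => Plane) i : Conf ι →L[ℝ] Plane).prod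
        (PiLp.proj 2 (fun _ : ι => Plane) j)) z := fun i j =>
    ((PiLp.proj 2 (fun _ : ι => Plane) i : Conf ι →L[ℝ] Plane).prod
      (PiLp.proj 2 (fun _ : ι => Plane) j)).hasFDerivAt
  have := HasFDerivAt.fun_sum (u := Finset.univ) fun i _ =>
    HasFDerivAt.fun_sum (u := Finset.univ) fun j _ =>
    ((((h i j).hasFDerivAt.comp z (hc i j))).const_mul (c i * c j))
  rw [show pairHam c K = fun z => ∑ i, ∑ j, c i * c j * (K i j ∘ fun z : Conf ι => (z i, z j)) z
    from rfl, this.fderiv]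
  simp

theorem pairHam_relabel {c : ι → ℝ} {K : ι → ι → Plane × Plane → ℝ} {π : Equiv.Perm ι}
    (hc : ∀ i, c (π⁻¹ i) = c i) (hK : ∀ i j, K (π⁻¹ i) (π⁻¹ j) = K i j) (z : Conf ι) :
    pairHam c K (relabel π z) = pairHam c K z := by
  simp only [pairHam, relabel_apply]
  rw [← Equiv.sum_comp π⁻¹ fun i => ∑ j, c i * c j * K i j (z i, z j)]
  refine Finset.sum_congr rfl fun i _ => ?_
  rw [← Equiv.sum_comp π⁻¹ fun j => c (π⁻¹ i) * c j * K (π⁻¹ i) j (z (π⁻¹ i), z j)]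
  exact Finset.sum_congr rfl fun j _ => by rw [hc, hc, hK]

variable [DecidableEq ι]

/-- The interaction kernels of the vortex Hamiltonian. -/
def vortexKernel (g : Plane → Plane → ℝ) (i j : ι) (p : Plane × Plane) : ℝ :=
  if i = j then -g p.1 p.2 else greenFun g p.1 p.2

theorem vortexHam_eq_pairHam (c : ι → ℝ) (g : Plane → Plane → ℝ) :
    vortexHam c g = pairHam c (vortexKernel g) := by
  ext z
  rw [vortexHam, pairHam, ← Finset.sum_sub_distrib]
  refine Finset.sum_congr rfl fun i _ => ?_
  have : c i * c i * g (z i) (z i) = ∑ j, if i = j then c i * c i * g (z i) (z i) else 0 := by simp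
  rw [this, ← Finset.sum_sub_distrib]
  refine Finset.sum_congr rfl fun j _ => ?_
  by_cases h : i = j
  · subst h; simp [vortexKernel]
  · simp [vortexKernel, h]

theorem contDiffAt_log_norm_sub {n : WithTop ℕ∞} {p : Plane × Plane} (h : p.1 ≠ p.2) :
    ContDiffAt ℝ n (fun p : Plane × Plane => Real.log ‖p.1 - p.2‖) p := by
  have h1 : p.1 - p.2 ≠ 0 := sub_ne_zero.2 h
  exact ((contDiffAt_fst.sub contDiffAt_snd).norm ℝ h1).log (norm_ne_zero_iff.2 h1)

theorem contDiffAt_greenFun {n : WithTop ℕ∞} {g : Plane → Plane → ℝ} {p : Plane × Plane}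
    (hg : ContDiffAt ℝ n (fun p : Plane × Plane => g p.1 p.2) p) (h : p.1 ≠ p.2) :
    ContDiffAt ℝ n (fun p : Plane × Plane => greenFun g p.1 p.2) p :=
  (contDiffAt_const.mul (contDiffAt_log_norm_sub h)).sub hg

omit [Fintype ι] in
theorem contDiffAt_vortexKernel {n : WithTop ℕ∞} {g : Plane → Plane → ℝ} {p : Plane × Plane}
    (hg : ContDiffAt ℝ n (fun p : Plane × Plane => g p.1 p.2) p) {i j : ι} (h : i ≠ j → p.1 ≠ p.2) :
    ContDiffAt ℝ n (vortexKernel g i j) p := by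
  by_cases hij : i = j
  · have : vortexKernel g i j = fun p : Plane × Plane => -g p.1 p.2 := by
      ext p; simp [vortexKernel, hij]
    rw [this]
    exact hg.neg
  · have : vortexKernel g i j = fun p : Plane × Plane => greenFun g p.1 p.2 := by
      ext p; simp [vortexKernel, hij]
    rw [this]
    exact contDiffAt_greenFun hg (h hij)

theorem contDiffOn_vortexHam {n : ℕ} {Ω : Set Plane} (hΩ : IsOpen Ω) {g : Plane → Plane → ℝ}
    (hg : ContDiffOn ℝ n (fun p : Plane × Plane => g p.1 p.2) (Ω ×ˢ Ω)) (c : ι → ℝ) :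
    ContDiffOn ℝ n (vortexHam c g) (collisionFree ι Ω) := by
  rw [vortexHam_eq_pairHam]
  intro z hz
  refine (contDiffAt_pairHam c fun i j => contDiffAt_vortexKernel ?_ (hz.2 i j)).contDiffWithinAt
  exact hg.contDiffAt ((hΩ.prod hΩ).mem_nhds ⟨hz.1 i, hz.1 j⟩)

end Pair

/-! ### Splitting of the Hamiltonian into cluster interaction and regular part. -/

section Clusters

variable {m : ℕ} {N : Fin m → ℕ}

/-- The self-interaction of the clusters in the whole plane. -/
def clusterHam (c : (Σ k, Fin (N k)) → ℝ) : Conf (Σ k, Fin (N k)) → ℝ :=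
  pairHam c fun i j p => if i ≠ j ∧ i.1 = j.1 then greenFun 0 p.1 p.2 else 0

/-- The part of the vortex Hamiltonian that is regular when clusters collapse. -/
def regularHam (c : (Σ k, Fin (N k)) → ℝ) (g : Plane → Plane → ℝ) : Conf (Σ k, Fin (N k)) → ℝ :=
  pairHam c fun i j => vortexKernel g i.1 j.1

/-- Configurations without collisions inside a cluster. -/
def clusterFree (N : Fin m → ℕ) : Set (Conf (Σ k, Fin (N k))) :=
  separated univ fun i j => i ≠ j ∧ i.1 = j.1

/-- Configurations in `Ω` without collisions between different clusters. -/
def regularFree (N : Fin m → ℕ) (Ω : Set Plane) : Set (Conf (Σ k, Fin (N k))) :=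
  separated Ω fun i j => i.1 ≠ j.1

theorem clusterFree_inter_regularFree (Ω : Set Plane) :
    clusterFree N ∩ regularFree N Ω = collisionFree (Σ k, Fin (N k)) Ω := by
  ext z
  simp only [clusterFree, regularFree, separated, collisionFree, mem_inter_iff, mem_ofPred_eq]
  constructor
  · rintro ⟨⟨-, h1⟩, h2, h3⟩
    refine ⟨h2, fun i j hij => ?_⟩
    by_cases h : i.1 = j.1
    · exact h1 i j ⟨hij, h⟩
    · exact h3 i j h
  · rintro ⟨h1, h2⟩
    exact ⟨⟨fun i => mem_univ _, fun i j h => h2 i j h.1⟩, h1,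
      fun i j h => h2 i j fun h' => h (by rw [h'])⟩

/-- Only the logarithms of pairs within one cluster are singular in the collapse. Once they are
split off, such pairs interact through -g, just like a vortex with itself; therefore the kernels of
the regular part depend on the cluster indices only. -/
theorem vortexHam_eq_add (c : (Σ k, Fin (N k)) → ℝ) (g : Plane → Plane → ℝ)
    (z : Conf (Σ k, Fin (N k))) : vortexHam c g z = clusterHam c z + regularHam c g z := by
  rw [vortexHam_eq_pairHam, clusterHam, regularHam, pairHam, pairHam, pairHam,
    ← Finset.sum_add_distrib]
  refine Finset.sum_congr rfl fun i _ => ?_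
  rw [← Finset.sum_add_distrib]
  refine Finset.sum_congr rfl fun j _ => ?_
  rw [← mul_add]
  congr 1
  by_cases h : i = j
  · subst h; simp [vortexKernel]
  · by_cases h' : i.1 = j.1 <;> simp [vortexKernel, h, h', greenFun]
    ring

theorem contDiffOn_clusterHam (n : ℕ) (c : (Σ k, Fin (N k)) → ℝ) :
    ContDiffOn ℝ n (clusterHam c) (clusterFree N) := by
  intro z hz
  refine (contDiffAt_pairHam c fun i j => ?_).contDiffWithinAt
  by_cases h : i ≠ j ∧ i.1 = j.1
  · simp only [h, if_true, ne_eq, not_false_eq_true, and_self]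
    exact contDiffAt_greenFun (g := 0) contDiffAt_const (hz.2 i j h)
  · simp only [h, if_false]
    exact contDiffAt_const

theorem contDiffAt_regularKernel {n : ℕ} {Ω : Set Plane} (hΩ : IsOpen Ω) {g : Plane → Plane → ℝ}
    (hg : ContDiffOn ℝ n (fun p : Plane × Plane => g p.1 p.2) (Ω ×ˢ Ω))
    {z : Conf (Σ k, Fin (N k))} (hz : z ∈ regularFree N Ω) (i j : Σ k, Fin (N k)) :
    ContDiffAt ℝ n (vortexKernel g i.1 j.1) (z i, z j) :=
  contDiffAt_vortexKernel (hg.contDiffAt ((hΩ.prod hΩ).mem_nhds ⟨hz.1 i, hz.1 j⟩)) (hz.2 i j)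

theorem contDiffOn_regularHam {n : ℕ} {Ω : Set Plane} (hΩ : IsOpen Ω) {g : Plane → Plane → ℝ}
    (hg : ContDiffOn ℝ n (fun p : Plane × Plane => g p.1 p.2) (Ω ×ˢ Ω))
    (c : (Σ k, Fin (N k)) → ℝ) :
    ContDiffOn ℝ n (regularHam c g) (regularFree N Ω) := fun _ hz =>
  (contDiffAt_pairHam c fun i j => contDiffAt_regularKernel hΩ hg hz i j).contDiffWithinAt

theorem clusterHam_hatCLM_add (c : (Σ k, Fin (N k)) → ℝ) (a : Conf (Fin m))
    (z : Conf (Σ k, Fin (N k))) : clusterHam c (hatCLM N a + z) = clusterHam c z := by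
  refine Finset.sum_congr rfl fun i _ => Finset.sum_congr rfl fun j _ => ?_
  by_cases h : i ≠ j ∧ i.1 = j.1
  · simp [h.1, h.2, greenFun]
  · simp [h]

/-- Clusters can be translated independently of each other without changing their self-interaction,
so the total internal force on each cluster is zero. -/
theorem clusterSum_gradient_clusterHam (c : (Σ k, Fin (N k)) → ℝ)
    {z : Conf (Σ k, Fin (N k))} (hz : z ∈ clusterFree N) :
    clusterSum N (gradient (clusterHam c) z) = 0 := by
  refine ext_inner_right ℝ fun a => ?_
  rw [inner_clusterSum, inner_gradient, inner_zero_left]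
  have h1 : HasFDerivAt (clusterHam c) (fderiv ℝ (clusterHam c) z) (z + (0 : ℝ) • hatCLM N a) := by
    rw [zero_smul, add_zero]
    exact (((contDiffOn_clusterHam 1 c).contDiffAt ((isOpen_separated isOpen_univ _).mem_nhds
      hz)).differentiableAt (by simp)).hasFDerivAt
  have h2 : HasDerivAt (fun s : ℝ => z + s • hatCLM N a) (hatCLM N a) 0 := by
    simpa using ((hasDerivAt_id (0 : ℝ)).smul_const (hatCLM N a)).const_add z
  have h3 := h1.comp_hasDerivAt (0 : ℝ) h2
  have h4 : (clusterHam c ∘ fun s : ℝ => z + s • hatCLM N a) = fun _ => clusterHam c z := by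
    ext s
    rw [Function.comp_apply, ← map_smul, add_comm, clusterHam_hatCLM_add]
  rw [h4] at h3
  exact h3.unique (hasDerivAt_const _ _)

theorem smul_mem_clusterFree {r : ℝ} (hr : r ≠ 0) (a : Conf (Fin m)) {z : Conf (Σ k, Fin (N k))} :
    hatCLM N a + r • z ∈ clusterFree N ↔ z ∈ clusterFree N := by
  simp only [clusterFree, separated, mem_ofPred_eq, mem_univ, true_and, implies_true]
  refine forall_congr' fun i => forall_congr' fun j => ?_
  refine forall_congr' fun h => not_congr ?_
  simp [h.2, hr]

/-- The gradient of the self-interaction is homogeneous of degree `-1`. -/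
theorem gradient_clusterHam_smul (c : (Σ k, Fin (N k)) → ℝ) {r : ℝ} (hr : r ≠ 0)
    (a : Conf (Fin m)) {z : Conf (Σ k, Fin (N k))} (hz : z ∈ clusterFree N) :
    gradient (clusterHam c) (hatCLM N a + r • z) = r⁻¹ • gradient (clusterHam c) z := by
  have hopen : IsOpen (clusterFree N) := isOpen_separated isOpen_univ _
  have hd : ∀ z ∈ clusterFree N, DifferentiableAt ℝ (clusterHam c) z := fun z hz =>
    ((contDiffOn_clusterHam 1 c).contDiffAt (hopen.mem_nhds hz)).differentiableAt (by simp)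
  -- Scaling by r shifts each logarithm by a constant, which disappears in the gradient; the factor
  -- r⁻¹ is left by the chain rule.
  have h1 : ∀ x ∈ clusterFree N, clusterHam c (hatCLM N a + r • x) = clusterHam c x +
      ∑ i, ∑ j, c i * c j * (if i ≠ j ∧ i.1 = j.1 then
        -(1 / (2 * Real.pi)) * Real.log ‖r‖ else 0) := by
    intro x hx
    rw [clusterHam_hatCLM_add]
    simp only [clusterHam, pairHam]
    rw [← Finset.sum_add_distrib]
    refine Finset.sum_congr rfl fun i _ => ?_
    rw [← Finset.sum_add_distrib]
    refine Finset.sum_congr rfl fun j _ => ?_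
    rw [← mul_add]
    congr 1
    by_cases h : i ≠ j ∧ i.1 = j.1
    · have h2 : ‖x i - x j‖ ≠ 0 := norm_ne_zero_iff.2 (sub_ne_zero.2 (hx.2 i j h))
      have h3 : ‖r‖ ≠ 0 := norm_ne_zero_iff.2 hr
      simp only [h, if_true, ne_eq, not_false_eq_true, and_self, greenFun, PiLp.smul_apply,
        ← smul_sub, norm_smul, Real.log_mul h3 h2]
      simp
      ring
    · simp only [h, if_false, add_zero]
  refine ext_inner_right ℝ fun y => ?_
  rw [inner_smul_left, inner_gradient, inner_gradient]
  have h2 : HasFDerivAt (fun x => hatCLM N a + r • x) (r • ContinuousLinearMap.id ℝ _) z :=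
    ((hasFDerivAt_id z).const_smul r).const_add _
  have h3 := (hd _ ((smul_mem_clusterFree hr a).2 hz)).hasFDerivAt.comp z h2
  have h4 := ((hd z hz).hasFDerivAt.add_const _).congr_of_eventuallyEq
    (f₁ := clusterHam c ∘ fun x => hatCLM N a + r • x)
    (by filter_upwards [hopen.mem_nhds hz] with x hx using h1 x hx)
  have h5 := DFunLike.congr_fun (h3.unique h4) y
  simp only [ContinuousLinearMap.comp_apply, smul_apply,
    ContinuousLinearMap.id_apply, map_smul, smul_eq_mul] at h5
  rw [← h5]
  simp [hr]

/-- On clusters collapsed to points, the derivative of the regular part is that of the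
Hamiltonian of the centres. -/
theorem gradient_regularHam_hatCLM {Ω : Set Plane} (hΩ : IsOpen Ω) {g : Plane → Plane → ℝ}
    (hg : ContDiffOn ℝ (1 : ℕ) (fun p : Plane × Plane => g p.1 p.2) (Ω ×ˢ Ω))
    {γ : ∀ k, Fin (N k) → ℝ} {Γ : Fin m → ℝ} (hsum : ∀ k, ∑ j, γ k j = Γ k) (hΓ : ∀ k, Γ k ≠ 0)
    {a : Conf (Fin m)} (ha : a ∈ collisionFree (Fin m) Ω) :
    gradient (regularHam (fun i : Σ k, Fin (N k) => γ i.1 i.2) g) (hatCLM N a) =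
      clusterSpread γ Γ (gradient (vortexHam Γ g) a) := by
  refine ext_inner_right ℝ fun y => ?_
  have hza : hatCLM N a ∈ regularFree N Ω := ⟨fun i => ha.1 i.1, fun i j h => ha.2 _ _ h⟩
  have hΓq : ∀ k, Γ k • clusterCenter γ Γ y k = ∑ j, γ k j • y ⟨k, j⟩ := fun k => by
    rw [clusterCenter_apply, smul_smul, mul_inv_cancel₀ (hΓ k), one_smul]
  have hK : ∀ k k', DifferentiableAt ℝ (vortexKernel g k k') (a k, a k') := fun k k' =>
    (contDiffAt_vortexKernel (hg.contDiffAt ((hΩ.prod hΩ).mem_nhds ⟨ha.1 k, ha.1 k'⟩))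
      (ha.2 k k')).differentiableAt (by simp)
  rw [inner_clusterSpread, inner_gradient, inner_gradient, vortexHam_eq_pairHam, regularHam,
    fderiv_pairHam _ fun i j => hK i.1 j.1, fderiv_pairHam _ hK]
  simp only [Fintype.sum_sigma, hatCLM_apply]
  have hsplit : ∀ (L : Plane × Plane →L[ℝ] ℝ) (x y : Plane), L (x, y) = L (x, 0) + L (0, y) :=
    fun L x y => by rw [← map_add]; simp
  -- At collapsed clusters the kernel derivative depends only on k and k'. Summing over the members
  -- weights the displacement of one cluster to its centre and leaves the total vorticity of the
  -- other.
  have hfst : ∀ (L : Plane × Plane →L[ℝ] ℝ) (k k' : Fin m),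
      ∑ j, ∑ j', γ k j * γ k' j' * L (y ⟨k, j⟩, 0) =
        Γ k * Γ k' * L (clusterCenter γ Γ y k, 0) := by
    intro L k k'
    have h1 : ∀ x : Plane, L (x, 0) = (L ∘L ContinuousLinearMap.inl ℝ Plane Plane) x := fun x => by
      simp
    have h2 := congrArg (L ∘L ContinuousLinearMap.inl ℝ Plane Plane) (hΓq k)
    simp only [map_smul, map_sum, smul_eq_mul] at h2
    simp only [h1]
    rw [mul_assoc, mul_comm (Γ k'), ← mul_assoc, h2, ← hsum k', Finset.sum_mul_sum]
    exact Finset.sum_congr rfl fun j _ => Finset.sum_congr rfl fun j' _ => by ring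
  have hsnd : ∀ (L : Plane × Plane →L[ℝ] ℝ) (k k' : Fin m),
      ∑ j, ∑ j', γ k j * γ k' j' * L (0, y ⟨k', j'⟩) =
        Γ k * Γ k' * L (0, clusterCenter γ Γ y k') := by
    intro L k k'
    have h1 : ∀ x : Plane, L (0, x) = (L ∘L ContinuousLinearMap.inr ℝ Plane Plane) x := fun x => by
      simp
    have h2 := congrArg (L ∘L ContinuousLinearMap.inr ℝ Plane Plane) (hΓq k')
    simp only [map_smul, map_sum, smul_eq_mul] at h2
    simp only [h1]
    rw [mul_assoc, h2, ← hsum k, Finset.sum_mul_sum]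
    exact Finset.sum_congr rfl fun j _ => Finset.sum_congr rfl fun j' _ => by ring
  refine Finset.sum_congr rfl fun k _ => ?_
  rw [Finset.sum_comm]
  refine Finset.sum_congr rfl fun k' _ => ?_
  rw [hsplit _ (clusterCenter γ Γ y k), mul_add, ← hfst, ← hsnd, ← Finset.sum_add_distrib]
  refine Finset.sum_congr rfl fun j _ => ?_
  rw [← Finset.sum_add_distrib]
  refine Finset.sum_congr rfl fun j' _ => ?_
  rw [hsplit, mul_add]

/-- The gradient of the vortex Hamiltonian at clusters of size `r`. -/
theorem gradient_vortexHam_cluster {Ω : Set Plane} (hΩ : IsOpen Ω) {g : Plane → Plane → ℝ}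
    (hg : ContDiffOn ℝ (1 : ℕ) (fun p : Plane × Plane => g p.1 p.2) (Ω ×ˢ Ω))
    (c : (Σ k, Fin (N k)) → ℝ) {r : ℝ} (hr : r ≠ 0)
    (a : Conf (Fin m)) {z : Conf (Σ k, Fin (N k))} (hz : z ∈ clusterFree N)
    (hza : hatCLM N a + r • z ∈ regularFree N Ω) :
    gradient (vortexHam c g) (hatCLM N a + r • z) =
      r⁻¹ • gradient (clusterHam c) z + gradient (regularHam c g) (hatCLM N a + r • z) := by
  have h1 := (contDiffOn_clusterHam 1 c).hasGradientAt (isOpen_separated isOpen_univ _) one_ne_zero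
    ((smul_mem_clusterFree hr a).2 hz)
  have h2 := (contDiffOn_regularHam hΩ hg c).hasGradientAt (isOpen_separated hΩ _) one_ne_zero hza
  rw [← gradient_clusterHam_smul c hr a hz, funext (vortexHam_eq_add c g)]
  refine HasGradientAt.gradient ?_
  rw [HasGradientAt, HasGradientAtFilter, map_add]
  exact h1.add h2

end Clusters

/-! ### Relative equilibria of the whole-plane system -/

section SingleCluster

variable {ι : Type} [Fintype ι]

/-- The embedding of the plane as configurations of equal points. -/
def constConf (ι : Type) [Fintype ι] : Plane →L[ℝ] Conf ι :=
  { toFun := fun a => WithLp.toLp 2 fun _ => a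
    map_add' := fun x y => rfl
    map_smul' := fun a x => rfl
    cont := by fun_prop }

@[simp] theorem constConf_apply (a : Plane) (i : ι) : constConf ι a i = a := rfl

theorem permAct_eq_relabel (σ : Equiv.Perm ι) (z : Conf ι) : permAct σ z = relabel σ z := by
  ext i : 1
  rw [relabel_apply]
  rfl

omit [Fintype ι] in
theorem rigidRotation_eq (ω : ℝ) (z : Conf ι) (t : ℝ) :
    rigidRotation ω z t = Real.cos (ω * t) • z + Real.sin (ω * t) • confRot 1 z := by
  ext i : 1
  simp [rigidRotation, expJ, rotJL_apply]

omit [Fintype ι] in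
theorem confRot_one_confRot_one (z : Conf ι) : confRot 1 (confRot 1 z) = -z := by
  ext i : 1
  simp [rotJL_rotJL]

theorem hasDerivAt_rigidRotation (ω : ℝ) (z : Conf ι) (t : ℝ) :
    HasDerivAt (rigidRotation ω z) (ω • confRot 1 (rigidRotation ω z t)) t := by
  have h1 : HasDerivAt (fun t => ω * t) ω t := by simpa using (hasDerivAt_id t).const_mul ω
  have h2 := (h1.cos.smul_const z).add (h1.sin.smul_const (confRot 1 z))
  refine (h2.congr_of_eventuallyEq
    (Eventually.of_forall fun s => rigidRotation_eq ω z s)).congr_deriv ?_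
  rw [rigidRotation_eq, map_add, map_smul, map_smul, confRot_one_confRot_one]
  module

variable [DecidableEq ι] {c : ι → ℝ}

theorem vortexHam_zero_add_constConf (z : Conf ι) (a : Plane) :
    vortexHam c 0 (z + constConf ι a) = vortexHam c 0 z := by
  simp [vortexHam, greenFun]

theorem gradient_vortexHam_zero_add_constConf (z : Conf ι) (a : Plane) :
    gradient (vortexHam c 0) (z + constConf ι a) = gradient (vortexHam c 0) z := by
  unfold gradient
  rw [← fderiv_comp_add_right]
  simp only [vortexHam_zero_add_constConf]

/-- Translation invariance of the gradient, differentiated along a translation. -/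
theorem hessianMap_constConf {z : Conf ι} (hz : DifferentiableAt ℝ (gradient (vortexHam c 0)) z)
    (a : Plane) : hessianMap (vortexHam c 0) z (constConf ι a) = 0 := by
  have h1 : HasFDerivAt (gradient (vortexHam c 0)) (hessianMap (vortexHam c 0) z)
      (z + (0 : ℝ) • constConf ι a) := by
    rw [zero_smul, add_zero]
    exact hz.hasFDerivAt
  have h2 : HasDerivAt (fun s : ℝ => z + s • constConf ι a) (constConf ι a) 0 := by
    simpa using ((hasDerivAt_id (0 : ℝ)).smul_const (constConf ι a)).const_add z
  have h3 := h1.comp_hasDerivAt (0 : ℝ) h2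
  have h4 : (gradient (vortexHam c 0) ∘ fun s : ℝ => z + s • constConf ι a) =
      fun _ => gradient (vortexHam c 0) z := by
    ext1 s
    rw [Function.comp_apply, ← map_smul, gradient_vortexHam_zero_add_constConf]
  rw [h4] at h3
  exact h3.unique (hasDerivAt_const _ _)

theorem contDiffOn_vortexHam_zero (c : ι → ℝ) (n : ℕ) :
    ContDiffOn ℝ n (vortexHam c 0) (collisionFree ι univ) :=
  contDiffOn_vortexHam isOpen_univ contDiffOn_const c

theorem contDiffOn_gradient_vortexHam_zero (c : ι → ℝ) (n : ℕ) :
    ContDiffOn ℝ n (gradient (vortexHam c 0)) (collisionFree ι univ) :=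
  contDiffOn_gradient (isOpen_separated isOpen_univ _)
    (contDiffOn_vortexHam_zero c _)

theorem differentiableAt_gradient_vortexHam_zero {z : Conf ι} (hz : z ∈ collisionFree ι univ) :
    DifferentiableAt ℝ (gradient (vortexHam c 0)) z :=
  ((contDiffOn_gradient_vortexHam_zero c 1).contDiffAt
    ((isOpen_separated isOpen_univ _).mem_nhds hz)).differentiableAt (by simp)

theorem sum_gradient_vortexHam_zero {z : Conf ι} (hz : z ∈ collisionFree ι univ) :
    ∑ i, gradient (vortexHam c 0) z i = 0 := by
  refine ext_inner_right ℝ fun a => ?_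
  have h0 : (inner ℝ (gradient (vortexHam c 0) z) (constConf ι a) : ℝ) = 0 := by
    rw [inner_gradient]
    have h1 : HasFDerivAt (vortexHam c 0) (fderiv ℝ (vortexHam c 0) z)
        (z + (0 : ℝ) • constConf ι a) := by
      rw [zero_smul, add_zero]
      exact (((contDiffOn_vortexHam_zero c 1).contDiffAt
        ((isOpen_separated isOpen_univ _).mem_nhds hz)).differentiableAt (by simp)).hasFDerivAt
    have h2 : HasDerivAt (fun s : ℝ => z + s • constConf ι a) (constConf ι a) 0 := by
      simpa using ((hasDerivAt_id (0 : ℝ)).smul_const (constConf ι a)).const_add z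
    have h3 := h1.comp_hasDerivAt (0 : ℝ) h2
    have h4 : (vortexHam c 0 ∘ fun s : ℝ => z + s • constConf ι a) =
        fun _ => vortexHam c 0 z := by
      ext1 s
      rw [Function.comp_apply, ← map_smul, vortexHam_zero_add_constConf]
    rw [h4] at h3
    exact h3.unique (hasDerivAt_const _ _)
  rw [PiLp.inner_apply] at h0
  rw [sum_inner, inner_zero_left]
  exact h0

theorem vortexHam_zero_relabel {σ : Equiv.Perm ι} (hσ : ∀ j, c j = c (σ⁻¹ j)) (z : Conf ι) :
    vortexHam c 0 (relabel σ z) = vortexHam c 0 z := by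
  rw [vortexHam_eq_pairHam]
  refine pairHam_relabel (fun i => (hσ i).symm) (fun i j => ?_) z
  ext p
  simp [vortexKernel]

theorem gradient_vortexHam_zero_relabel {σ : Equiv.Perm ι} (hσ : ∀ j, c j = c (σ⁻¹ j)) {z : Conf ι}
    (hz : z ∈ collisionFree ι univ) :
    gradient (vortexHam c 0) (relabel σ z) = relabel σ (gradient (vortexHam c 0) z) := by
  have h : ∀ z ∈ collisionFree ι univ,
      HasGradientAt (vortexHam c 0) (gradient (vortexHam c 0) z) z := fun z hz =>
    (contDiffOn_vortexHam_zero c 1).hasGradientAt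
      (isOpen_separated isOpen_univ _) one_ne_zero hz
  exact gradient_equivariant (relabel σ) (Eventually.of_forall (vortexHam_zero_relabel hσ)) (h z hz)
    (h _ ((relabel_mem_separated (by simp) z).2 hz))

theorem hessianMap_relabel {σ : Equiv.Perm ι} (hσ : ∀ j, c j = c (σ⁻¹ j)) {z : Conf ι}
    (hz : z ∈ collisionFree ι univ) (y : Conf ι) :
    hessianMap (vortexHam c 0) (relabel σ z) (relabel σ y) =
      relabel σ (hessianMap (vortexHam c 0) z y) := by
  have hz' : relabel σ z ∈ collisionFree ι univ := (relabel_mem_separated (by simp) z).2 hz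
  have hS : ∀ x, HasFDerivAt (relabel σ : Conf ι → Conf ι)
      ((relabel σ).toContinuousLinearEquiv : Conf ι →L[ℝ] Conf ι) x := fun x =>
    ((relabel σ).toContinuousLinearEquiv : Conf ι →L[ℝ] Conf ι).hasFDerivAt
  have h1 := (differentiableAt_gradient_vortexHam_zero (c := c) hz').hasFDerivAt.comp z (hS z)
  have h2 := (hS _).comp z (differentiableAt_gradient_vortexHam_zero (c := c) hz).hasFDerivAt
  have h3 := h2.congr_of_eventuallyEq
    (f₁ := gradient (vortexHam c 0) ∘ relabel σ) (by
      filter_upwards [(isOpen_separated isOpen_univ _).mem_nhds hz] with x hx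
      exact gradient_vortexHam_zero_relabel hσ hx)
  exact DFunLike.congr_fun (h1.unique h3) y

theorem IsVortexSolution.hasDerivAt {Ω : Set Plane} {g : Plane → Plane → ℝ} (hc : ∀ i, c i ≠ 0)
    {Z : ℝ → Conf ι} (hZ : IsVortexSolution Ω c g Z) (t : ℝ) :
    HasDerivAt Z (confRot c (gradient (vortexHam c g) (Z t))) t := by
  refine (hZ.2.1 t).hasDerivAt.congr_deriv ?_
  ext i : 1
  rw [confRot_apply, rotJL_apply, ← hZ.2.2 t i, smul_smul, inv_mul_cancel₀ (hc i), one_smul]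

theorem IsRelativeEquilibrium.exists_confRot (hc : ∀ i, c i ≠ 0) {Z : ℝ → Conf ι}
    (hZ : IsRelativeEquilibrium c Z) : ∃ ω : ℝ, ω ≠ 0 ∧ ∀ t,
      confRot c (gradient (vortexHam c 0) (Z t)) = ω • confRot 1 (Z t) := by
  obtain ⟨h1, ω, hω, z, rfl⟩ := hZ
  exact ⟨ω, hω, fun t => (h1.hasDerivAt hc t).unique (hasDerivAt_rigidRotation ω z t)⟩

/-- The forces of the whole-plane system add up to zero, so the weighted sum of positions has zero
velocity. It also rotates about the origin with speed ω ≠ 0, so it is the origin. -/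
theorem IsRelativeEquilibrium.sum_smul_eq_zero (hc : ∀ i, c i ≠ 0) {Z : ℝ → Conf ι}
    (hZ : IsRelativeEquilibrium c Z) (t : ℝ) : ∑ i, c i • Z t i = 0 := by
  obtain ⟨ω, hω, h⟩ := hZ.exists_confRot hc
  have h1 : ∀ i, ω • rotJL (c i • Z t i) = rotJL (gradient (vortexHam c 0) (Z t) i) := fun i => by
    have h2 := congrArg (fun x : Conf ι => c i • x i) (h t)
    simp only [confRot_apply, PiLp.smul_apply, Pi.one_apply, inv_one, one_smul, smul_smul,
      mul_inv_cancel₀ (hc i)] at h2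
    rw [h2, map_smul, smul_smul, mul_comm]
  have h2 : ω • rotJL (∑ i, c i • Z t i) = 0 := by
    rw [map_sum, Finset.smul_sum, Finset.sum_congr rfl fun i _ => h1 i, ← map_sum,
      sum_gradient_vortexHam_zero (hZ.1.1 t), map_zero]
  exact rotJL_eq_zero.1 ((smul_eq_zero.1 h2).resolve_left hω)

/-- A fixed point of the rotation has all vortices at the origin, which is a collision as soon as
there are two of them. -/
theorem IsRelativeEquilibrium.confRot_gradient_ne_zero [Nontrivial ι] (hc : ∀ i, c i ≠ 0)
    {Z : ℝ → Conf ι} (hZ : IsRelativeEquilibrium c Z) (t : ℝ) :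
    confRot c (gradient (vortexHam c 0) (Z t)) ≠ 0 := by
  obtain ⟨ω, hω, h⟩ := hZ.exists_confRot hc
  rw [h]
  refine smul_ne_zero hω fun h0 => ?_
  obtain ⟨i, j, hij⟩ := exists_pair_ne ι
  have h1 : ∀ i, Z t i = 0 := fun i => by
    have := congrArg (fun x : Conf ι => x i) h0
    simp only [confRot_apply, Pi.one_apply, inv_one, one_smul, PiLp.zero_apply] at this
    exact rotJL_eq_zero.1 this
  exact (hZ.1.1 t).2 i j hij ((h1 i).trans (h1 j).symm)

theorem hasDerivAt_confRot_gradient (hc : ∀ i, c i ≠ 0) {Z : ℝ → Conf ι}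
    (hZ : IsVortexSolution univ c 0 Z) (t : ℝ) :
    HasDerivAt (fun t => confRot c (gradient (vortexHam c 0) (Z t)))
      (confRot c (hessianMap (vortexHam c 0) (Z t)
        (confRot c (gradient (vortexHam c 0) (Z t))))) t :=
  (confRot c).hasFDerivAt.comp_hasDerivAt t
    ((differentiableAt_gradient_vortexHam_zero (hZ.1 t)).hasFDerivAt.comp_hasDerivAt t
      (hZ.hasDerivAt hc t))

theorem mem_linearizedSolutions (hc : ∀ i, c i ≠ 0) {σ : Equiv.Perm ι} {Z w : ℝ → Conf ι}
    (hw : ∀ t, HasDerivAt w (confRot c (hessianMap (vortexHam c 0) (Z t) (w t))) t)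
    (hσ : ∀ t, permAct σ (w (t + 2 * Real.pi)) = w t) : w ∈ linearizedSolutions c σ Z := by
  refine ⟨fun t => (hw t).differentiableAt, fun t j => ?_, hσ⟩
  rw [(hw t).deriv, confRot_apply, smul_smul, mul_inv_cancel₀ (hc j), one_smul, rotJL_apply]

/-- The solutions of the linearization generated by translations and time shifts. -/
theorem constConf_add_smul_mem_linearizedSolutions (hc : ∀ i, c i ≠ 0) {σ : Equiv.Perm ι}
    {Z : ℝ → Conf ι} (hσ : ∀ j, c j = c (σ⁻¹ j)) (hZ : IsSigmaNondegenerate c σ Z)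
    (p : Plane × ℝ) :
    (fun t => constConf ι p.1 + p.2 • confRot c (gradient (vortexHam c 0) (Z t))) ∈
      linearizedSolutions c σ Z := by
  have hd := hZ.1.1.1
  refine mem_linearizedSolutions hc (fun t => ?_) fun t => ?_
  · rw [map_add, hessianMap_constConf (differentiableAt_gradient_vortexHam_zero (hd t)), zero_add,
      map_smul, map_smul]
    exact ((hasDerivAt_confRot_gradient hc hZ.1.1 t).const_smul p.2).const_add _
  · have h1 : relabel σ (constConf ι p.1) = constConf ι p.1 := by
      ext i : 1
      simp
    rw [permAct_eq_relabel, map_add, map_smul, h1, ← confRot_relabel (fun i => (hσ i).symm),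
      ← gradient_vortexHam_zero_relabel hσ (hd _), ← permAct_eq_relabel σ (Z _), hZ.2.1]

/-- Translations and the velocity of Z give a three-dimensional space of solutions, so by
nondegeneracy there are no others. The centre of such a solution is its translation part, as the
total vorticity is nonzero and Z is centred; the orthogonality then removes the velocity part. -/
theorem exists_eq_of_mem_linearizedSolutions [Nontrivial ι] (hc : ∀ i, c i ≠ 0)
    (hsum : ∑ i, c i ≠ 0) {σ : Equiv.Perm ι} {Z : ℝ → Conf ι} (hσ : ∀ j, c j = c (σ⁻¹ j))
    (hZ : IsSigmaNondegenerate c σ Z) {w : ℝ → Conf ι} (hw : w ∈ linearizedSolutions c σ Z)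
    (hq : ∑ i, c i • w 0 i = 0)
    (hi : inner ℝ (w 0) (confRot c (gradient (vortexHam c 0) (Z 0))) = 0) : w = 0 := by
  obtain ⟨ω, hω, hωZ⟩ := hZ.1.exists_confRot hc
  have hqc : ∀ p : Plane × ℝ, ∑ i, c i • (constConf ι p.1 +
      p.2 • confRot c (gradient (vortexHam c 0) (Z 0))) i = (∑ i, c i) • p.1 := by
    intro p
    have h1 : ∀ i, c i • (constConf ι p.1 +
        p.2 • confRot c (gradient (vortexHam c 0) (Z 0))) i =
        c i • p.1 + (p.2 * ω) • rotJL (c i • Z 0 i) := fun i => by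
      rw [hωZ]
      simp only [PiLp.add_apply, constConf_apply, PiLp.smul_apply, confRot_apply, Pi.one_apply,
        inv_one, one_smul, map_smul]
      module
    rw [Finset.sum_congr rfl fun i _ => h1 i, Finset.sum_add_distrib, ← Finset.smul_sum,
      ← map_sum, hZ.1.sum_smul_eq_zero hc, map_zero, smul_zero, add_zero, Finset.sum_smul]
  have hzero : ∀ p : Plane × ℝ, ∑ i, c i • (constConf ι p.1 +
      p.2 • confRot c (gradient (vortexHam c 0) (Z 0))) i = 0 →
      inner ℝ (constConf ι p.1 + p.2 • confRot c (gradient (vortexHam c 0) (Z 0)))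
        (confRot c (gradient (vortexHam c 0) (Z 0))) = 0 → p = 0 := by
    intro p h1 h2
    rw [hqc] at h1
    have h3 : p.1 = 0 := (smul_eq_zero.1 h1).resolve_left hsum
    rw [h3, map_zero, zero_add, inner_smul_left, mul_eq_zero, inner_self_eq_zero] at h2
    exact Prod.ext h3 (h2.resolve_right (hZ.1.confRot_gradient_ne_zero hc 0))
  let Φ : Plane × ℝ →ₗ[ℝ] linearizedSolutions c σ Z :=
    { toFun := fun p => ⟨_, constConf_add_smul_mem_linearizedSolutions hc hσ hZ p⟩
      map_add' := fun p p' => by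
        refine Subtype.ext (funext fun t => ?_)
        change constConf ι (p.1 + p'.1) + (p.2 + p'.2) • _ = (_ + _) + (_ + _)
        rw [map_add]
        module
      map_smul' := fun a p => by
        refine Subtype.ext (funext fun t => ?_)
        change constConf ι (a • p.1) + (a * p.2) • _ = a • (_ + _)
        rw [map_smul]
        module }
  have hΦ : ∀ p t, (Φ p : ℝ → Conf ι) t =
    constConf ι p.1 + p.2 • confRot c (gradient (vortexHam c 0) (Z t)) := fun p t => rfl
  have hinj : Function.Injective Φ := by
    rw [injective_iff_map_eq_zero]
    intro p hp
    have h1 : constConf ι p.1 + p.2 • confRot c (gradient (vortexHam c 0) (Z 0)) = 0 := by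
      rw [← hΦ, hp]
      rfl
    exact hzero p (by rw [h1]; simp) (by rw [h1, inner_zero_left])
  have hfin : FiniteDimensional ℝ (linearizedSolutions c σ Z) :=
    FiniteDimensional.of_finrank_pos (by rw [hZ.2.2]; norm_num)
  have hsurj : Function.Surjective Φ :=
    (LinearMap.injective_iff_surjective_of_finrank_eq_finrank (by
      rw [hZ.2.2, Module.finrank_prod, finrank_euclideanSpace_fin, Module.finrank_self])).1 hinj
  obtain ⟨p, hp⟩ := hsurj ⟨w, hw⟩
  have hwp : ∀ t, w t = constConf ι p.1 + p.2 • confRot c (gradient (vortexHam c 0) (Z t)) :=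
    fun t => by rw [← hΦ, hp]
  rw [hwp] at hq hi
  funext t
  rw [hwp, hzero p hq hi]
  simp

/-- The nondegeneracy of a relative equilibrium as a statement on the interval `[0, 2π]`. -/
theorem IsSigmaNondegenerate.eq_zero_of_linearized [Nontrivial ι] (hc : ∀ i, c i ≠ 0)
    (hsum : ∑ i, c i ≠ 0) {σ : Equiv.Perm ι} {Z : ℝ → Conf ι} (hσ : ∀ j, c j = c (σ⁻¹ j))
    (hZ : IsSigmaNondegenerate c σ Z) {x : C(Icc (0 : ℝ) (2 * Real.pi), Conf ι)}
    (hx : ∀ t, x t = x ⟨0, left_mem_Icc.2 Real.two_pi_pos.le⟩ + ∫ s in (0 : ℝ)..t,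
      confRot c (hessianMap (vortexHam c 0) (Z s) (IccExtend Real.two_pi_pos.le x s)))
    (hS : relabel σ (x ⟨2 * Real.pi, right_mem_Icc.2 Real.two_pi_pos.le⟩) =
      x ⟨0, left_mem_Icc.2 Real.two_pi_pos.le⟩)
    (hq : ∑ i, c i • x ⟨0, left_mem_Icc.2 Real.two_pi_pos.le⟩ i = 0)
    (hi : inner ℝ (x ⟨0, left_mem_Icc.2 Real.two_pi_pos.le⟩)
      (confRot c (gradient (vortexHam c 0) (Z 0))) = 0) : x = 0 := by
  have hT := Real.two_pi_pos
  obtain ⟨x0, hx0⟩ : ∃ x0, x0 = x ⟨0, left_mem_Icc.2 Real.two_pi_pos.le⟩ := ⟨_, rfl⟩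
  have hZc : Continuous Z := hZ.1.1.2.1.continuous
  have hA : Continuous fun t => hessianMap (vortexHam c 0) (Z t) :=
    ((contDiffOn_gradient_vortexHam_zero c 1).continuousOn_fderiv_of_isOpen
      (isOpen_separated isOpen_univ _) (by simp)).comp_continuous hZc hZ.1.1.1
  let W : ℝ → Conf ι → Conf ι := fun t y => confRot c (hessianMap (vortexHam c 0) (Z t) y)
  have hW : Continuous (Function.uncurry W) := by
    have : Continuous fun p : ℝ × Conf ι => hessianMap (vortexHam c 0) (Z p.1) p.2 :=
      (hA.comp continuous_fst).clm_apply continuous_snd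
    exact (confRot c).continuous.comp this
  let w : C(Icc (0 : ℝ) (2 * Real.pi), Conf ι) :=
    ⟨fun t => W t (x t), hW.comp (continuous_subtype_val.prodMk x.continuous)⟩
  have hv : x = ContinuousMap.const _ x0 + primitiveCLM hT.le w := by
    ext1 t
    rw [hx t, ContinuousMap.add_apply, primitiveCLM_apply, ContinuousMap.const_apply, hx0]
    congr 1
    rw [intervalIntegral.integral_of_le t.2.1, intervalIntegral.integral_of_le t.2.1]
    refine setIntegral_congr_fun measurableSet_Ioc fun s hs => ?_
    have hs' : s ∈ Icc 0 (2 * Real.pi) := ⟨hs.1.le, hs.2.trans t.2.2⟩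
    simp only [IccExtend_of_mem _ _ hs']
    rfl
  have hZS : ∀ t, Z (t + 2 * Real.pi) = (relabel σ)⁻¹ (Z t) := fun t => by
    rw [← hZ.2.1 t, permAct_eq_relabel]
    exact ((relabel σ).symm_apply_apply _).symm
  have hWS : ∀ t, ∀ y ∈ (univ : Set (Conf ι)),
      W (t + 2 * Real.pi) ((relabel σ)⁻¹ y) = (relabel σ)⁻¹ (W t y) := by
    intro t y _
    refine (relabel σ).injective ?_
    change _ = relabel σ ((relabel σ).symm (W t y))
    rw [(relabel σ).apply_symm_apply]
    have h1 := hessianMap_relabel hσ (hZ.1.1.1 (t + 2 * Real.pi)) ((relabel σ)⁻¹ y)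
    rw [← permAct_eq_relabel σ (Z _), hZ.2.1] at h1
    change _ = confRot c _
    rw [← confRot_relabel (fun i => (hσ i).symm), ← h1]
    congr 2
    exact (relabel σ).apply_symm_apply y
  -- The equation linearized along Z is equivariant for a time shift by 2π combined with σ, so a
  -- twisted solution on [0, 2π] extends to ℝ and lies in the solution space of the definition.
  have hsol := fun t => (hasDerivAt_twistPrimitive hT (relabel σ) w hv (hS.trans hx0.symm)
    (fun _ _ => mem_univ _) (fun _ _ => mem_univ _) hW.continuousOn hWS (fun _ => mem_univ _)
    (fun t => rfl) t).2
  have hmem : twistPrimitive hT (relabel σ) w x0 ∈ linearizedSolutions c σ Z := by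
    refine mem_linearizedSolutions hc hsol fun t => ?_
    rw [permAct_eq_relabel, twistPrimitive_add_period hT (relabel σ) w hv (hS.trans hx0.symm)]
    exact (relabel σ).apply_symm_apply _
  have hval : ∀ t (ht : t ∈ Icc 0 (2 * Real.pi)),
      twistPrimitive hT (relabel σ) w x0 t = x ⟨t, ht⟩ := fun t ht =>
    twistPrimitive_of_mem hT (relabel σ) w hv ht
  have h0 := hval 0 (left_mem_Icc.2 hT.le)
  have h := exists_eq_of_mem_linearizedSolutions hc hsum hσ hZ hmem (by rw [h0, hq])
    (by rw [h0, hi])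
  ext1 t
  rw [← hval t t.2, h]
  rfl

end SingleCluster

/-! ### A single nontrivial cluster -/

section OneCluster

variable {m : ℕ} {N : Fin m → ℕ} {k₀ : Fin m}

/-- The `k₀`th cluster of a configuration. -/
def clusterProj (N : Fin m → ℕ) (k₀ : Fin m) : Conf (Σ k, Fin (N k)) →L[ℝ] Conf (Fin (N k₀)) :=
  { toFun := fun z => WithLp.toLp 2 fun j => z ⟨k₀, j⟩
    map_add' := fun x y => rfl
    map_smul' := fun a x => rfl
    cont := by fun_prop }

@[simp] theorem clusterProj_apply (z : Conf (Σ k, Fin (N k))) (j : Fin (N k₀)) :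
    clusterProj N k₀ z j = z ⟨k₀, j⟩ := rfl

/-- The configuration with `k₀`th cluster `x` and all other clusters `0`. -/
def clusterInc (N : Fin m → ℕ) (k₀ : Fin m) : Conf (Fin (N k₀)) →L[ℝ] Conf (Σ k, Fin (N k)) :=
  { toFun := fun x => WithLp.toLp 2 fun i =>
      if h : i.1 = k₀ then x (Fin.cast (congrArg N h) i.2) else 0
    map_add' := fun x y => by
      ext i : 1
      by_cases h : i.1 = k₀ <;> simp [h]
    map_smul' := fun a x => by
      ext i : 1
      by_cases h : i.1 = k₀ <;> simp [h]
    cont := by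
      refine (PiLp.continuous_toLp 2 _).comp (continuous_pi fun i => ?_)
      by_cases h : i.1 = k₀
      · simp only [h, dif_pos]
        fun_prop
      · simp only [h, dif_neg, not_false_eq_true]
        fun_prop }

@[simp] theorem clusterInc_apply_self (x : Conf (Fin (N k₀))) (j : Fin (N k₀)) :
    clusterInc N k₀ x ⟨k₀, j⟩ = x j := by
  simp [clusterInc]

theorem clusterInc_apply_of_ne (x : Conf (Fin (N k₀))) {i : Σ k, Fin (N k)} (h : i.1 ≠ k₀) :
    clusterInc N k₀ x i = 0 := by
  simp [clusterInc, h]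

theorem clusterProj_clusterInc (x : Conf (Fin (N k₀))) :
    clusterProj N k₀ (clusterInc N k₀ x) = x := by
  ext j : 1
  simp

theorem inner_clusterInc (x : Conf (Fin (N k₀))) (y : Conf (Σ k, Fin (N k))) :
    inner ℝ (clusterInc N k₀ x) y = inner ℝ x (clusterProj N k₀ y) := by
  rw [PiLp.inner_apply, PiLp.inner_apply, Fintype.sum_sigma, Finset.sum_eq_single k₀]
  · simp
  · exact fun k _ hk => Finset.sum_eq_zero fun j _ => by
      rw [clusterInc_apply_of_ne x hk, inner_zero_left]
  · simp

theorem confRot_clusterInc (c : (Σ k, Fin (N k)) → ℝ) (x : Conf (Fin (N k₀))) :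
    confRot c (clusterInc N k₀ x) = clusterInc N k₀ (confRot (fun j => c ⟨k₀, j⟩) x) := by
  ext1 ⟨k, j⟩
  by_cases h : k = k₀
  · subst h
    simp
  · rw [confRot_apply, clusterInc_apply_of_ne _ h, clusterInc_apply_of_ne _ h, map_zero, smul_zero]

theorem relabel_clusterInc (σ : ∀ k, Equiv.Perm (Fin (N k))) (x : Conf (Fin (N k₀))) :
    relabel (Equiv.sigmaCongrRight σ) (clusterInc N k₀ x) =
      clusterInc N k₀ (permAct (σ k₀) x) := by
  rw [clusterPermAct_eq]
  ext1 ⟨k, j⟩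
  by_cases h : k = k₀
  · subst h
    simp [clusterPermAct, permAct]
  · rw [clusterInc_apply_of_ne _ h]
    exact clusterInc_apply_of_ne _ h

/-- A cluster with one vortex has no internal pairs. -/
theorem clusterHam_eq_vortexHam (hN : ∀ k, k ≠ k₀ → N k = 1) (c : (Σ k, Fin (N k)) → ℝ) :
    clusterHam c = fun z => vortexHam (fun j => c ⟨k₀, j⟩) 0 (clusterProj N k₀ z) := by
  funext z
  simp only [clusterHam, pairHam, vortexHam, Fintype.sum_sigma]
  have h1 : ∀ k j k', k' ≠ k → ∀ j' : Fin (N k'),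
      c ⟨k, j⟩ * c ⟨k', j'⟩ * (if (⟨k, j⟩ : Σ k, Fin (N k)) ≠ ⟨k', j'⟩ ∧ k = k' then
        greenFun 0 (z ⟨k, j⟩) (z ⟨k', j'⟩) else 0) = 0 := fun k j k' h j' => by simp [Ne.symm h]
  have h2 : ∀ (k : Fin m) (j : Fin (N k)), (∑ k', ∑ j' : Fin (N k'),
      c ⟨k, j⟩ * c ⟨k', j'⟩ * (if (⟨k, j⟩ : Σ k, Fin (N k)) ≠ ⟨k', j'⟩ ∧ k = k' then
        greenFun 0 (z ⟨k, j⟩) (z ⟨k', j'⟩) else 0)) = ∑ j' : Fin (N k),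
      if j ≠ j' then c ⟨k, j⟩ * c ⟨k, j'⟩ * greenFun 0 (z ⟨k, j⟩) (z ⟨k, j'⟩) else 0 :=
    fun k j => by
      rw [Finset.sum_eq_single k (fun k' _ h => Finset.sum_eq_zero fun j' _ => h1 k j k' h j')
        (by simp)]
      refine Finset.sum_congr rfl fun j' _ => ?_
      by_cases h : j = j' <;> simp [h]
  simp only [h2]
  rw [Finset.sum_eq_single k₀]
  · simp
  · intro k _ hk
    have : Subsingleton (Fin (N k)) := by rw [hN k hk]; infer_instance
    exact Finset.sum_eq_zero fun j _ => Finset.sum_eq_zero fun j' _ =>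
      if_neg fun h => h (Subsingleton.elim _ _)
  · simp

theorem mem_clusterFree_iff (hN : ∀ k, k ≠ k₀ → N k = 1) (z : Conf (Σ k, Fin (N k))) :
    z ∈ clusterFree N ↔ clusterProj N k₀ z ∈ collisionFree (Fin (N k₀)) univ := by
  constructor
  · exact fun h => ⟨fun _ => mem_univ _, fun i j hij =>
      h.2 ⟨k₀, i⟩ ⟨k₀, j⟩ ⟨fun h => hij (by simpa using h), rfl⟩⟩
  · rintro ⟨-, h⟩
    refine ⟨fun _ => mem_univ _, ?_⟩
    rintro ⟨k, i⟩ ⟨k', j⟩ ⟨hij, hk⟩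
    obtain rfl : k = k' := hk
    by_cases h0 : k = k₀
    · subst h0
      exact h i j fun h => hij (by rw [h])
    · have : Subsingleton (Fin (N k)) := by rw [hN k h0]; infer_instance
      exact absurd (by rw [Subsingleton.elim i j]) hij

theorem gradient_clusterHam (hN : ∀ k, k ≠ k₀ → N k = 1) (c : (Σ k, Fin (N k)) → ℝ)
    {z : Conf (Σ k, Fin (N k))} (hz : z ∈ clusterFree N) :
    gradient (clusterHam c) z =
      clusterInc N k₀ (gradient (vortexHam (fun j => c ⟨k₀, j⟩) 0) (clusterProj N k₀ z)) := by
  refine ext_inner_right ℝ fun y => ?_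
  rw [inner_clusterInc, inner_gradient, inner_gradient, clusterHam_eq_vortexHam hN]
  have h1 := (((contDiffOn_vortexHam_zero (fun j => c ⟨k₀, j⟩) 1).contDiffAt
    ((isOpen_separated isOpen_univ _).mem_nhds
      ((mem_clusterFree_iff hN z).1 hz))).differentiableAt (by simp)).hasFDerivAt.comp z
        (clusterProj N k₀).hasFDerivAt
  exact DFunLike.congr_fun h1.fderiv y

theorem fderiv_gradient_clusterHam (hN : ∀ k, k ≠ k₀ → N k = 1) (c : (Σ k, Fin (N k)) → ℝ)
    {z : Conf (Σ k, Fin (N k))} (hz : z ∈ clusterFree N) (y : Conf (Σ k, Fin (N k))) :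
    fderiv ℝ (gradient (clusterHam c)) z y =
      clusterInc N k₀ (hessianMap (vortexHam (fun j => c ⟨k₀, j⟩) 0) (clusterProj N k₀ z)
        (clusterProj N k₀ y)) := by
  have h1 := (differentiableAt_gradient_vortexHam_zero (c := fun j => c ⟨k₀, j⟩)
    ((mem_clusterFree_iff hN z).1 hz)).hasFDerivAt.comp z (clusterProj N k₀).hasFDerivAt
  have h2 := (clusterInc N k₀).hasFDerivAt.comp z h1
  have h3 := h2.congr_of_eventuallyEq (f₁ := gradient (clusterHam c)) (by
    filter_upwards [(isOpen_separated isOpen_univ _).mem_nhds hz] with x hx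
      using gradient_clusterHam hN c hx)
  exact DFunLike.congr_fun h3.fderiv y

theorem clusterInc_mem_clusterFree (hN : ∀ k, k ≠ k₀ → N k = 1) {x : Conf (Fin (N k₀))}
    (hx : x ∈ collisionFree (Fin (N k₀)) univ) : clusterInc N k₀ x ∈ clusterFree N := by
  rwa [mem_clusterFree_iff hN, clusterProj_clusterInc]

theorem gradient_clusterHam_clusterInc (hN : ∀ k, k ≠ k₀ → N k = 1) (c : (Σ k, Fin (N k)) → ℝ)
    {x : Conf (Fin (N k₀))} (hx : x ∈ collisionFree (Fin (N k₀)) univ) :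
    confRot c (gradient (clusterHam c) (clusterInc N k₀ x)) =
      clusterInc N k₀ (confRot (fun j => c ⟨k₀, j⟩)
        (gradient (vortexHam (fun j => c ⟨k₀, j⟩) 0) x)) := by
  rw [gradient_clusterHam hN c (clusterInc_mem_clusterFree hN hx), clusterProj_clusterInc,
    confRot_clusterInc]

theorem joinConf_eq_clusterInc {Z : ∀ k, Conf (Fin (N k))} (hZ : ∀ k, k ≠ k₀ → Z k = 0) :
    joinConf Z = clusterInc N k₀ (Z k₀) := by
  ext1 ⟨k, j⟩
  by_cases h : k = k₀
  · subst h
    simp [joinConf]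
  · rw [clusterInc_apply_of_ne _ h]
    change Z k j = 0
    rw [hZ k h]
    rfl

theorem clusterCenter_clusterInc (γ : ∀ k, Fin (N k) → ℝ) (Γ : Fin m → ℝ) {x : Conf (Fin (N k₀))}
    (hx : ∑ j, γ k₀ j • x j = 0) : clusterCenter γ Γ (clusterInc N k₀ x) = 0 := by
  ext1 k
  rw [clusterCenter_apply, PiLp.zero_apply]
  by_cases h : k = k₀
  · subst h
    simp [hx]
  · rw [Finset.sum_eq_zero fun j _ => ?_, smul_zero]
    rw [clusterInc_apply_of_ne _ h, smul_zero]

/-- The rotated deviations have a nonvanishing product with the velocity of a rigid rotation. -/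
theorem inner_clusterTwist_ne_zero (hN₀ : 2 ≤ N k₀) {x : Conf (Fin (N k₀))}
    (hx : x ∈ collisionFree (Fin (N k₀)) univ) {ω : ℝ} (hω : ω ≠ 0) :
    inner ℝ (clusterTwist N (clusterInc N k₀ x)) (clusterInc N k₀ (ω • confRot 1 x)) ≠ 0 := by
  rw [real_inner_comm, inner_clusterInc, PiLp.inner_apply]
  set μ : Plane := (N k₀ : ℝ)⁻¹ • ∑ j, x j with hμ
  have hN' : (N k₀ : ℝ) ≠ 0 := Nat.cast_ne_zero.2 (by omega)
  have h0 : ∑ j, (x j - μ) = 0 := by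
    rw [Finset.sum_sub_distrib, Finset.sum_const, Finset.card_univ, Fintype.card_fin,
      ← Nat.cast_smul_eq_nsmul ℝ, hμ, smul_smul, mul_inv_cancel₀ hN', one_smul, sub_self]
  -- J is an isometry, so the product is ω⟨xⱼ, xⱼ - μ⟩. After summation the deviations from the mean
  -- cancel the term with μ, and ω times the sum of ‖xⱼ - μ‖² is left, which vanishes only if all
  -- points coincide.
  have h1 : ∀ j, (inner ℝ ((ω • confRot 1 x) j)
      (clusterProj N k₀ (clusterTwist N (clusterInc N k₀ x)) j) : ℝ) =
      ω * ‖x j - μ‖ ^ 2 + ω * inner ℝ μ (x j - μ) := by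
    intro j
    have h2 : clusterProj N k₀ (clusterTwist N (clusterInc N k₀ x)) j = rotJL (x j - μ) := by
      simp [hμ]
    rw [h2, PiLp.smul_apply, confRot_apply, Pi.one_apply, inv_one, one_smul, real_inner_smul_left,
      inner_rotJL_rotJL, ← real_inner_self_eq_norm_sq, ← mul_add, ← inner_add_left,
      sub_add_cancel]
  rw [Finset.sum_congr rfl fun j _ => h1 j, Finset.sum_add_distrib, ← Finset.mul_sum,
    ← Finset.mul_sum, ← inner_sum, h0, inner_zero_right, mul_zero, add_zero]
  refine mul_ne_zero hω fun h => ?_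
  rw [Finset.sum_eq_zero_iff_of_nonneg fun _ _ => by positivity] at h
  have h2 : ∀ j, x j = μ := fun j => by
    simpa [sub_eq_zero] using h j (Finset.mem_univ j)
  exact hx.2 ⟨0, by omega⟩ ⟨1, by omega⟩ (by simp) ((h2 _).trans (h2 _).symm)

/-- The nondegeneracy of the first cluster extends to the system of all clusters. -/
theorem eq_zero_of_linearized_clusterHam (hN₀ : 2 ≤ N k₀) (hN : ∀ k, k ≠ k₀ → N k = 1)
    {γ : ∀ k, Fin (N k) → ℝ} {Γ : Fin m → ℝ} (hγ : ∀ k j, γ k j ≠ 0)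
    (hsum : ∀ k, ∑ j, γ k j = Γ k) (hΓ : ∀ k, Γ k ≠ 0)
    {σ : ∀ k, Equiv.Perm (Fin (N k))} (hσ : ∀ j, γ k₀ j = γ k₀ ((σ k₀)⁻¹ j))
    {Z : ℝ → Conf (Fin (N k₀))} (hZ : IsSigmaNondegenerate (γ k₀) (σ k₀) Z)
    {w : C(Icc (0 : ℝ) (2 * Real.pi), Conf (Σ k, Fin (N k)))}
    (hw : ∀ t, w t = w ⟨0, left_mem_Icc.2 Real.two_pi_pos.le⟩ + ∫ s in (0 : ℝ)..t,
      confRot (fun i : Σ k, Fin (N k) => γ i.1 i.2)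
        (fderiv ℝ (gradient (clusterHam fun i : Σ k, Fin (N k) => γ i.1 i.2))
          (clusterInc N k₀ (Z s)) (IccExtend Real.two_pi_pos.le w s)))
    (hS : relabel (Equiv.sigmaCongrRight σ)
      (w ⟨2 * Real.pi, right_mem_Icc.2 Real.two_pi_pos.le⟩) =
      w ⟨0, left_mem_Icc.2 Real.two_pi_pos.le⟩)
    (hq : clusterCenter γ Γ (w ⟨0, left_mem_Icc.2 Real.two_pi_pos.le⟩) = 0)
    (hi : inner ℝ (w ⟨0, left_mem_Icc.2 Real.two_pi_pos.le⟩)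
      (clusterInc N k₀ (confRot (γ k₀) (gradient (vortexHam (γ k₀) 0) (Z 0)))) = 0) : w = 0 := by
  have hnt : Nontrivial (Fin (N k₀)) := Fin.nontrivial_iff_two_le.2 hN₀
  have hT := Real.two_pi_pos
  obtain ⟨w0, hw0⟩ : ∃ w0, w0 = w ⟨0, left_mem_Icc.2 Real.two_pi_pos.le⟩ := ⟨_, rfl⟩
  rw [← hw0] at hS hq hi
  let x : C(Icc (0 : ℝ) (2 * Real.pi), Conf (Fin (N k₀))) :=
    ⟨fun t => clusterProj N k₀ (w t), (clusterProj N k₀).continuous.comp w.continuous⟩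
  have hA : Continuous fun s => confRot (γ k₀) (hessianMap (vortexHam (γ k₀) 0) (Z s)
      (IccExtend hT.le x s)) := by
    have h1 : Continuous fun t => hessianMap (vortexHam (γ k₀) 0) (Z t) :=
      ((contDiffOn_gradient_vortexHam_zero (γ k₀) 1).continuousOn_fderiv_of_isOpen
        (isOpen_separated isOpen_univ _) (by simp)).comp_continuous hZ.1.1.2.1.continuous hZ.1.1.1
    exact (confRot (γ k₀)).continuous.comp (h1.clm_apply x.continuous.Icc_extend')
  have hint : ∀ s, confRot (fun i : Σ k, Fin (N k) => γ i.1 i.2)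
        (fderiv ℝ (gradient (clusterHam fun i : Σ k, Fin (N k) => γ i.1 i.2))
          (clusterInc N k₀ (Z s)) (IccExtend Real.two_pi_pos.le w s)) =
      clusterInc N k₀ (confRot (γ k₀) (hessianMap (vortexHam (γ k₀) 0) (Z s)
        (IccExtend hT.le x s))) := fun s => by
    rw [fderiv_gradient_clusterHam hN _ (clusterInc_mem_clusterFree hN (hZ.1.1.1 s)),
      confRot_clusterInc, clusterProj_clusterInc]
    rfl
  have hw' : ∀ t, w t = w0 + clusterInc N k₀ (∫ s in (0 : ℝ)..t,
      confRot (γ k₀) (hessianMap (vortexHam (γ k₀) 0) (Z s) (IccExtend hT.le x s))) := fun t => by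
    rw [hw t, ← hw0, ← ContinuousLinearMap.intervalIntegral_comp_comm _
      (hA.intervalIntegrable _ _)]
    simp only [hint]
  have hx0 : x ⟨0, left_mem_Icc.2 Real.two_pi_pos.le⟩ = clusterProj N k₀ w0 := by rw [hw0]; rfl
  have hxw : x = 0 := by
    refine hZ.eq_zero_of_linearized (hγ k₀) (by rw [hsum]; exact hΓ k₀) hσ (fun t => ?_) ?_ ?_ ?_
    · rw [hx0]
      change clusterProj N k₀ (w t) = _
      rw [hw' t, map_add, clusterProj_clusterInc]
    · rw [hx0, ← hS, clusterPermAct_eq, ← permAct_eq_relabel]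
      rfl
    · have h1 := congrArg (fun b : Conf (Fin m) => b k₀) hq
      simp only [clusterCenter_apply, PiLp.zero_apply, smul_eq_zero, inv_eq_zero, hΓ k₀,
        false_or] at h1
      rw [hx0]
      exact h1
    · rw [hx0, real_inner_comm, ← inner_clusterInc, real_inner_comm]
      exact hi
  ext1 t
  ext1 ⟨k, j⟩
  by_cases h : k = k₀
  · subst h
    exact congrArg (fun y : Conf (Fin (N k)) => y j) (DFunLike.congr_fun hxw t)
  -- The vortex of a trivial cluster does not move under the linearized flow and coincides with its
  -- centre, which was normalized to zero.
  · have h1 := congrArg (fun b : Conf (Fin m) => b k) hq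
    have hsub : Subsingleton (Fin (N k)) := by rw [hN k h]; infer_instance
    simp only [clusterCenter_apply, PiLp.zero_apply, smul_eq_zero, inv_eq_zero, hΓ k,
      false_or] at h1
    rw [Finset.sum_eq_single j (fun j' _ h => absurd (Subsingleton.elim j' j) h)
      (by simp), smul_eq_zero] at h1
    rw [hw' t, PiLp.add_apply, clusterInc_apply_of_ne _ h, h1.resolve_left (hγ k j)]
    simp

end OneCluster

/-! ### Infinitesimal symmetries -/

section Symmetry

/-- The infinitesimal rigid motion `x ↦ s J x + ν`, acting on configurations. -/
def rigidField (ι : Type) [Fintype ι] (p : ℝ × Plane) (z : Conf ι) : Conf ι :=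
  p.1 • confRot 1 z + constConf ι p.2

theorem rigidField_apply {ι : Type} [Fintype ι] (p : ℝ × Plane) (z : Conf ι) (i : ι) :
    rigidField ι p z i = p.1 • rotJL (z i) + p.2 := by
  simp [rigidField]

/-- The infinitesimal rigid motions that leave all vortex Hamiltonians invariant. -/
def infinitesimalSymmetries (Ω : Set Plane) (g : Plane → Plane → ℝ) : Submodule ℝ (ℝ × Plane) where
  -- All finite index types and vorticities are admitted at once, because a symmetry found through
  -- the m-vortex Hessian is later applied to the N-vortex Hamiltonian.
  carrier := {p | ∀ (ι : Type) [Fintype ι] [DecidableEq ι] (c : ι → ℝ), ∀ z ∈ collisionFree ι Ω,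
    inner ℝ (gradient (vortexHam c g) z) (rigidField ι p z) = 0}
  zero_mem' := fun ι _ _ c z _ => by simp [rigidField]
  add_mem' := fun {p p'} hp hp' ι _ _ c z hz => by
    have h : rigidField ι (p + p') z = rigidField ι p z + rigidField ι p' z := by
      simp only [rigidField, Prod.fst_add, Prod.snd_add, map_add]
      module
    rw [h, inner_add_right, hp ι c z hz, hp' ι c z hz, add_zero]
  smul_mem' := fun a p hp ι _ _ c z hz => by
    have h : rigidField ι (a • p) z = a • rigidField ι p z := by
      simp only [rigidField, Prod.smul_fst, Prod.smul_snd, map_smul, smul_eq_mul]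
      module
    rw [h, inner_smul_right, hp ι c z hz, mul_zero]

variable {Ω : Set Plane} {g : Plane → Plane → ℝ}

theorem vortexHam_comp_isometry {ι : Type} [Fintype ι] [DecidableEq ι] {τ : Plane → Plane}
    (hτ : ∀ x y, ‖τ x - τ y‖ = ‖x - y‖) (hτg : ∀ x ∈ Ω, ∀ y ∈ Ω, g (τ x) (τ y) = g x y)
    (c : ι → ℝ) {z z' : Conf ι} (hz : z ∈ collisionFree ι Ω) (hz' : ∀ i, z' i = τ (z i)) :
    vortexHam c g z' = vortexHam c g z := by
  simp only [vortexHam, greenFun, hz', hτ, hτg _ (hz.1 _) _ (hz.1 _)]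

/-- A one-parameter family of symmetries generates an infinitesimal symmetry. -/
theorem mem_infinitesimalSymmetries (hΩ : IsOpen Ω)
    (hg : ContDiffOn ℝ (1 : ℕ) (fun p : Plane × Plane => g p.1 p.2) (Ω ×ˢ Ω))
    {τ : ℝ → Plane → Plane} {p : ℝ × Plane} (hτ0 : ∀ x, τ 0 x = x)
    (hτ : ∀ s x y, ‖τ s x - τ s y‖ = ‖x - y‖)
    (hτg : ∀ s, ∀ x ∈ Ω, ∀ y ∈ Ω, g (τ s x) (τ s y) = g x y)
    (hτd : ∀ x, HasDerivAt (fun s => τ s x) (p.1 • rotJL x + p.2) 0) :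
    p ∈ infinitesimalSymmetries Ω g := by
  intro ι _ _ c z hz
  have h1 : HasDerivAt (fun s => (WithLp.toLp 2 fun i => τ s (z i) : Conf ι))
      (rigidField ι p z) 0 := by
    refine (PiLp.continuousLinearEquiv 2 ℝ fun _ : ι => Plane).symm.hasFDerivAt.comp_hasDerivAt
      (0 : ℝ) (f := fun s i => τ s (z i)) (f' := fun i => rigidField ι p z i)
      (hasDerivAt_pi.2 fun i => ?_)
    rw [rigidField_apply]
    exact hτd (z i)
  have h2 : (WithLp.toLp 2 fun i => τ 0 (z i) : Conf ι) = z := by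
    ext1 i
    exact hτ0 _
  have h3 : HasFDerivAt (vortexHam c g) (fderiv ℝ (vortexHam c g) z)
      (WithLp.toLp 2 fun i => τ 0 (z i) : Conf ι) := by
    rw [h2]
    exact (((contDiffOn_vortexHam hΩ hg c).contDiffAt
      ((isOpen_separated hΩ _).mem_nhds hz)).differentiableAt (by simp)).hasFDerivAt
  have h4 := h3.comp_hasDerivAt (0 : ℝ) h1
  have h5 : (vortexHam c g ∘ fun s => (WithLp.toLp 2 fun i => τ s (z i) : Conf ι)) =
      fun _ => vortexHam c g z := by
    ext1 s
    exact vortexHam_comp_isometry (hτ s) (hτg s) c hz fun i => rfl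
  rw [h5] at h4
  rw [inner_gradient]
  exact h4.unique (hasDerivAt_const _ _)

theorem norm_expJ_sub (s : ℝ) (x y : Plane) : ‖expJ s x - expJ s y‖ = ‖x - y‖ := by
  have h : expJ s x - expJ s y = Real.cos s • (x - y) + Real.sin s • rotJL (x - y) := by
    rw [map_sub]
    simp only [expJ, rotJL_apply]
    module
  have h1 : ‖expJ s x - expJ s y‖ ^ 2 = ‖x - y‖ ^ 2 := by
    rw [h, norm_add_sq_real, inner_smul_left, inner_smul_right, inner_rotJL_self, norm_smul,
      norm_smul, mul_pow, mul_pow, ← real_inner_self_eq_norm_sq (rotJL _), inner_rotJL_rotJL,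
      real_inner_self_eq_norm_sq, Real.norm_eq_abs, Real.norm_eq_abs, sq_abs, sq_abs]
    linear_combination ‖x - y‖ ^ 2 * Real.sin_sq_add_cos_sq s
  exact (pow_left_inj₀ (norm_nonneg _) (norm_nonneg _) two_ne_zero).1 h1

theorem rotation_mem_infinitesimalSymmetries (hΩ : IsOpen Ω)
    (hg : ContDiffOn ℝ (1 : ℕ) (fun p : Plane × Plane => g p.1 p.2) (Ω ×ˢ Ω))
    (hrot : ∀ s : ℝ, ∀ x ∈ Ω, ∀ y ∈ Ω, g (expJ s x) (expJ s y) = g x y) :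
    (1, 0) ∈ infinitesimalSymmetries Ω g := by
  refine mem_infinitesimalSymmetries hΩ hg (τ := expJ) (fun x => by simp [expJ]) norm_expJ_sub hrot
    fun x => ?_
  refine (((Real.hasDerivAt_cos 0).smul_const x).add
    ((Real.hasDerivAt_sin 0).smul_const (rotJ x))).congr_deriv ?_
  simp [rotJL_apply]

theorem translation_mem_infinitesimalSymmetries (hΩ : IsOpen Ω)
    (hg : ContDiffOn ℝ (1 : ℕ) (fun p : Plane × Plane => g p.1 p.2) (Ω ×ˢ Ω)) {ν : Plane}
    (htr : ∀ s : ℝ, ∀ x ∈ Ω, ∀ y ∈ Ω, g (x + s • ν) (y + s • ν) = g x y) :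
    (0, ν) ∈ infinitesimalSymmetries Ω g := by
  refine mem_infinitesimalSymmetries hΩ hg (τ := fun s x => x + s • ν) (fun x => by simp)
    (fun s x y => by simp) htr fun x => ?_
  simpa using ((hasDerivAt_id (0 : ℝ)).smul_const ν).const_add x

variable {ι : Type} [Fintype ι] [DecidableEq ι] {Γ : ι → ℝ} {α : Conf ι}

/-- Infinitesimal symmetries at a critical point are in the kernel of the Hessian. -/
theorem hessianMap_rigidField (hΩ : IsOpen Ω)
    (hg : ContDiffOn ℝ (2 : ℕ) (fun p : Plane × Plane => g p.1 p.2) (Ω ×ˢ Ω))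
    (hα : α ∈ collisionFree ι Ω) (hcrit : gradient (vortexHam Γ g) α = 0) {p : ℝ × Plane}
    (hp : p ∈ infinitesimalSymmetries Ω g) :
    hessianMap (vortexHam Γ g) α (rigidField ι p α) = 0 := by
  have hopen : IsOpen (collisionFree ι Ω) := isOpen_separated hΩ _
  have hH := contDiffOn_vortexHam hΩ hg Γ
  have hd : DifferentiableAt ℝ (gradient (vortexHam Γ g)) α :=
    ((contDiffOn_gradient hopen hH).contDiffAt (hopen.mem_nhds hα)).differentiableAt (by simp)
  have hsymm := inner_fderiv_gradient_comm (H := vortexHam Γ g) (x := α)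
    (by filter_upwards [hopen.mem_nhds hα] with y hy using hH.hasGradientAt hopen two_ne_zero hy) hd
  have hζ : HasFDerivAt (rigidField ι p) (p.1 • confRot 1) α :=
    ((confRot 1).hasFDerivAt.const_smul p.1).add_const _
  refine ext_inner_left ℝ fun β => ?_
  rw [inner_zero_right]
  change inner ℝ β (fderiv ℝ (gradient (vortexHam Γ g)) α _) = 0
  rw [← hsymm]
  -- The identity ⟨∇𝓗, ζ⟩ = 0 is differentiated at α. The term with the derivative of ζ drops out
  -- since ∇𝓗(α) = 0.
  have h1 := (hd.hasFDerivAt.inner ℝ hζ).unique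
    ((hasFDerivAt_const (0 : ℝ) α).congr_of_eventuallyEq (by
      filter_upwards [hopen.mem_nhds hα] with z hz using hp ι Γ z hz))
  have h2 := DFunLike.congr_fun h1 β
  simpa [fderivInnerCLM_apply, hcrit] using h2

/-- If some infinitesimal symmetries span a space of the dimension of the kernel of the Hessian,
they give the kernel. -/
theorem exists_rigidField_of_finrank (hΩ : IsOpen Ω)
    (hg : ContDiffOn ℝ (2 : ℕ) (fun p : Plane × Plane => g p.1 p.2) (Ω ×ˢ Ω))
    (hα : α ∈ collisionFree ι Ω) (hcrit : gradient (vortexHam Γ g) α = 0)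
    {V : Submodule ℝ (ℝ × Plane)} (hV : V ≤ infinitesimalSymmetries Ω g)
    (hinj : ∀ p ∈ V, rigidField ι p α = 0 → p = 0)
    (hdim : Module.finrank ℝ (hessianMap (vortexHam Γ g) α).ker = Module.finrank ℝ V) :
    ∃ C : ℝ, ∀ a, hessianMap (vortexHam Γ g) α a = 0 →
      ∃ p ∈ infinitesimalSymmetries Ω g, a = rigidField ι p α ∧ |p.1| ≤ C * ‖a‖ := by
  let Φ : V →ₗ[ℝ] Conf ι :=
    { toFun := fun p => rigidField ι p.1 α
      map_add' := fun p p' => by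
        simp only [rigidField, Submodule.coe_add, Prod.fst_add, Prod.snd_add, map_add]
        module
      map_smul' := fun a p => by
        simp only [rigidField, Submodule.coe_smul, Prod.smul_fst, Prod.smul_snd, map_smul,
          smul_eq_mul, RingHom.id_apply]
        module }
  have hker : LinearMap.ker Φ = ⊥ := by
    rw [LinearMap.ker_eq_bot']
    exact fun p hp => Subtype.ext (hinj p p.2 hp)
  have hrange : LinearMap.range Φ = (hessianMap (vortexHam Γ g) α).ker := by
    refine Submodule.eq_of_le_of_finrank_eq ?_ ?_
    · rintro _ ⟨p, rfl⟩
      exact hessianMap_rigidField hΩ hg hα hcrit (hV p.2)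
    · rw [hdim, LinearMap.finrank_range_of_inj (LinearMap.ker_eq_bot.1 hker)]
  -- An injective linear map on a finite-dimensional space is bounded below, which controls the
  -- angular speed by the size of the kernel vector.
  obtain ⟨K, -, hK⟩ := Φ.exists_antilipschitzWith hker
  refine ⟨K, fun a ha => ?_⟩
  obtain ⟨p, rfl⟩ : a ∈ LinearMap.range Φ := by rw [hrange]; exact ha
  refine ⟨p, hV p.2, rfl, ?_⟩
  calc |(p : ℝ × Plane).1| = ‖(p : ℝ × Plane).1‖ := rfl
    _ ≤ ‖p‖ := norm_fst_le (p : ℝ × Plane)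
    _ ≤ K * ‖Φ p‖ := by simpa using hK.le_mul_dist p 0

/-- The rotation `J` acting on configurations, as an isometry. -/
def confRotEquiv (ι : Type) [Fintype ι] : Conf ι ≃ₗᵢ[ℝ] Conf ι :=
  LinearIsometry.toLinearIsometryEquiv
    { toLinearMap := (confRot (1 : ι → ℝ) : Conf ι →ₗ[ℝ] Conf ι)
      norm_map' := fun z => by
        have h : ‖confRot (1 : ι → ℝ) z‖ ^ 2 = ‖z‖ ^ 2 := by
          rw [← real_inner_self_eq_norm_sq, ← real_inner_self_eq_norm_sq, PiLp.inner_apply,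
            PiLp.inner_apply]
          simp only [confRot_apply, Pi.one_apply, inv_one, one_smul, inner_rotJL_rotJL]
        exact (pow_left_inj₀ (norm_nonneg _) (norm_nonneg _) two_ne_zero).1 h } rfl

omit [DecidableEq ι] in
theorem confRotEquiv_apply (z : Conf ι) : confRotEquiv ι z = confRot 1 z := rfl

/-- At a rotation invariant critical point at the origin, the kernel of the Hessian is invariant
under `J`. -/
theorem hessianMap_confRot (hΩ : IsOpen Ω)
    (hg : ContDiffOn ℝ (2 : ℕ) (fun p : Plane × Plane => g p.1 p.2) (Ω ×ˢ Ω))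
    (hα : (0 : Conf ι) ∈ collisionFree ι Ω) (hΩrot : ∀ s : ℝ, expJ s '' Ω = Ω)
    (hrot : ∀ s : ℝ, ∀ x ∈ Ω, ∀ y ∈ Ω, g (expJ s x) (expJ s y) = g x y) (y : Conf ι) :
    hessianMap (vortexHam Γ g) 0 (confRot 1 y) = confRot 1 (hessianMap (vortexHam Γ g) 0 y) := by
  have hopen : IsOpen (collisionFree ι Ω) := isOpen_separated hΩ _
  have hH := contDiffOn_vortexHam hΩ hg Γ
  have hJ : ∀ x, expJ (Real.pi / 2) x = rotJL x := fun x => by simp [expJ, rotJL_apply]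
  have hmem : ∀ z ∈ collisionFree ι Ω, confRotEquiv ι z ∈ collisionFree ι Ω := by
    refine fun z hz => ⟨fun i => ?_, fun i j hij h => hz.2 i j hij ?_⟩
    · have h1 : confRotEquiv ι z i = expJ (Real.pi / 2) (z i) := by
        simp [confRotEquiv_apply, hJ]
      rw [h1, ← hΩrot (Real.pi / 2)]
      exact mem_image_of_mem _ (hz.1 i)
    · simp only [confRotEquiv_apply, confRot_apply, Pi.one_apply, inv_one, one_smul] at h
      rw [← sub_eq_zero, ← map_sub, rotJL_eq_zero, sub_eq_zero] at h
      exact h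
  have hgrad : ∀ z ∈ collisionFree ι Ω, gradient (vortexHam Γ g) (confRotEquiv ι z) =
      confRotEquiv ι (gradient (vortexHam Γ g) z) := by
    intro z hz
    refine gradient_equivariant (confRotEquiv ι) ?_ (hH.hasGradientAt hopen two_ne_zero hz)
      (hH.hasGradientAt hopen two_ne_zero (hmem z hz))
    filter_upwards [hopen.mem_nhds hz] with x hx
    exact vortexHam_comp_isometry (norm_expJ_sub (Real.pi / 2)) (hrot _) Γ hx fun i => by
      simp [confRotEquiv_apply, hJ]
  have hd : DifferentiableAt ℝ (gradient (vortexHam Γ g)) 0 :=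
    ((contDiffOn_gradient hopen hH).contDiffAt (hopen.mem_nhds hα)).differentiableAt (by simp)
  have h0 : HasFDerivAt (gradient (vortexHam Γ g)) (hessianMap (vortexHam Γ g) 0)
      (confRot 1 0) := by
    rw [map_zero]
    exact hd.hasFDerivAt
  have h1 := h0.comp 0 (confRot (1 : ι → ℝ)).hasFDerivAt
  have h2 := (confRot (1 : ι → ℝ)).hasFDerivAt.comp 0 hd.hasFDerivAt
  have h3 := h2.congr_of_eventuallyEq (f₁ := gradient (vortexHam Γ g) ∘ confRot 1) (by
    filter_upwards [hopen.mem_nhds hα] with z hz using hgrad z hz)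
  exact DFunLike.congr_fun (h1.unique h3) y

/-- The kernel of the Hessian at an admissible critical point consists of infinitesimal
symmetries. -/
theorem IsAdmissibleCriticalPoint.exists_rigidField [Nonempty ι] (hΩ : IsOpen Ω)
    (hg : ContDiffOn ℝ (2 : ℕ) (fun p : Plane × Plane => g p.1 p.2) (Ω ×ˢ Ω))
    (hα : IsAdmissibleCriticalPoint Ω g Γ α) :
    ∃ C : ℝ, ∀ a, hessianMap (vortexHam Γ g) α a = 0 →
      ∃ p ∈ infinitesimalSymmetries Ω g, a = rigidField ι p α ∧ |p.1| ≤ C * ‖a‖ := by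
  obtain ⟨hα0, hcrit, h⟩ := hα
  have hg1 := hg.of_le (m := (1 : ℕ)) (by norm_num)
  obtain ⟨i₀⟩ := ‹Nonempty ι›
  have hconst : ∀ ν, constConf ι ν = 0 → ν = 0 := fun ν h =>
    congrArg (fun z : Conf ι => z i₀) h
  rcases h with h | ⟨hΩrot, hrot, hdim⟩ | ⟨⟨ν, hν, htr⟩, hdim⟩ | ⟨rfl, ⟨g₀, hg₀⟩, hdim⟩
  · refine exists_rigidField_of_finrank hΩ hg hα0 hcrit (V := ⊥) bot_le (fun p hp _ => ?_) ?_
    · simpa using hp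
    · rw [h, finrank_bot, finrank_bot]
  -- The rotation field must not vanish at α. At α = 0 the Hessian commutes with J, so a
  -- one-dimensional kernel would be J-invariant, which is impossible as Ja is orthogonal to a and
  -- nonzero.
  · have hα' : α ≠ 0 := by
      rintro rfl
      obtain ⟨⟨a, ha⟩, ha0, hspan⟩ := finrank_eq_one_iff'.1 hdim
      have hJa : hessianMap (vortexHam Γ g) 0 (confRot 1 a) = 0 := by
        rw [hessianMap_confRot hΩ hg hα0 hΩrot hrot,
          show hessianMap (vortexHam Γ g) 0 a = 0 from ha, map_zero]
      obtain ⟨t, ht⟩ := hspan ⟨confRot 1 a, hJa⟩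
      have ht' : t • a = confRot 1 a := congrArg Subtype.val ht
      have h1 := inner_confRot (1 : ι → ℝ) a
      rw [← ht', inner_smul_right, mul_eq_zero, inner_self_eq_zero] at h1
      have ha1 : a = 0 := by
        rcases h1 with rfl | h1
        · rw [zero_smul] at ht'
          exact (confRotEquiv ι).map_eq_zero_iff.1 ht'.symm
        · exact h1
      exact ha0 (Subtype.ext ha1)
    have hne : ((1, 0) : ℝ × Plane) ≠ 0 := by simp
    refine exists_rigidField_of_finrank hΩ hg hα0 hcrit (V := Submodule.span ℝ {(1, 0)}) ?_ ?_ ?_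
    · rw [Submodule.span_singleton_le_iff_mem]
      exact rotation_mem_infinitesimalSymmetries hΩ hg1 hrot
    · intro p hp h0
      obtain ⟨t, rfl⟩ := Submodule.mem_span_singleton.1 hp
      simp only [rigidField, Prod.smul_mk, smul_eq_mul, mul_one, smul_zero, map_zero, add_zero,
        smul_eq_zero] at h0
      rcases h0 with rfl | h0
      · simp
      · exact absurd ((confRotEquiv ι).map_eq_zero_iff.1 h0) hα'
    · rw [hdim, finrank_span_singleton hne]
  · have hne : ((0, ν) : ℝ × Plane) ≠ 0 := by simp [hν]
    refine exists_rigidField_of_finrank hΩ hg hα0 hcrit (V := Submodule.span ℝ {(0, ν)}) ?_ ?_ ?_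
    · rw [Submodule.span_singleton_le_iff_mem]
      exact translation_mem_infinitesimalSymmetries hΩ hg1 fun s => (htr s).2
    · intro p hp h0
      obtain ⟨t, rfl⟩ := Submodule.mem_span_singleton.1 hp
      simp only [rigidField, Prod.smul_mk, smul_zero, zero_smul, zero_add] at h0
      rw [Prod.smul_mk, hconst _ h0]
      simp
    · rw [hdim, finrank_span_singleton hne]
  · refine exists_rigidField_of_finrank hΩ hg hα0 hcrit (V := ⊤) ?_ ?_ ?_
    · rintro ⟨s, ν⟩ -
      have h1 := rotation_mem_infinitesimalSymmetries hΩ hg1 fun s x _ y _ => by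
        rw [hg₀, hg₀, norm_expJ_sub]
      have h2 := translation_mem_infinitesimalSymmetries hΩ hg1 (ν := ν) fun s x _ y _ => by
        rw [hg₀, hg₀, add_sub_add_right_eq_sub]
      have h3 := Submodule.add_mem _ (Submodule.smul_mem _ s h1) h2
      simpa using h3
    · rintro ⟨s, ν⟩ - h0
      have hi : ∀ i, s • rotJL (α i) + ν = 0 := fun i => by
        rw [← rigidField_apply (s, ν), h0]
        rfl
      -- A rigid motion with s ≠ 0 has one fixed point only, so m would be 1, and a Hessian on ℝ²
      -- has no three-dimensional kernel.
      have hs : s = 0 := by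
        by_contra hs
        have hsub : Subsingleton ι := by
          refine ⟨fun i j => ?_⟩
          by_contra hij
          refine hα0.2 i j hij ?_
          have h1 := (hi i).trans (hi j).symm
          rw [add_left_inj, ← sub_eq_zero, ← smul_sub, ← map_sub, smul_eq_zero, rotJL_eq_zero,
            sub_eq_zero] at h1
          exact h1.resolve_left hs
        have h1 : Module.finrank ℝ (Conf ι) ≤ 2 := by
          have h2 : Module.finrank ℝ (Conf ι) = Fintype.card ι * 2 := by
            rw [(WithLp.linearEquiv 2 ℝ (ι → Plane)).finrank_eq, Module.finrank_pi_fintype]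
            simp
          rw [h2]
          have := Fintype.card_le_one_iff_subsingleton.2 hsub
          omega
        have h3 := Submodule.finrank_le (hessianMap (vortexHam Γ g) α).ker
        omega
      subst hs
      have := hi i₀
      simp only [zero_smul, zero_add] at this
      simp [this]
    · rw [hdim, finrank_top, Module.finrank_prod, Module.finrank_self, finrank_euclideanSpace_fin]

end Symmetry

/-! ### The system of vortex clusters -/

section VortexSystem

variable {m : ℕ} {N : Fin m → ℕ} {γ : ∀ k, Fin (N k) → ℝ} {σ : ∀ k, Equiv.Perm (Fin (N k))}
  {Ω : Set Plane} {g : Plane → Plane → ℝ} {Γ : Fin m → ℝ} {α : Conf (Fin m)}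

theorem clusterHam_relabel (hσ : ∀ k j, γ k j = γ k ((σ k)⁻¹ j)) (z : Conf (Σ k, Fin (N k))) :
    clusterHam (fun i : Σ k, Fin (N k) => γ i.1 i.2) (relabel (Equiv.sigmaCongrRight σ) z) =
      clusterHam (fun i : Σ k, Fin (N k) => γ i.1 i.2) z := by
  refine pairHam_relabel (fun i => (hσ i.1 i.2).symm) (fun i j => ?_) z
  have h : ∀ i : Σ k, Fin (N k), ((Equiv.sigmaCongrRight σ)⁻¹ i).1 = i.1 := fun i => rfl
  simp only [h, ne_eq, EmbeddingLike.apply_eq_iff_eq]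

theorem regularHam_relabel (hσ : ∀ k j, γ k j = γ k ((σ k)⁻¹ j)) (z : Conf (Σ k, Fin (N k))) :
    regularHam (fun i : Σ k, Fin (N k) => γ i.1 i.2) g (relabel (Equiv.sigmaCongrRight σ) z) =
      regularHam (fun i : Σ k, Fin (N k) => γ i.1 i.2) g z :=
  pairHam_relabel (fun i => (hσ i.1 i.2).symm) (fun _ _ => rfl) z

theorem relabel_mem_clusterFree (σ : ∀ k, Equiv.Perm (Fin (N k))) (z : Conf (Σ k, Fin (N k))) :
    relabel (Equiv.sigmaCongrRight σ) z ∈ clusterFree N ↔ z ∈ clusterFree N := by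
  refine relabel_mem_separated (fun i j => ?_) z
  have h : ∀ i : Σ k, Fin (N k), ((Equiv.sigmaCongrRight σ)⁻¹ i).1 = i.1 := fun i => rfl
  simp only [h, ne_eq, EmbeddingLike.apply_eq_iff_eq]

theorem relabel_mem_regularFree (σ : ∀ k, Equiv.Perm (Fin (N k))) (z : Conf (Σ k, Fin (N k))) :
    relabel (Equiv.sigmaCongrRight σ) z ∈ regularFree N Ω ↔ z ∈ regularFree N Ω :=
  relabel_mem_separated (fun _ _ => Iff.rfl) z

/-- The identity `gradient_regularHam_hatCLM` holds on a neighbourhood of α and may be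
differentiated. -/
theorem fderiv_gradient_regularHam_hatCLM (hΩ : IsOpen Ω)
    (hg : ContDiffOn ℝ (2 : ℕ) (fun p : Plane × Plane => g p.1 p.2) (Ω ×ˢ Ω))
    (hsum : ∀ k, ∑ j, γ k j = Γ k) (hΓ : ∀ k, Γ k ≠ 0) (hα : α ∈ collisionFree (Fin m) Ω)
    (a : Conf (Fin m)) :
    fderiv ℝ (gradient (regularHam (fun i : Σ k, Fin (N k) => γ i.1 i.2) g)) (hatCLM N α)
      (hatCLM N a) = clusterSpread γ Γ (hessianMap (vortexHam Γ g) α a) := by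
  have hopen : IsOpen (collisionFree (Fin m) Ω) := isOpen_separated hΩ _
  have hopen' : IsOpen (regularFree N Ω) := isOpen_separated hΩ _
  have hmem : hatCLM N α ∈ regularFree N Ω := ⟨fun i => hα.1 i.1, fun i j h => hα.2 _ _ h⟩
  have h1 := (((contDiffOn_gradient hopen' (contDiffOn_regularHam hΩ hg
    fun i : Σ k, Fin (N k) => γ i.1 i.2)).contDiffAt
      (hopen'.mem_nhds hmem)).differentiableAt (by simp)).hasFDerivAt.comp α (hatCLM N).hasFDerivAt
  have h2 := (clusterSpread γ Γ).hasFDerivAt.comp α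
    (((contDiffOn_gradient hopen (contDiffOn_vortexHam hΩ hg Γ)).contDiffAt
      (hopen.mem_nhds hα)).differentiableAt (by simp)).hasFDerivAt
  have h3 := h2.congr_of_eventuallyEq
    (f₁ := gradient (regularHam (fun i : Σ k, Fin (N k) => γ i.1 i.2) g) ∘ hatCLM N) (by
      filter_upwards [hopen.mem_nhds hα] with b hb
      exact gradient_regularHam_hatCLM hΩ (hg.of_le (by norm_num)) hsum hΓ hb)
  exact DFunLike.congr_fun (h1.unique h3) a

/-- The first integral that generates an infinitesimal rigid motion. -/
theorem exists_firstIntegral {ι : Type} [Fintype ι] {c : ι → ℝ} (hc : ∀ i, c i ≠ 0)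
    (p : ℝ × Plane) : ∃ I : Conf ι → ℝ, Differentiable ℝ I ∧
      (∀ π : Equiv.Perm ι, (∀ i, c (π⁻¹ i) = c i) → ∀ z, I (relabel π z) = I z) ∧
      ∀ z y, fderiv ℝ I z (confRot c y) = inner ℝ y (rigidField ι p z) := by
  -- These are the angular impulse and the linear impulse, combined with the coefficients of the
  -- rigid motion.
  let L : Conf ι → ℝ := fun z => ∑ i, c i * (-(p.1 / 2) * inner ℝ (z i) (z i) +
    inner ℝ (z i) (rotJL p.2))
  have hproj : ∀ i (z : Conf ι), HasFDerivAt (fun z : Conf ι => z i)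
      (PiLp.proj 2 (fun _ : ι => Plane) i : Conf ι →L[ℝ] Plane) z := fun i z =>
    (PiLp.proj 2 (fun _ : ι => Plane) i : Conf ι →L[ℝ] Plane).hasFDerivAt
  have hd : ∀ z, HasFDerivAt L _ z := fun z => HasFDerivAt.fun_sum (u := Finset.univ) fun i _ =>
    ((((hproj i z).inner ℝ (hproj i z)).const_mul (-(p.1 / 2))).add
      ((hproj i z).inner ℝ (hasFDerivAt_const (rotJL p.2) z))).const_mul (c i)
  refine ⟨L, fun z => (hd z).differentiableAt, fun π hπ z => ?_, fun z y => ?_⟩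
  · simp only [L, relabel_apply]
    rw [← Equiv.sum_comp π⁻¹ fun i => c i * (-(p.1 / 2) * inner ℝ (z i) (z i) +
      inner ℝ (z i) (rotJL p.2))]
    exact Finset.sum_congr rfl fun i _ => by rw [hπ]
  · rw [(hd z).fderiv, PiLp.inner_apply, sum_apply]
    refine Finset.sum_congr rfl fun i _ => ?_
    simp only [smul_apply, add_apply, ContinuousLinearMap.comp_apply,
      ContinuousLinearMap.prod_apply, fderivInnerCLM_apply, PiLp.proj_apply,
      confRot_apply, zero_apply, inner_zero_right, zero_add, smul_eq_mul,
      rigidField_apply, inner_add_right, inner_smul_right, real_inner_smul_left]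
    have h1 : (inner ℝ (rotJL (y i)) (z i) : ℝ) = -inner ℝ (y i) (rotJL (z i)) := by
      rw [inner_rotJL_right, neg_neg]
    rw [real_inner_comm (rotJL (y i)) (z i), h1, inner_rotJL_rotJL]
    field_simp [hc i]
    ring

end VortexSystem

section VortexSystem

variable {m : ℕ} {N : Fin m → ℕ} {γ : ∀ k, Fin (N k) → ℝ} {σ : ∀ k, Equiv.Perm (Fin (N k))}
  {Ω : Set Plane} {g : Plane → Plane → ℝ} {Γ : Fin m → ℝ} {α : Conf (Fin m)}

/-- The same rigid motion acts on the m centres and on all N vortices. Recentred at α̂ its field is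
â plus a rotation of x; ⟨qs a, â⟩ = ‖a‖² because the centre of â is a, and the rotation is an error
of size ‖a‖²‖x‖. -/
theorem exists_symmetry_clusters [NeZero m] (hΩ : IsOpen Ω)
    (hg : ContDiffOn ℝ (2 : ℕ) (fun p : Plane × Plane => g p.1 p.2) (Ω ×ˢ Ω))
    (hΓ : ∀ k, Γ k ≠ 0) (hα : IsAdmissibleCriticalPoint Ω g Γ α)
    (hγ : ∀ k j, γ k j ≠ 0) (hsum : ∀ k, ∑ j, γ k j = Γ k)
    (hσ : ∀ k j, γ k j = γ k ((σ k)⁻¹ j)) :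
    ∃ C : ℝ, ∀ a, hessianMap (vortexHam Γ g) α a = 0 →
      ∃ (I : Conf (Σ k, Fin (N k)) → ℝ) (ξ : Conf (Σ k, Fin (N k)) → Conf (Σ k, Fin (N k))),
      Differentiable ℝ I ∧ (∀ x, I (relabel (Equiv.sigmaCongrRight σ) x) = I x) ∧
      (∀ x y, fderiv ℝ I x (confRot (fun i : Σ k, Fin (N k) => γ i.1 i.2) y) = inner ℝ y (ξ x)) ∧
      (∀ r : ℝ, r ≠ 0 → ∀ b, ∀ v ∈ clusterFree N,
        hatCLM N α + (hatCLM N b + r • v) ∈ regularFree N Ω →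
        inner ℝ (gradient (clusterHam fun i : Σ k, Fin (N k) => γ i.1 i.2) v +
          r • gradient (regularHam (fun i : Σ k, Fin (N k) => γ i.1 i.2) g)
            (hatCLM N α + (hatCLM N b + r • v))) (ξ (hatCLM N b + r • v)) = 0) ∧
      ∀ x, ‖a‖ ^ 2 - C * ‖a‖ ^ 2 * ‖x‖ ≤ inner ℝ (clusterSpread γ Γ a) (ξ x) := by
  obtain ⟨C, hC⟩ := hα.exists_rigidField hΩ hg
  set c : (Σ k, Fin (N k)) → ℝ := fun i => γ i.1 i.2 with hc
  refine ⟨‖clusterSpread γ Γ‖ * (C * ‖confRot (1 : (Σ k, Fin (N k)) → ℝ)‖), fun a ha => ?_⟩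
  obtain ⟨p, hp, hap, hpC⟩ := hC a ha
  obtain ⟨I, hI, hIS, hId⟩ := exists_firstIntegral (c := c) (fun i => hγ i.1 i.2) p
  have hIx : ∀ x, HasFDerivAt (fun x => I (hatCLM N α + x)) (fderiv ℝ I (hatCLM N α + x)) x :=
    fun x => (hI _).hasFDerivAt.comp x ((hasFDerivAt_id x).const_add (hatCLM N α))
  refine ⟨fun x => I (hatCLM N α + x), fun x => rigidField _ p (hatCLM N α + x),
    fun x => (hIx x).differentiableAt, fun x => ?_, fun x y => ?_, ?_, fun x => ?_⟩
  · change I (hatCLM N α + _) = _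
    rw [← relabel_sigmaCongrRight_hatCLM σ α, ← map_add,
      hIS (Equiv.sigmaCongrRight σ) fun i => (hσ i.1 i.2).symm, relabel_sigmaCongrRight_hatCLM]
  · rw [(hIx x).fderiv, hId]
  · intro r hr b v hv hmem
    change inner ℝ _ (rigidField _ p (hatCLM N α + (hatCLM N b + r • v))) = 0
    rw [← add_assoc, ← map_add] at hmem ⊢
    have h1 := gradient_vortexHam_cluster hΩ (hg.of_le (by norm_num)) c hr (α + b) hv hmem
    have h2 := hp _ c (hatCLM N (α + b) + r • v) (by
      rw [← clusterFree_inter_regularFree]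
      exact ⟨(smul_mem_clusterFree hr _).2 hv, hmem⟩)
    rw [h1] at h2
    -- Multiplication by r turns the gradient at scale r into the field of the rescaled system.
    have h3 := congrArg (fun x => r * x) h2
    simp only [mul_zero] at h3
    rw [← real_inner_smul_left, smul_add, smul_smul, mul_inv_cancel₀ hr, one_smul] at h3
    exact h3
  · have h1 : rigidField (Σ k, Fin (N k)) p (hatCLM N α + x) =
        hatCLM N a + p.1 • confRot 1 x := by
      ext1 i
      rw [rigidField_apply, PiLp.add_apply, PiLp.add_apply, hatCLM_apply, hatCLM_apply,
        PiLp.smul_apply, confRot_apply, hap, rigidField_apply]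
      simp only [map_add, Pi.one_apply, inv_one, one_smul]
      module
    have h2 : |inner ℝ (clusterSpread γ Γ a) (p.1 • confRot 1 x)| ≤
        ‖clusterSpread γ Γ‖ * (C * ‖confRot (1 : (Σ k, Fin (N k)) → ℝ)‖) * ‖a‖ ^ 2 * ‖x‖ := by
      refine (abs_real_inner_le_norm _ _).trans ?_
      rw [norm_smul, Real.norm_eq_abs]
      calc ‖clusterSpread γ Γ a‖ * (|p.1| * ‖confRot (1 : (Σ k, Fin (N k)) → ℝ) x‖)
          ≤ (‖clusterSpread γ Γ‖ * ‖a‖) *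
            ((C * ‖a‖) * (‖confRot (1 : (Σ k, Fin (N k)) → ℝ)‖ * ‖x‖)) := by
            have h3 := (confRot (1 : (Σ k, Fin (N k)) → ℝ)).le_opNorm x
            have h4 := (clusterSpread γ Γ).le_opNorm a
            have h5 := (abs_nonneg _).trans hpC
            gcongr
        _ = _ := by ring
    change _ ≤ inner ℝ _ (rigidField _ p (hatCLM N α + x))
    rw [h1, inner_add_right, inner_clusterSpread, clusterCenter_hatCLM hsum hΓ,
      real_inner_self_eq_norm_sq]
    linarith [neg_abs_le (inner ℝ (clusterSpread γ Γ a) (p.1 • confRot 1 x))]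

/-- The vortex system, written as a system with fast and slow
components. -/
def vortexClusterSystem [NeZero m] (hΩ : IsOpen Ω) {k : ℕ} (hk : 2 ≤ k)
    (hg : ContDiffOn ℝ k (fun p : Plane × Plane => g p.1 p.2) (Ω ×ˢ Ω))
    (hΓ : ∀ i, Γ i ≠ 0) (hα : IsAdmissibleCriticalPoint Ω g Γ α)
    (hN₀ : 2 ≤ N 0) (hN : ∀ i, i ≠ 0 → N i = 1)
    (hγ : ∀ i j, γ i j ≠ 0) (hsum : ∀ i, ∑ j, γ i j = Γ i)
    (hσ : ∀ k j, γ k j = γ k ((σ k)⁻¹ j)) {Z : ℝ → Conf (Fin (N 0))}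
    (hZ : IsSigmaNondegenerate (γ 0) (σ 0) Z) :
    ClusterSystem (Conf (Σ k, Fin (N k))) (Conf (Fin m)) where
  Y := confRot fun i : Σ k, Fin (N k) => γ i.1 i.2
  S := relabel (Equiv.sigmaCongrRight σ)
  hat := hatCLM N
  P := clusterSum N
  q := clusterCenter γ Γ
  qs := clusterSpread γ Γ
  YB := confRot Γ
  Q := clusterTwist N
  inner_Y := inner_confRot _
  Y_S := confRot_relabel fun i => (hσ i.1 i.2).symm
  S_hat := relabel_sigmaCongrRight_hatCLM σ
  inner_P := inner_clusterSum
  q_hat := clusterCenter_hatCLM hsum hΓ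
  q_S := clusterCenter_relabel Γ hσ
  inner_qs := inner_clusterSpread γ Γ
  q_Y := clusterCenter_confRot hγ Γ
  P_Q := clusterSum_clusterTwist fun k => by
    by_cases h : k = 0
    · subst h
      omega
    · rw [hN k h]
      exact one_ne_zero
  -- The gradient of a Hamiltonian of class C^k is of class C^{k-1}; Hadamard's lemma takes the
  -- second derivative off.
  n := k - 1
  n_ne_zero := by omega
  H := clusterHam fun i : Σ k, Fin (N k) => γ i.1 i.2
  h := gradient (clusterHam fun i : Σ k, Fin (N k) => γ i.1 i.2)
  U := clusterFree N
  isOpen_U := isOpen_separated isOpen_univ _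
  H_S := clusterHam_relabel hσ
  S_mem_U := relabel_mem_clusterFree σ
  hasGradientAt_H := fun _ hx =>
    (contDiffOn_clusterHam 1 _).hasGradientAt (isOpen_separated isOpen_univ _) one_ne_zero hx
  contDiffOn_h := contDiffOn_gradient (isOpen_separated isOpen_univ _) (contDiffOn_clusterHam _ _)
  P_h := fun _ hx => clusterSum_gradient_clusterHam _ hx
  F := fun y => regularHam (fun i : Σ k, Fin (N k) => γ i.1 i.2) g (hatCLM N α + y)
  f := fun y => gradient (regularHam (fun i : Σ k, Fin (N k) => γ i.1 i.2) g) (hatCLM N α + y)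
  O := {y | hatCLM N α + y ∈ regularFree N Ω}
  isOpen_O := (isOpen_separated hΩ _).preimage (continuous_const.add continuous_id)
  zero_mem_O := by
    change hatCLM N α + 0 ∈ regularFree N Ω
    rw [add_zero]
    exact ⟨fun i => hα.1.1 i.1, fun i j h => hα.1.2 _ _ h⟩
  F_S := fun x => by
    rw [← regularHam_relabel hσ (hatCLM N α + x), map_add, relabel_sigmaCongrRight_hatCLM]
  S_mem_O := fun x => by
    change hatCLM N α + _ ∈ regularFree N Ω ↔ hatCLM N α + x ∈ regularFree N Ω
    rw [← relabel_mem_regularFree σ (hatCLM N α + x), map_add, relabel_sigmaCongrRight_hatCLM]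
  hasGradientAt_F := fun x hx => by
    have h1 := (contDiffOn_regularHam hΩ hg fun i : Σ k, Fin (N k) => γ i.1 i.2).hasGradientAt
      (isOpen_separated hΩ _) (by omega) hx
    exact h1.hasFDerivAt.comp x ((hasFDerivAt_id x).const_add (hatCLM N α))
  contDiffOn_f := by
    have h1 : ContDiffOn ℝ (k - 1 : ℕ)
        (gradient (regularHam (fun i : Σ k, Fin (N k) => γ i.1 i.2) g)) (regularFree N Ω) :=
      contDiffOn_gradient (isOpen_separated hΩ _) (contDiffOn_regularHam hΩ
        (by rwa [Nat.sub_add_cancel (by omega)]) _)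
    exact h1.comp (contDiff_const.add contDiff_id).contDiffOn fun _ hx => hx
  f_zero := by
    change gradient _ (hatCLM N α + 0) = 0
    rw [add_zero, gradient_regularHam_hatCLM hΩ (hg.of_le (by exact_mod_cast (by omega : 1 ≤ k)))
      hsum hΓ hα.1, hα.2.1, map_zero]
  M := hessianMap (vortexHam Γ g) α
  inner_M := by
    have hopen : IsOpen (collisionFree (Fin m) Ω) := isOpen_separated hΩ _
    have hH := contDiffOn_vortexHam hΩ (hg.of_le (m := (2 : ℕ)) (by exact_mod_cast hk)) Γ
    exact inner_fderiv_gradient_comm (H := vortexHam Γ g)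
      (by filter_upwards [hopen.mem_nhds hα.1] with y hy using
        hH.hasGradientAt hopen two_ne_zero hy)
      (((contDiffOn_gradient hopen hH).contDiffAt (hopen.mem_nhds hα.1)).differentiableAt (by simp))
  fderiv_f_hat := fun a => by
    have h1 := fderiv_gradient_regularHam_hatCLM (N := N) hΩ
      (hg.of_le (by exact_mod_cast hk)) hsum hΓ hα.1 a
    rw [fderiv_comp_add_left, add_zero]
    exact h1
  T := 2 * Real.pi
  T_pos := Real.two_pi_pos
  Z := fun t => clusterInc N 0 (Z t)
  Z_mem := fun t => clusterInc_mem_clusterFree hN (hZ.1.1.1 t)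
  hasDerivAt_Z := fun t => by
    rw [gradient_clusterHam_clusterInc hN _ (hZ.1.1.1 t)]
    exact (clusterInc N 0).hasFDerivAt.comp_hasDerivAt t (hZ.1.1.hasDerivAt (hγ 0) t)
  S_Z := fun t => by rw [relabel_clusterInc, hZ.2.1]
  q_Z := fun t => clusterCenter_clusterInc γ Γ (hZ.1.sum_smul_eq_zero (hγ 0) t)
  inner_Q_Z := fun t => by
    obtain ⟨ω, hω, h⟩ := hZ.1.exists_confRot (hγ 0)
    rw [gradient_clusterHam_clusterInc hN _ (hZ.1.1.1 t), h]
    exact inner_clusterTwist_ne_zero hN₀ (hZ.1.1.1 t) hω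
  nondegenerate := fun w h1 h2 h3 h4 =>
    eq_zero_of_linearized_clusterHam hN₀ hN hγ hsum hΓ (hσ 0) hZ h1 h2 h3 (by
      rwa [gradient_clusterHam_clusterInc hN _ (hZ.1.1.1 0)] at h4)
  C := (exists_symmetry_clusters hΩ (hg.of_le (by exact_mod_cast hk)) hΓ hα hγ hsum hσ).choose
  symmetry :=
    (exists_symmetry_clusters hΩ (hg.of_le (by exact_mod_cast hk)) hΓ hα hγ hsum hσ).choose_spec

end VortexSystem

/-! ### From the boundary value problem to a curve in H¹. -/

namespace ClusterSystem

variable {E B : Type} [NormedAddCommGroup E] [InnerProductSpace ℝ E]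
    [CompleteSpace E] [NormedAddCommGroup B] [InnerProductSpace ℝ B] [FiniteDimensional ℝ E]
    [FiniteDimensional ℝ B] (D : ClusterSystem E B)

/-- The continuation of the orbit `Z` as a curve of periodic functions. -/
theorem exists_hOne_curve {P : ℝ} [Fact (0 < P)] {ν : ℕ} (hS : D.S ^ ν = 1) (hP : P = D.T * ν) :
    ∃ r₁ : ℝ, 0 < r₁ ∧ ∃ u : ℝ → HOne P E,
      ContDiffOn ℝ (D.n - 1 : ℕ) u (Ico 0 r₁) ∧ (∀ t, u 0 t = D.Z t) ∧
      (∀ r ∈ Ico 0 r₁, ∀ t, D.S (u r (t + D.T)) = u r t) ∧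
      (∀ r ∈ Ioo 0 r₁, ∃ (c : B) (y : ℝ → E), (∀ t, u r t = D.hat c + y t) ∧
        ∀ t, y t ∈ D.U ∧ D.hat (r • c) + r • y t ∈ D.O ∧
          HasDerivAt y (D.Y (D.h (y t) + r • D.f (D.hat (r • c) + r • y t))) t) ∧
      (2 ≤ D.n → ∃ c, ∀ t, derivWithin u (Ico 0 r₁) 0 t = D.hat c) := by
  have : CompleteSpace B := FiniteDimensional.complete ℝ B
  obtain ⟨b, v, w, hb, hv, hw, hb', hv', hw', hb0, hv0, hev⟩ := D.exists_continuation
  obtain ⟨n, hn⟩ := Nat.exists_eq_succ_of_ne_zero D.n_ne_zero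
  obtain ⟨a, ha, ha0, hba⟩ := exists_contDiffAt_smul (n := n) (b := b)
    (by rw [Nat.succ_eq_add_one] at hn; rw [← hn]; exact hb) hb0
  rw [hb'.deriv] at ha0
  have hn' : D.n - 1 = n := by omega
  have hnD : ((n : ℕ) : WithTop ℕ∞) ≤ (D.n : ℕ) := by exact_mod_cast (by omega : n ≤ D.n)
  let L := hOneCLM D.T_pos D.S hS hP
  let ev : C(Icc (0 : ℝ) D.T, E) →L[ℝ] E := ContinuousMap.evalCLM ℝ D.tzero
  -- The element of H¹ is built by a bounded linear map from its value at 0 and its derivative on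
  -- [0, T], so its regularity in r is that of a, v and w. Dividing b by r to get a is what lowers
  -- the class to n - 1.
  obtain ⟨u, hu⟩ : ∃ u : ℝ → HOne P E, u = fun r => L (D.hat (a r) + ev (v r), w r) := ⟨_, rfl⟩
  have hucont : ContDiffAt ℝ n u 0 := by
    rw [hu]
    exact L.contDiff.comp_contDiffAt 0 (((D.hat.contDiff.comp_contDiffAt 0 ha).add
      (ev.contDiff.comp_contDiffAt 0 (hv.of_le hnD))).prodMk (hw.of_le hnD))
  obtain ⟨V, hV, hVu⟩ := hucont.contDiffOn le_rfl (by simp)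
  obtain ⟨r₁, hr₁, hball⟩ := Metric.eventually_nhds_iff_ball.1
    ((eventually_mem_set.2 hV).and (hev.and hba))
  have hmem : ∀ r ∈ Ico 0 r₁, r ∈ Metric.ball (0 : ℝ) r₁ := fun r hr => by
    rw [Metric.mem_ball, Real.dist_eq, sub_zero, abs_of_nonneg hr.1]
    exact hr.2
  have hut : ∀ r ∈ Ico 0 r₁, ∀ t, u r t = D.hat (a r) +
      twistPrimitive D.T_pos D.S (w r) (v r D.tzero) t := fun r hr t => by
    obtain ⟨-, ⟨h1, h2, -⟩, -⟩ := hball r (hmem r hr)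
    rw [hu]
    exact hOneCLM_eq_twistPrimitive D.T_pos D.S hS hP h1 h2 (D.hat (a r)) t
  have hSS : ∀ x, D.S (D.S⁻¹ x) = x := fun x => D.S.apply_symm_apply x
  have hsol : ∀ r ∈ Ico 0 r₁, ∀ t,
      (twistPrimitive D.T_pos D.S (w r) (v r D.tzero) t ∈ D.U ∧
        D.hat (b r) + r • twistPrimitive D.T_pos D.S (w r) (v r D.tzero) t ∈ D.O) ∧
      HasDerivAt (twistPrimitive D.T_pos D.S (w r) (v r D.tzero))
        (D.Y (D.h (twistPrimitive D.T_pos D.S (w r) (v r D.tzero) t) +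
          r • D.f (D.hat (b r) + r • twistPrimitive D.T_pos D.S (w r) (v r D.tzero) t))) t := by
    intro r hr t
    obtain ⟨-, ⟨h1, h2, h3⟩, -⟩ := hball r (hmem r hr)
    have hSO : ∀ y, D.hat (b r) + r • D.S y = D.S (D.hat (b r) + r • y) := fun y => by
      rw [map_add, D.S_hat, map_smul]
    let 𝒟 : Set E := {y | y ∈ D.U ∧ D.hat (b r) + r • y ∈ D.O}
    let W : E → E := fun y => D.Y (D.h y + r • D.f (D.hat (b r) + r • y))
    have hWS : ∀ y ∈ 𝒟, W (D.S y) = D.S (W y) := fun y hy => by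
      change D.Y (D.h (D.S y) + r • D.f (D.hat (b r) + r • D.S y)) = _
      rw [hSO, D.h_S hy.1, D.f_S hy.2, ← map_smul, ← map_add, D.Y_S]
    have h𝒟 : ∀ y ∈ 𝒟, D.S y ∈ 𝒟 := fun y hy => by
      refine ⟨(D.S_mem_U y).2 hy.1, ?_⟩
      rw [hSO]
      exact (D.S_mem_O _).2 hy.2
    have h𝒟' : ∀ y ∈ 𝒟, D.S⁻¹ y ∈ 𝒟 := fun y hy => by
      refine ⟨(D.S_mem_U _).1 (by rw [hSS]; exact hy.1), (D.S_mem_O _).1 ?_⟩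
      rw [← hSO, hSS]
      exact hy.2
    have hWc : ContinuousOn W 𝒟 := by
      have h4 : ContinuousOn D.h 𝒟 := D.contDiffOn_h.continuousOn.mono fun y hy => hy.1
      have h5 : ContinuousOn (fun y => D.f (D.hat (b r) + r • y)) 𝒟 :=
        D.contDiffOn_f.continuousOn.comp (by fun_prop) fun y hy => hy.2
      exact D.Y.continuous.comp_continuousOn (h4.add (h5.const_smul r))
    refine hasDerivAt_twistPrimitive (W := fun _ => W) D.T_pos D.S (w r) h1 h2 h𝒟 h𝒟' ?_ ?_
      (fun t => ⟨(h3 t).1, (h3 t).2.1⟩) (fun t => (h3 t).2.2) t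
    · exact hWc.comp continuous_snd.continuousOn fun p hp => hp.2
    · intro _ y hy
      refine D.S.injective ?_
      rw [hSS, ← hWS _ (h𝒟' y hy), hSS]
  refine ⟨r₁, hr₁, u, ?_, fun t => ?_, fun r hr t => ?_, fun r hr => ?_, fun h2 => ?_⟩
  · rw [hn']
    exact hVu.mono fun r hr => (hball r (hmem r hr)).1
  · have h0 : (0 : ℝ) ∈ Ico 0 r₁ := left_mem_Ico.2 hr₁
    obtain ⟨-, ⟨h1, h2, -⟩, -⟩ := hball 0 (hmem 0 h0)
    rw [hut 0 h0, ha0, map_zero, zero_add]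
    have hper := twistPrimitive_add_period D.T_pos D.S (w 0) h1 h2
    have hZper : ∀ t, D.Z (t + D.T) = D.S⁻¹ (D.Z t) := fun t => by
      refine D.S.injective ?_
      rw [D.S_Z, hSS]
    have hIcc : ∀ t ∈ Icc 0 D.T,
        twistPrimitive D.T_pos D.S (w 0) (v 0 D.tzero) t = D.Z t := fun t ht => by
      rw [twistPrimitive_of_mem D.T_pos D.S (w 0) h1 ht, hv0]
      rfl
    -- Both curves are twisted by the same isometry, so their distance is T-periodic and need only
    -- vanish on [0, T).
    have hdiff : Function.Periodic (fun t => ‖twistPrimitive D.T_pos D.S (w 0) (v 0 D.tzero) t -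
        D.Z t‖) D.T := fun t => by
      simp only [hper, hZper, ← map_sub, LinearIsometryEquiv.norm_map]
    obtain ⟨s, hs, hst⟩ := hdiff.exists_mem_Ico₀ D.T_pos t
    simp only [hIcc s (Ico_subset_Icc_self hs), sub_self, norm_zero] at hst
    exact sub_eq_zero.1 (norm_eq_zero.1 hst)
  · obtain ⟨-, ⟨h1, h2, -⟩, -⟩ := hball r (hmem r hr)
    rw [hut r hr, hut r hr, map_add, D.S_hat, twistPrimitive_add_period D.T_pos D.S (w r) h1 h2,
      hSS]
  · have hr' := Ioo_subset_Ico_self hr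
    obtain ⟨-, -, hbr⟩ := hball r (hmem r hr')
    refine ⟨a r, _, hut r hr', fun t => ?_⟩
    rw [← hbr]
    exact ⟨(hsol r hr' t).1.1, (hsol r hr' t).1.2, (hsol r hr' t).2⟩
  · have had : HasDerivAt a (deriv a 0) 0 :=
      (ha.differentiableAt (by
        have : n ≠ 0 := by omega
        exact_mod_cast this)).hasDerivAt
    -- v and w have zero derivative at r = 0, so only the constant part of u varies to first order.
    have hud : HasDerivAt u (L (D.hat (deriv a 0) + ev 0, 0)) 0 := by
      rw [hu]
      exact L.hasFDerivAt.comp_hasDerivAt (0 : ℝ)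
        (((D.hat.hasFDerivAt.comp_hasDerivAt (0 : ℝ) had).add
        (ev.hasFDerivAt.comp_hasDerivAt (0 : ℝ) hv')).prodMk hw')
    refine ⟨deriv a 0, fun t => ?_⟩
    rw [hud.hasDerivWithinAt.derivWithin (uniqueDiffOn_Ico 0 r₁ 0 (left_mem_Ico.2 hr₁)), map_zero,
      add_zero]
    exact hOneCLM_const D.T_pos D.S hS hP _ t

end ClusterSystem
end

/-! ### Undoing the rescaling for the vortex system. -/

theorem theorem3 {m : ℕ} [NeZero m]
    -- the domain `Ω` and the symmetric function `g`
    (Ω : Set Plane) (hΩo : IsOpen Ω) (hΩc : IsConnected Ω)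
    (g : Plane → Plane → ℝ) (hgs : ∀ x ∈ Ω, ∀ y ∈ Ω, g x y = g y x)
    (k : ℕ) (hk : 2 ≤ k)
    (hg : ContDiffOn ℝ k (fun p : Plane × Plane => g p.1 p.2) (Ω ×ˢ Ω))
    -- the critical point `α` of the `m`-vortex system
    (Γ : Fin m → ℝ) (hΓ : ∀ i, Γ i ≠ 0)
    (α : Conf (Fin m)) (hα : IsAdmissibleCriticalPoint Ω g Γ α)
    -- only the first vortex is split, and the vorticities add up
    (N : Fin m → ℕ) (hN₀ : 2 ≤ N 0) (hN : ∀ i, i ≠ 0 → N i = 1)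
    (γ : ∀ i, Fin (N i) → ℝ) (hγ : ∀ i j, γ i j ≠ 0) (hsum : ∀ i, ∑ j, γ i j = Γ i)
    -- the relative equilibrium of the first cluster, the other clusters being trivial
    (σ : ∀ i, Equiv.Perm (Fin (N i))) (hσ : ∀ j, γ 0 j = γ 0 ((σ 0)⁻¹ j))
    (Z : ∀ i, ℝ → Conf (Fin (N i)))
    (hZ₀ : ∃ ε : ℝ, (ε = 1 ∨ ε = -1) ∧ ∃ z₀ : Conf (Fin (N 0)),
      Z 0 = rigidRotation (ε / orderOf (σ 0)) z₀)
    (hZnd : IsSigmaNondegenerate (γ 0) (σ 0) (Z 0))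
    (hZ : ∀ i, i ≠ 0 → Z i = 0) :
    ∃ r₁ : ℝ, 0 < r₁ ∧ ∃ u : ℝ → HOne (tauPeriod σ) (Conf (Σ i, Fin (N i))),
      ContDiffOn ℝ (k - 2 : ℕ) u (Set.Ico 0 r₁) ∧
      (∀ t, u 0 t = joinConf fun i => Z i t) ∧
      (∀ r ∈ Set.Ico 0 r₁, ∀ t, clusterPermAct σ (u r (t + 2 * Real.pi)) = u r t) ∧
      (∀ r ∈ Set.Ioo 0 r₁,
        IsVortexSolution Ω (fun i : (Σ i, Fin (N i)) => γ i.1 i.2) g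
          (fun t => r • u r (t / r ^ 2) + hatConf N α) ∧
        Function.Periodic (fun t => r • u r (t / r ^ 2) + hatConf N α) (tauPeriod σ * r ^ 2)) ∧
      (3 ≤ k → ∃ a : Conf (Fin m), ∀ t, derivWithin u (Set.Ico 0 r₁) 0 t = hatConf N a) := by
  have hσ' : ∀ k j, γ k j = γ k ((σ k)⁻¹ j) := by
    intro i j
    by_cases h : i = 0
    · subst h
      exact hσ j
    · have : Subsingleton (Fin (N i)) := by rw [hN i h]; infer_instance
      rw [Subsingleton.elim ((σ i)⁻¹ j) j]
  let D := vortexClusterSystem hΩo hk hg hΓ hα hN₀ hN hγ hsum hσ' hZnd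
  obtain ⟨r₁, hr₁, u, hu, hu0, huS, hsol, hder⟩ := D.exists_hOne_curve (P := tauPeriod σ)
    (ν := orderOf σ) (relabel_sigmaCongrRight_pow_orderOf σ) rfl
  have hg1 : ContDiffOn ℝ (1 : ℕ) (fun p : Plane × Plane => g p.1 p.2) (Ω ×ˢ Ω) :=
    hg.of_le (by exact_mod_cast (by omega : 1 ≤ k))
  refine ⟨r₁, hr₁, u, ?_, fun t => ?_, fun r hr t => ?_, fun r hr => ⟨?_, fun t => ?_⟩,
    fun hk3 => hder (by change 2 ≤ k - 1; omega)⟩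
  · have hn : k - 2 = D.n - 1 := by change k - 2 = k - 1 - 1; omega
    rw [hn]
    exact hu
  · rw [hu0]
    exact (joinConf_eq_clusterInc (Z := fun i => Z i t) fun i hi => by rw [hZ i hi]; rfl).symm
  · rw [← clusterPermAct_eq]
    exact huS r hr t
  · obtain ⟨c, y, huy, hy⟩ := hsol r hr
    set κ : (Σ i, Fin (N i)) → ℝ := fun i => γ i.1 i.2 with hκ
    have hr0 : r ≠ 0 := hr.1.ne'
    -- The constant part of u is absorbed into the centres α + rc, about which y is rescaled by r.
    have hz : ∀ t, r • u r (t / r ^ 2) + hatConf N α =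
        hatCLM N (α + r • c) + r • y (t / r ^ 2) := fun t => by
      rw [huy, ← hatCLM_eq, map_add, map_smul, smul_add]
      change r • hatCLM N c + _ + _ = _
      abel
    have hU : ∀ t, y t ∈ clusterFree N := fun t => (hy t).1
    have hO : ∀ t, hatCLM N (α + r • c) + r • y t ∈ regularFree N Ω := fun t => by
      rw [map_add, add_assoc]
      exact (hy t).2.1
    have hgrad := fun t => gradient_vortexHam_cluster hΩo hg1 κ hr0 (α + r • c) (hU t) (hO t)
    have hzd : ∀ t, HasDerivAt (fun t => r • u r (t / r ^ 2) + hatConf N α)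
        (confRot κ (gradient (vortexHam κ g) (r • u r (t / r ^ 2) + hatConf N α))) t := by
      intro t
      have h1 : HasDerivAt y (confRot κ (gradient (clusterHam κ) (y (t / r ^ 2)) +
          r • gradient (regularHam κ g) (hatCLM N (α + r • c) + r • y (t / r ^ 2))))
          (t / r ^ 2) := by
        have := (hy (t / r ^ 2)).2.2
        rw [map_add (hatCLM N), add_assoc]
        exact this
      have h2 : HasDerivAt (fun t : ℝ => t / r ^ 2) (1 / r ^ 2) t :=
        (hasDerivAt_id t).div_const _
      have h3 := ((h1.scomp t h2).const_smul r).const_add (hatCLM N (α + r • c))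
      -- The factor r · r⁻² = r⁻¹ from scaling space and time turns h + r f into r⁻¹h + f, the
      -- gradient of the full Hamiltonian at clusters of size r.
      refine (h3.congr_of_eventuallyEq (Filter.Eventually.of_forall hz)).congr_deriv ?_
      rw [hz, hgrad, ← map_smul, ← map_smul, smul_smul]
      congr 1
      rw [smul_add, smul_smul]
      congr 2
      · field_simp
      · field_simp
        rw [one_smul]
    refine ⟨fun t => ?_, fun t => (hzd t).differentiableAt, fun t i => ?_⟩
    · change r • u r (t / r ^ 2) + hatConf N α ∈ _
      rw [hz, ← clusterFree_inter_regularFree]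
      exact ⟨(smul_mem_clusterFree hr0 _).2 (hU _), hO _⟩
    · rw [(hzd t).deriv, confRot_apply, smul_smul, mul_inv_cancel₀ (hγ i.1 i.2), one_smul,
        rotJL_apply]
  · have hr0 : r ≠ 0 := hr.1.ne'
    have h1 : (t + tauPeriod σ * r ^ 2) / r ^ 2 = t / r ^ 2 + tauPeriod σ := by
      field_simp
    simp only [h1, (u r).periodic (t / r ^ 2)]
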